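/- **Setting.** In a single-hop radio network time is divided into slots; in each slot each device transmits a message (of unbounded size), listens, or stays idle. Transmitting and listening cost one unit of energy each; local computation is free. A listener hears the message if exactly one device transmits and silence if none does. If two or more transmit, a listener hears noise in the models Strong-CD and Receiver-CD, and silence in Sender-CD and No-CD. In Strong-CD and Sender-CD a transmitter hears what a listener would hear; in Receiver-CD and No-CD it receives no signal. The time and energy of an execution are the maxima over all devices. *A leader is elected* means that, when all devices have halted, exactly one is designated leader and all others are designated followers; *no leader is elected* means that all are followers. Let $\alpha(x)=\min\{k\ge 1: A(k,k)\ge x\}$ with $A$ the Ackermann function. **Dense Census.** A dense Census algorithm with parameter $c$ is a family, indexed by $N\ge 1$, of deterministic No-CD algorithms for devices with distinct IDs in $\{0,\dots,N-1\}$, in which two devices never transmit in the same slot, and which, whenever at least $cN$ devices are present, elects a leader that knows the list of all IDs present and announces it in the last slot while all other devices listen, in $O(N)$ time with $O(\alpha(N))$ energy. **Algorithm Test-Network-Size$(\tilde n)$.** It is run by $n$ identical devices without IDs, which have independent private random bits and know $\tilde n$ but not $n$. Let $N=\lceil K\log\tilde n\rceil$. 1. *ID assignment in Strong-CD and Sender-CD*: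 in each of $N$ slots each device transmits with probability $1/\tilde n$; a device that hears its own message in the $i$-th slot takes ID $i$. *ID assignment in Receiver-CD and No-CD*: there are $2N$ such slots, numbered $0,\dots,2N-1$, and ID $i\in\{0,\dots,N-1\}$ is taken by a device $u$ if $u$ is the only device transmitting in slot $2i$ and some other device is the only one transmitting in slot $2i+1$. This is verified in two additional slots for each $i$: in the first the transmitters of slot $2i$ speak and the other transmitters of slot $2i+1$ listen; in the second those listeners that received a message speak, and the devices that transmitted in slot $2i$ but not in slot $2i+1$ listen, and take ID $i$ if they receive a message. In all models the random choices are made in advance, and a device selected to transmit in at least $\beta$ of these slots does not participate: it never transmits or listens, and it ends as a follower. 2. A dense Census algorithm with parameter $c$ is run on ID space $\{0,\dots,N-1\}$ by the devices that took an ID, where $c=0.325$ in Strong-CD and Sender-CD, and $c=0.325^2$ in Receiver-CD and No-CD. A device with several IDs simulates one device for each of them. A leader whose list has fewer than $cN$ IDs resets itself to follower. All other devices are followers. **Theorem.** For each of the four collision detection models there are a dense Census algorithm with the parameter $c$ above and constants $K,C,\varepsilon>0$ and $\beta\in\mathbb N$ such that for all integers $n\ge 1$ and all real $\tilde n\ge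 100$, with probability at least $1-\min\{n^{-\varepsilon},\tilde n^{-\varepsilon}\}$, Test-Network-Size$(\tilde n)$ run by $n$ devices halts on all devices within time $C\log\tilde n$ and with energy at most $C\,\alpha(\tilde n)$ for every device, and - if $n/1.5\le\tilde n\le 1.5\,n$, then a leader is elected; - if $\tilde n\ge 1.9\,n$ or $\tilde n\le n/1.9$, then no leader is elected. -/

import Mathlib

namespace RadioNetwork

/-! ### The single-hop radio network -/

/-- The four collision detection models. -/
inductive CDModel where
  | strongCD
  | senderCD
  | receiverCD
  | noCD

/-- What a device does in one time slot; `M` is the message space. -/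
inductive Action (M : Type) where
  | idle
  | listen
  | transmit (m : M)

/-- What a device hears in one time slot; `nothing` means that it receives no signal at all. -/
inductive Signal (M : Type) where
  | nothing
  | silence
  | noise
  | message (m : M)

/-- Listening and transmitting cost one unit of energy, idling is free. -/
def Action.cost {M : Type} : Action M → ℕ
  | .idle => 0
  | .listen => 1
  | .transmit _ => 1

/-- Device `i` transmits `m` and no other device transmits. -/
def IsSoleTransmitter {ι M : Type} (a : ι → Action M) (i : ι) (m : M) : Prop :=
  a i = .transmit m ∧ ∀ j, j ≠ i → ∀ m', a j ≠ .transmit m'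

open Classical in
/-- The true state of the channel when each device `i` performs `a i`: the message if exactly one
device transmits, noise if at least two do, silence if none does. -/
noncomputable def channel {ι M : Type} (a : ι → Action M) : Signal M :=
  if h : ∃ m i, IsSoleTransmitter a i m then .message h.choose
  else if ∃ i m, a i = .transmit m then .noise
  else .silence

/-- In the models that do not distinguish noise from silence, noise is heard as silence. -/
def CDModel.perceive {M : Type} : CDModel → Signal M → Signal M
  | .senderCD, .noise => .silence
  | .noCD, .noise => .silence
  | _, s => s

/-- The signal that a device performing action `b` receives when the true state of the channel
is `ch`: senders hear the channel only in the first two models. -/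
def CDModel.hear {M : Type} (c : CDModel) (ch : Signal M) (b : Action M) : Signal M :=
  match b, c with
  | .idle, _ => .nothing
  | .listen, c => c.perceive ch
  | .transmit _, .strongCD => CDModel.strongCD.perceive ch
  | .transmit _, .senderCD => CDModel.senderCD.perceive ch
  | .transmit _, .receiverCD => .nothing
  | .transmit _, .noCD => .nothing

/-- A protocol, run by all devices alike. A device starts from its private input in `X` (its ID in
the deterministic setting, its random bits in the randomized setting). In each slot its local state
determines an action, or says that the device has halted with an output in `O`; the signal that it
receives then updates the state. Local computation is free and unrestricted. -/
structure Protocol (X M O : Type) where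
  State : Type
  init : X → State
  next : State → Action M ⊕ O
  update : State → Signal M → State

namespace Protocol

variable {X M O Y : Type}

/-- A halted device stays idle. -/
def action (P : Protocol X M O) (s : P.State) : Action M :=
  match P.next s with
  | .inl a => a
  | .inr _ => .idle

/-- One step of a single device; a halted device keeps its state. -/
def step (P : Protocol X M O) (s : P.State) (sig : Signal M) : P.State :=
  match P.next s with
  | .inl _ => P.update s sig
  | .inr _ => s

/-- The states of all devices after `t` time slots, device `i` having private input `x i`. -/
noncomputable def run (P : Protocol X M O) (c : CDModel) {ι : Type} (x : ι → X) :
    ℕ → ι → P.State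
  | 0 => fun i => P.init (x i)
  | t + 1 => fun i =>
      P.step (P.run c x t i)
        (c.hear (channel fun j => P.action (P.run c x t j)) (P.action (P.run c x t i)))

/-- The action of device `i` in time slot `t` (slots are numbered from `0`). -/
noncomputable def actionAt (P : Protocol X M O) (c : CDModel) {ι : Type} (x : ι → X)
    (t : ℕ) (i : ι) : Action M :=
  P.action (P.run c x t i)

/-- After `t` time slots device `i` has halted with output `o`. -/
def OutputAt (P : Protocol X M O) (c : CDModel) {ι : Type} (x : ι → X)
    (t : ℕ) (i : ι) (o : O) : Prop :=
  P.next (P.run c x t i) = .inr o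

/-- The energy spent by device `i` in the first `T` time slots. -/
noncomputable def energy (P : Protocol X M O) (c : CDModel) {ι : Type} (x : ι → X)
    (T : ℕ) (i : ι) : ℕ :=
  ∑ t ∈ Finset.range T, (P.actionAt c x t i).cost

/-- Start the second protocol from the output of the first if the first has halted. -/
def handOver (P : Protocol X M Y) (Q : Protocol Y M O) (s : P.State) : P.State ⊕ Q.State :=
  match P.next s with
  | .inl _ => .inl s
  | .inr y => .inr (Q.init y)

/-- Sequential composition: when a device halts in `P` with output `y`, it continues with `Q` on
input `y` in the next time slot. -/
def seq (P : Protocol X M Y) (Q : Protocol Y M O) : Protocol X M O where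
  State := P.State ⊕ Q.State
  init x := handOver P Q (P.init x)
  next
    | .inl s => .inl (P.action s)
    | .inr s => Q.next s
  update
    | .inl s, sig => handOver P Q (P.update s sig)
    | .inr s, sig => .inr (Q.update s sig)

end Protocol

/-! ### Inverse Ackermann function and dense Census -/

/-- The inverse Ackermann function: the least `k ≥ 1` with `x ≤ A(k, k)`. -/
noncomputable def invAck (x : ℝ) : ℕ :=
  sInf {k : ℕ | 1 ≤ k ∧ x ≤ (ack k k : ℝ)}

/-- An algorithm for Leader Election and Census on the ID space `{0, …, N - 1}`, for every `N`.
A device ends as the leader with a list `I` of IDs (output `some I`), or as a follower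
(output `none`). -/
abbrev CensusFamily (M : Type) : Type 1 :=
  ∀ N : ℕ, Protocol (Fin N) M (Option (Finset (Fin N)))

/-- The execution, with devices having exactly the IDs in `S`, solves Leader Election and Census in
`T` time slots: one device designates itself the leader and holds the list of all IDs, all others
designate themselves followers, and in the last slot the leader announces the list while all others
listen. The function `read` extracts the list from a message. -/
def SolvesCensus {M : Type} {N : ℕ} (P : Protocol (Fin N) M (Option (Finset (Fin N))))
    (read : M → Finset (Fin N)) (S : Finset (Fin N)) (T : ℕ) : Prop :=
  let x : S → Fin N := Subtype.val
  ∃ s : S, P.OutputAt .noCD x T s (some S) ∧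
    (∀ i, i ≠ s → P.OutputAt .noCD x T i none) ∧
    ∃ t m, T = t + 1 ∧ P.actionAt .noCD x t s = .transmit m ∧ read m = S ∧
      ∀ i, i ≠ s → P.actionAt .noCD x t i = .listen

/-- `D` is a deterministic `No-CD` algorithm that, whenever at least `c * N` of the `N` possible
devices are present, solves Leader Election and Census in time `O(N)` with energy `O(α(N))`.
It never lets two devices transmit in the same time slot. -/
def IsDenseCensus {M : Type} (c : ℝ) (D : CensusFamily M) : Prop :=
  ∃ (C : ℝ) (read : ∀ N : ℕ, M → Finset (Fin N)), ∀ N : ℕ, 1 ≤ N → ∀ S : Finset (Fin N),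
    (∀ (t : ℕ) (i j : S) (m m' : M),
      (D N).actionAt .noCD (Subtype.val : S → Fin N) t i = .transmit m →
      (D N).actionAt .noCD (Subtype.val : S → Fin N) t j = .transmit m' → i = j) ∧
    (c * N ≤ S.card → ∃ T : ℕ, (T : ℝ) ≤ C * N ∧ SolvesCensus (D N) (read N) S T ∧
      ∀ i : S, ((D N).energy .noCD (Subtype.val : S → Fin N) T i : ℝ) ≤ C * invAck N)

/-! ### Assigning IDs

Before the start each device tosses a coin for every slot in which it may have to transmit; these
slots are its tasks. A device with at least `β` tasks does not participate. In this phase the only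
message ever sent is the contentless message `none`. -/

open Classical in
/-- The slots in which a device transmits: those selected by its coins if these are fewer than `β`,
otherwise none. -/
noncomputable def tasks {L : ℕ} (β : ℕ) (coins : Fin L → Bool) : Finset ℕ :=
  let sel := (Finset.univ.filter fun j => coins j = true).image Fin.val
  if sel.card < β then sel else ∅

/-- The signal is a message. -/
def Signal.IsMessage {M : Type} (s : Signal M) : Prop := ∃ m, s = .message m

/-- Local state during the ID assignment. -/
structure AssignState (N : ℕ) where
  tasks : Finset ℕ
  slot : ℕ
  heard : Prop
  ids : Finset (Fin N)

open Classical in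
/-- ID assignment with sender-side collision detection, in `N` slots: a device that transmits in
slot `i` and hears its message takes the ID `i`. -/
noncomputable def assignDirect (M : Type) (N β : ℕ) :
    Protocol (Fin N → Bool) (Option M) (Finset (Fin N)) where
  State := AssignState N
  init coins := ⟨tasks β coins, 0, False, ∅⟩
  next s :=
    if s.slot < N then .inl (if s.slot ∈ s.tasks then .transmit none else .idle)
    else .inr s.ids
  update s sig :=
    { s with
      slot := s.slot + 1
      ids := if h : s.slot < N then
          (if s.slot ∈ s.tasks ∧ sig.IsMessage then insert ⟨s.slot, h⟩ s.ids else s.ids)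
        else s.ids }

open Classical in
/-- ID assignment without sender-side collision detection, in `N` blocks of four slots. In the
first two slots of block `i` the devices having the task `2 * i`, respectively `2 * i + 1`,
transmit. In the third slot the former speak and the latter listen. In the fourth slot the latter
speak if they received a message in the third slot, and the former listen; those of the former that
then receive a message take the ID `i`. (A device having both tasks speaks in the third slot and is
idle in the fourth one.) -/
noncomputable def assignPaired (M : Type) (N β : ℕ) :
    Protocol (Fin (2 * N) → Bool) (Option M) (Finset (Fin N)) where
  State := AssignState N
  init coins := ⟨tasks β coins, 0, False, ∅⟩
  next s :=
    let A : Prop := 2 * (s.slot / 4) ∈ s.tasks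
    let B : Prop := 2 * (s.slot / 4) + 1 ∈ s.tasks
    if s.slot < 4 * N then .inl <|
      match s.slot % 4 with
      | 0 => if A then .transmit none else .idle
      | 1 => if B then .transmit none else .idle
      | 2 => if A then .transmit none else if B then .listen else .idle
      | _ => if B ∧ s.heard then .transmit none else if A ∧ ¬ B then .listen else .idle
    else .inr s.ids
  update s sig :=
    let A : Prop := 2 * (s.slot / 4) ∈ s.tasks
    let B : Prop := 2 * (s.slot / 4) + 1 ∈ s.tasks
    { s with
      slot := s.slot + 1
      heard := s.slot % 4 = 2 ∧ B ∧ ¬ A ∧ sig.IsMessage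
      ids := if h : s.slot / 4 < N then
          (if s.slot % 4 = 3 ∧ A ∧ ¬ B ∧ sig.IsMessage then insert ⟨s.slot / 4, h⟩ s.ids
            else s.ids)
        else s.ids }

/-- The number of coins that each device tosses. -/
def CDModel.coinCount : CDModel → ℕ → ℕ
  | .strongCD, N => N
  | .senderCD, N => N
  | .receiverCD, N => 2 * N
  | .noCD, N => 2 * N

/-- The ID assignment used in each model. -/
noncomputable def assignIDs (M : Type) (N β : ℕ) : (c : CDModel) →
    Protocol (Fin (c.coinCount N) → Bool) (Option M) (Finset (Fin N))
  | .strongCD => assignDirect M N β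
  | .senderCD => assignDirect M N β
  | .receiverCD => assignPaired M N β
  | .noCD => assignPaired M N β

/-- The density parameter of the dense Census used in each model. -/
noncomputable def CDModel.density : CDModel → ℝ
  | .strongCD => 0.325
  | .senderCD => 0.325
  | .receiverCD => 0.325 ^ 2
  | .noCD => 0.325 ^ 2

/-! ### Running the dense Census on the assigned IDs -/

inductive Role where
  | leader
  | follower

/-- What a device does when the devices that it simulates together produce the channel state `ch`
and some of them listen iff `l`: it sends the message if there is one, it sends the contentless
message `none` if they already collide, and otherwise it listens if one of them does. -/
noncomputable def outerAction {M : Type} (ch : Signal M) (l : Prop) [Decidable l] :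
    Action (Option M) :=
  match ch with
  | .message m => .transmit (some m)
  | .noise => .transmit none
  | _ => if l then .listen else .idle

/-- What a simulated device that listens hears when the devices simulated by the same device
together produce the channel state `ch` and their common device receives the signal `sig`. -/
def innerSignal {M : Type} (ch : Signal M) (sig : Signal (Option M)) : Signal M :=
  match ch, sig with
  | .message m, _ => .message m
  | .noise, _ => .silence
  | _, .message (some m) => .message m
  | _, _ => .silence

open Classical in
/-- A device that holds the set `ids` of IDs simulates one device of the `No-CD` algorithm `D` for
each of these IDs. The device ends as the leader iff a device that it simulates ends as the leader
with a list of at least `c * N` IDs. -/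
noncomputable def simulate {M : Type} {N : ℕ} (c : ℝ)
    (D : Protocol (Fin N) M (Option (Finset (Fin N)))) :
    Protocol (Finset (Fin N)) (Option M) Role where
  State := Σ ids : Finset (Fin N), (ids → D.State)
  init ids := ⟨ids, fun k => D.init k⟩
  next := fun ⟨ids, v⟩ =>
    if ∀ k : ids, ∃ o, D.next (v k) = .inr o then
      .inr (if ∃ (k : ids) (I : Finset (Fin N)), D.next (v k) = .inr (some I) ∧ c * N ≤ I.card
        then .leader else .follower)
    else
      .inl (outerAction (channel fun k : ids => D.action (v k))
        (∃ k : ids, D.action (v k) = .listen))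
  update := fun ⟨ids, v⟩ sig =>
    ⟨ids, fun k => D.step (v k)
      (match D.action (v k) with
        | .listen => innerSignal (channel fun j : ids => D.action (v j)) sig
        | _ => .nothing)⟩

/-- The algorithm Test-Network-Size with `N` IDs, task bound `β` and dense Census algorithm `D`. -/
noncomputable def testNetworkSize {M : Type} (c : CDModel) (N β : ℕ) (D : CensusFamily M) :
    Protocol (Fin (c.coinCount N) → Bool) (Option M) Role :=
  (assignIDs M N β c).seq (simulate c.density (D N))

/-- After `T` time slots exactly one device is the leader and all others are followers. -/
def LeaderElected {X M ι : Type} (P : Protocol X M Role) (c : CDModel) (x : ι → X) (T : ℕ) : Prop :=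
  ∃ s, P.OutputAt c x T s .leader ∧ ∀ i, i ≠ s → P.OutputAt c x T i .follower

/-- After `T` time slots all devices are followers. -/
def NoLeaderElected {X M ι : Type} (P : Protocol X M Role) (c : CDModel) (x : ι → X) (T : ℕ) :
    Prop :=
  ∀ i, P.OutputAt c x T i .follower

open MeasureTheory in
/-- The joint law of the coins of `n` devices, each tossing `L` coins, all independent and
`true` with probability `p` (for `0 ≤ p ≤ 1`). -/
noncomputable def coinLaw (n L : ℕ) (p : ℝ) : Measure (Fin n → Fin L → Bool) :=
  Measure.pi fun _ => Measure.pi fun _ =>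
    ProbabilityTheory.bernoulliMeasure true false (Set.projIcc 0 1 zero_le_one p)

end RadioNetwork

/-!
Census. Each device starts with the list of IDs known to it, itself alone, and the aligned blocks
of length `2 ^ i` merge pairwise in stage `i`. Only the devices that are awake at a stage take
part, and the stages form a forest: a device wakes up at a stage if its rank among the devices
awake at the parent stage is the index of the stage among its siblings, so a device follows a
single path of the forest. A tree of depth `k` can span Ackermann-many stages, hence the energy is
`O(α(N))`. A block in which too few devices are awake gives up; the losses telescope and leave a
positive fraction of the devices, which can afford to listen to all others one by one and to
collect the list along a chain.

Test-Network-Size. An ID is taken with a probability that depends on `x = n / est` essentially as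
`x * exp (-x)` (squared in the models without sender detection). This has its maximum at `1`, and
for a good estimate it lies above the density of the Census, for a bad one below it, so Hoeffding's
inequality decides between the two with `O(log est)` slots. If `n` exceeds a power of `est` then no
device ever transmits alone. Otherwise it is unlikely that a device selects `β` slots, and without
such devices different IDs are independent.
-/

namespace RadioNetwork

/-! ### Wake-up forests -/

/-- A tree of wake-up stages: stage `i` is child number `idx i` of the stage `par i`, and `dep i` is
its depth. Only the values on the interval named in `IsSegment` matter. -/
structure WakeScheme where
  par : ℕ → ℕ
  idx : ℕ → ℕ
  dep : ℕ → ℕ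

namespace WakeScheme

/-- The stages of the open interval `(a, b)` form a tree of depth at most `m` with root `a`. Stage
`p` has at most `2 ^ (p / 4)` children, and if `p ≠ a` has children then its parent is at most
`p / 2`. -/
structure IsSegment (W : WakeScheme) (m a b : ℕ) : Prop where
  le_par : ∀ i, a < i → i < b → a ≤ W.par i
  par_lt : ∀ i, a < i → i < b → W.par i < i
  idx_lt : ∀ i, a < i → i < b → W.idx i < 2 ^ (W.par i / 4)
  dep_le : ∀ i, a < i → i < b → W.dep i ≤ m
  dep_base : ∀ i, a < i → i < b → W.par i = a → W.dep i = 1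
  dep_succ : ∀ i, a < i → i < b → W.par i ≠ a → W.dep i = W.dep (W.par i) + 1
  two_mul_par : ∀ i, a < i → i < b → W.par i ≠ a → 2 * W.par (W.par i) ≤ W.par i
  inj : ∀ i i', a < i → i < b → a < i' → i' < b → W.par i = W.par i' → W.idx i = W.idx i' → i = i'

variable {W W' : WakeScheme} {m a b b' n : ℕ}

lemma IsSegment.mono (h : W.IsSegment m a b) (hb : b' ≤ b) : W.IsSegment m a b' := by
  cases h
  constructor <;> grind

lemma isSegment_of_le_succ (W : WakeScheme) (h : b ≤ a + 1) : W.IsSegment m a b := by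
  constructor <;> intros <;> omega

/-- The scheme that follows `W` below stage `b` and `W'` above it, where `b` becomes child number
`n` of the stage `a` and `W'` is moved below `b`. -/
def graft (W W' : WakeScheme) (a b n : ℕ) : WakeScheme where
  par i := if i < b then W.par i else if i = b then a else W'.par i
  idx i := if i < b then W.idx i else if i = b then n else W'.idx i
  dep i := if i < b then W.dep i else if i = b then 1 else W'.dep i + 1

lemma IsSegment.graft (h : W.IsSegment (m + 1) a b) (h' : W'.IsSegment m b b') (hab : a < b)
    (hidx : ∀ i, a < i → i < b → W.par i = a → W.idx i < n) (hn : n < 2 ^ (a / 4))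
    (hb : 2 * a ≤ b ∨ b' ≤ b + 1) : (W.graft W' a b n).IsSegment (m + 1) a b' := by
  have hpos (i : ℕ) (hi : i < b') : i < b ∨ i = b ∨ (b < i ∧ 2 * a ≤ b) := by omega
  have hle := h'.le_par
  constructor <;> simp only [WakeScheme.graft]
  case le_par => have := h.le_par; grind
  case par_lt => have := h.par_lt; have := h'.par_lt; grind
  case idx_lt => have := h.idx_lt; have := h'.idx_lt; grind
  case dep_le => have := h.dep_le; have := h'.dep_le; grind
  case dep_base => have := h.dep_base; grind
  case dep_succ =>
    have := h.par_lt; have := h.dep_succ; have := h'.dep_base; have := h'.dep_succ; grind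
  case two_mul_par => have := h.par_lt; have := h.two_mul_par; have := h'.two_mul_par; grind
  case inj => have := h.par_lt; have := h.inj; have := h'.inj; grind

lemma idx_graft_lt (h' : W'.IsSegment m b b') (hab : a < b)
    (hidx : ∀ i, a < i → i < b → W.par i = a → W.idx i < n) (i : ℕ) (hi : a < i) (hi' : i < b')
    (hpar : (W.graft W' a b n).par i = a) : (W.graft W' a b n).idx i < n + 1 := by
  have := h'.le_par i
  simp only [WakeScheme.graft] at hpar ⊢
  grind

lemma mul_succ_le_two_pow_div_four {i : ℕ} (hi : 64 ≤ i) : i * (i + 1) ≤ 2 ^ (i / 4) := by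
  have key (q : ℕ) (hq : 16 ≤ q) : (4 * q + 3) * (4 * q + 4) ≤ 2 ^ q := by
    induction q, hq using Nat.le_induction with
    | base => norm_num
    | succ q hq ih => rw [pow_succ]; nlinarith
  calc i * (i + 1) ≤ (4 * (i / 4) + 3) * (4 * (i / 4) + 4) :=
        Nat.mul_le_mul (by omega) (by omega)
    _ ≤ 2 ^ (i / 4) := key _ (by omega)

/-- The first `a + 1` children of the root `a` only bring the stage beyond `2 * a`; each further
child `b` starts a tree of depth `m` and so carries the stage from `b` to `ack m b`, which is the
recursion of `ack (m + 1)`. -/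
lemma exists_isSegment_children
    (hm : ∀ c, 64 ≤ c → ∃ (b : ℕ) (W : WakeScheme), ack m c ≤ b ∧ W.IsSegment m c b)
    (ha : 64 ≤ a) (n : ℕ) (hn : n ≤ 2 ^ (a / 4)) :
    ∃ (b : ℕ) (W : WakeScheme), a + 1 + n ≤ b ∧ (∀ k, n = a + k + 1 → ack (m + 1) k ≤ b) ∧
      W.IsSegment (m + 1) a b ∧ ∀ i, a < i → i < b → W.par i = a → W.idx i < n := by
  induction n with
  | zero =>
    exact ⟨a + 1, ⟨id, id, id⟩, by omega, by omega, isSegment_of_le_succ _ le_rfl, by omega⟩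
  | succ n ih =>
    obtain ⟨b, W, hb, hack, hW, hidx⟩ := ih (by omega)
    by_cases h2 : 2 * a ≤ b
    · obtain ⟨b', W', hb', hW'⟩ := hm b (by omega)
      have hlt := lt_ack_right m b
      refine ⟨b', W.graft W' a b n, by omega, fun k hk => le_trans ?_ hb',
        hW.graft hW' (by omega) hidx (by omega) (.inl h2), idx_graft_lt hW' (by omega) hidx⟩
      cases k with
      | zero => rw [ack_succ_zero]; exact ack_mono_right m (by omega)
      | succ k => rw [ack_succ_succ]; exact ack_mono_right m (hack k (by omega))
    · have hW' : WakeScheme.IsSegment ⟨id, id, id⟩ m b (b + 1) := isSegment_of_le_succ _ le_rfl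
      exact ⟨b + 1, W.graft _ a b n, by omega, by omega,
        hW.graft hW' (by omega) hidx (by omega) (.inr le_rfl), idx_graft_lt hW' (by omega) hidx⟩

lemma exists_isSegment (m : ℕ) (ha : 64 ≤ a) :
    ∃ (b : ℕ) (W : WakeScheme), ack m a ≤ b ∧ W.IsSegment m a b := by
  induction m generalizing a with
  | zero => exact ⟨a + 1, ⟨id, id, id⟩, by simp, isSegment_of_le_succ _ le_rfl⟩
  | succ m ih =>
    obtain ⟨b, W, _, hack, hW, _⟩ := exists_isSegment_children (fun c hc => ih hc) ha (a + a + 1)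
      (le_trans (by nlinarith) (mul_succ_le_two_pow_div_four ha))
    exact ⟨b, W, hack a rfl, hW⟩

end WakeScheme

/-- The wake-up scheme for `L` stages: the stages up to `64` and from `L` on are roots, and the
stages between are at most `k + 1` levels below the root `64`. -/
structure WakeForest (L k : ℕ) extends WakeScheme where
  seg : toWakeScheme.IsSegment (k + 1) 64 L

lemma nonempty_wakeForest {L k : ℕ} (h : L ≤ ack k k) : Nonempty (WakeForest L k) := by
  obtain ⟨b, W, hb, hW⟩ := WakeScheme.exists_isSegment (k + 1) (le_refl 64)
  have hack : ack k k ≤ ack (k + 1) 64 := by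
    rw [ack_succ_succ]
    have := add_lt_ack (k + 1) 63
    exact ack_mono_right k (by omega)
  exact ⟨⟨W, hW.mono (h.trans (hack.trans hb))⟩⟩

/-! ### Waking up by rank -/

section Block

variable {U U' : Finset ℕ} {p s b j x y : ℕ}

/-- The elements of `U` in the dyadic interval number `b` of length `2 ^ p`; the interval of `x` has
number `x / 2 ^ p`. -/
def block (U : Finset ℕ) (p b : ℕ) : Finset ℕ := U.filter fun y => y / 2 ^ p = b

lemma mem_block : y ∈ block U p b ↔ y ∈ U ∧ y / 2 ^ p = b := Finset.mem_filter

lemma card_block_le (U : Finset ℕ) (p b : ℕ) : (block U p b).card ≤ 2 ^ p := by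
  have hsub : block U p b ⊆ Finset.Ico (b * 2 ^ p) ((b + 1) * 2 ^ p) := by
    intro y hy
    obtain ⟨-, rfl⟩ := mem_block.1 hy
    rw [Finset.mem_Ico, ← Nat.div_lt_iff_lt_mul (by positivity)]
    exact ⟨Nat.div_mul_le_self _ _, Nat.lt_succ_self _⟩
  calc _ ≤ _ := Finset.card_le_card hsub
    _ = 2 ^ p := by rw [Nat.card_Ico, ← Nat.sub_mul]; simp

lemma div_two_pow_eq_of_le (h : p ≤ s) (hxy : y / 2 ^ p = x / 2 ^ p) :
    y / 2 ^ s = x / 2 ^ s := by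
  obtain ⟨d, rfl⟩ := Nat.exists_eq_add_of_le h
  rw [pow_add, ← Nat.div_div_eq_div_mul, ← Nat.div_div_eq_div_mul, hxy]

/-- The number of elements of `U` below `x` in the dyadic interval of `x` of length `2 ^ p`. -/
def blockRank (U : Finset ℕ) (p x : ℕ) : ℕ := ((block U p (x / 2 ^ p)).filter (· < x)).card

lemma blockRank_congr (h : ∀ y, y / 2 ^ p = x / 2 ^ p → (y ∈ U ↔ y ∈ U')) :
    blockRank U p x = blockRank U' p x := by
  have hb : block U p (x / 2 ^ p) = block U' p (x / 2 ^ p) := by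
    ext y
    simpa only [mem_block, and_congr_left_iff] using h y
  rw [blockRank, blockRank, hb]

lemma blockRank_lt_card (hx : x ∈ U) : blockRank U p x < (block U p (x / 2 ^ p)).card :=
  Finset.card_lt_card <| Finset.filter_ssubset.2 ⟨x, mem_block.2 ⟨hx, rfl⟩, lt_irrefl x⟩

lemma blockRank_lt_blockRank (hx : x ∈ U) (hb : x / 2 ^ p = y / 2 ^ p) (h : x < y) :
    blockRank U p x < blockRank U p y := by
  refine Finset.card_lt_card (Finset.ssubset_iff_of_subset ?_ |>.2 ⟨x, ?_, by simp⟩)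
  · rw [hb]
    exact Finset.monotone_filter_right _ fun z _ hz => lt_trans hz h
  · simp [mem_block, hx, hb, h]

lemma blockRank_inj (hx : x ∈ U) (hy : y ∈ U) (hb : x / 2 ^ p = y / 2 ^ p)
    (h : blockRank U p x = blockRank U p y) : x = y := by
  rcases lt_trichotomy x y with hlt | heq | hgt
  · exact absurd h (blockRank_lt_blockRank hx hb hlt).ne
  · exact heq
  · exact absurd h (blockRank_lt_blockRank hy hb.symm hgt).ne'

lemma exists_blockRank_eq (h : j < (block U p b).card) :
    ∃ y ∈ U, y / 2 ^ p = b ∧ blockRank U p y = j := by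
  have hinj : Set.InjOn (blockRank U p) (block U p b) := fun x hx y hy =>
    blockRank_inj (mem_block.1 hx).1 (mem_block.1 hy).1
      ((mem_block.1 hx).2.trans (mem_block.1 hy).2.symm)
  have hmaps : Set.MapsTo (blockRank U p) (block U p b) (Finset.range (block U p b).card) := by
    intro x hx
    obtain ⟨hxU, rfl⟩ := mem_block.1 (Finset.mem_coe.1 hx)
    simpa using blockRank_lt_card hxU
  obtain ⟨y, hy, hyj⟩ := Finset.surjOn_of_injOn_of_card_le _ hmaps hinj (by simp)
    (Finset.mem_coe.2 (Finset.mem_range.2 h))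
  exact ⟨y, (mem_block.1 hy).1, (mem_block.1 hy).2, hyj⟩

end Block

namespace WakeForest

variable {L k : ℕ} (F : WakeForest L k) {S A A' K : Finset ℕ} {a i i' s x y : ℕ}

/-- The devices that wake up at stage `i` when `A` is the set of surviving devices: all at a root,
and otherwise those whose rank among the devices of their block that were awake at the parent
stage is the index of `i`. -/
def awake (A : Finset ℕ) (i : ℕ) : Finset ℕ :=
  if _h : 64 < i ∧ i < L then
    (awake A (F.par i)).filter fun x => blockRank (awake A (F.par i)) (F.par i) x = F.idx i
  else A
termination_by i
decreasing_by all_goals exact F.seg.par_lt i _h.1 _h.2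

lemma awake_root (h : ¬(64 < i ∧ i < L)) : F.awake A i = A := by
  rw [awake, dif_neg h]

lemma mem_awake (h : 64 < i) (h' : i < L) :
    x ∈ F.awake A i ↔
      x ∈ F.awake A (F.par i) ∧ blockRank (F.awake A (F.par i)) (F.par i) x = F.idx i := by
  rw [awake, dif_pos ⟨h, h'⟩, Finset.mem_filter]

lemma awake_subset (A : Finset ℕ) (i : ℕ) : F.awake A i ⊆ A := by
  induction i using Nat.strong_induction_on with
  | _ i ih =>
    by_cases h : 64 < i ∧ i < L
    · intro x hx
      exact ih _ (F.seg.par_lt i h.1 h.2) ((F.mem_awake h.1 h.2).1 hx).1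
    · rw [F.awake_root h]

lemma mem_awake_congr (hi : 64 < i → i < L → F.par i ≤ s)
    (h : ∀ y, y / 2 ^ s = x / 2 ^ s → (y ∈ A ↔ y ∈ A')) :
    x ∈ F.awake A i ↔ x ∈ F.awake A' i := by
  induction i using Nat.strong_induction_on generalizing x with
  | _ i ih =>
    by_cases hr : 64 < i ∧ i < L
    · obtain ⟨h1, h2⟩ := hr
      have hps := hi h1 h2
      have hpar (y : ℕ) (hy : y / 2 ^ F.par i = x / 2 ^ F.par i) :
          y ∈ F.awake A (F.par i) ↔ y ∈ F.awake A' (F.par i) :=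
        ih _ (F.seg.par_lt i h1 h2) (fun g1 g2 => (F.seg.par_lt _ g1 g2).le.trans hps)
          fun z hz => h z (hz.trans (div_two_pow_eq_of_le hps hy))
      rw [F.mem_awake h1 h2, F.mem_awake h1 h2, hpar x rfl, blockRank_congr hpar]
    · rw [F.awake_root hr, F.awake_root hr]
      exact h x rfl

lemma exists_mem_awake_of_lt (hx : x ∈ F.awake A i) (ha : a < i) :
    ∃ b, a < b ∧ b ≤ i ∧ (64 < b → b < L → F.par b ≤ a) ∧ x ∈ F.awake A b := by
  induction i using Nat.strong_induction_on with
  | _ i ih =>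
    by_cases h : 64 < i ∧ i < L ∧ a < F.par i
    · obtain ⟨h1, h2, h3⟩ := h
      have hlt := F.seg.par_lt i h1 h2
      obtain ⟨b, hab, hb, hpar, hxb⟩ := ih _ hlt ((F.mem_awake h1 h2).1 hx).1 h3
      exact ⟨b, hab, hb.trans hlt.le, hpar, hxb⟩
    · exact ⟨i, ha, le_rfl, fun h1 h2 => not_lt.1 fun h3 => h ⟨h1, h2, h3⟩, hx⟩

/-- The logarithm of the length of the blocks for which the devices awake at stage `i` stand: every
such block with a survivor contains one of them (`exists_mem_awake_unit`). -/
def unit (i : ℕ) : ℕ := if 64 < i ∧ i < L then F.par i else 0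

lemma unit_le (i : ℕ) : F.unit i ≤ i := by
  unfold unit
  split_ifs with h
  · exact (F.seg.par_lt i h.1 h.2).le
  · exact Nat.zero_le i

/-- A block with fewer devices awake at stage `i` gives up. -/
def threshold (i : ℕ) : ℕ := if 64 ≤ i ∧ 2 * F.unit i ≤ i then 2 ^ (i / 4) else 1

lemma one_le_threshold (i : ℕ) : 1 ≤ F.threshold i := by
  unfold threshold
  split_ifs
  · exact Nat.one_le_two_pow
  · rfl

lemma threshold_par (h : 64 < i) (h' : i < L) : F.threshold (F.par i) = 2 ^ (F.par i / 4) := by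
  have hle := F.seg.le_par i h h'
  refine if_pos ⟨hle, ?_⟩
  unfold unit
  split_ifs with hr
  · exact F.seg.two_mul_par i h h' (by omega)
  · omega

/-- The devices whose blocks have not given up before stage `i`. -/
def survivors (S : Finset ℕ) : ℕ → Finset ℕ
  | 0 => S
  | i + 1 => (survivors S i).filter fun x =>
      F.threshold i ≤ (block (F.awake (survivors S i) i) i (x / 2 ^ i)).card

lemma mem_survivors_succ : x ∈ F.survivors S (i + 1) ↔ x ∈ F.survivors S i ∧
    F.threshold i ≤ (block (F.awake (F.survivors S i) i) i (x / 2 ^ i)).card := by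
  rw [survivors, Finset.mem_filter]

lemma survivors_antitone (S : Finset ℕ) : Antitone (F.survivors S) :=
  antitone_nat_of_succ_le fun _ _ hx => (F.mem_survivors_succ.1 hx).1

lemma survivors_subset (S : Finset ℕ) (i : ℕ) : F.survivors S i ⊆ S :=
  F.survivors_antitone S (Nat.zero_le i)

lemma mem_survivors_iff_of_block (h : a ≤ i) (hx : x ∈ F.survivors S i)
    (hxy : y / 2 ^ a = x / 2 ^ a) : y ∈ F.survivors S i ↔ y ∈ F.survivors S a := by
  refine ⟨fun hy => F.survivors_antitone S h hy, fun hy => ?_⟩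
  induction i, h using Nat.le_induction with
  | base => exact hy
  | succ i hi ih =>
    obtain ⟨hxi, hcard⟩ := F.mem_survivors_succ.1 hx
    refine F.mem_survivors_succ.2 ⟨ih hxi, ?_⟩
    rwa [div_two_pow_eq_of_le hi hxy]

section Knows

/-- What device `x` may know before stage `i`: the surviving devices of its block at the last stage
`a` at which it was awake. -/
def Knows (S : Finset ℕ) (i x : ℕ) (K : Finset ℕ) : Prop :=
  ∃ a ≤ i, K = block (F.survivors S a) a (x / 2 ^ a) ∧ ∀ b, a < b → b ≤ i → x ∉ F.awake K b

lemma knows_zero (hx : x ∈ S) : F.Knows S 0 x {x} := by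
  refine ⟨0, le_rfl, ?_, by omega⟩
  ext y
  simp only [Finset.mem_singleton, survivors, mem_block, pow_zero, Nat.div_one]
  exact ⟨fun h => ⟨h ▸ hx, h⟩, And.right⟩

lemma knows_survivors (S : Finset ℕ) (i x : ℕ) :
    F.Knows S i x (block (F.survivors S i) i (x / 2 ^ i)) :=
  ⟨i, le_rfl, rfl, by omega⟩

lemma mem_awake_block_survivors :
    x ∈ F.awake (block (F.survivors S i) i (x / 2 ^ i)) i ↔ x ∈ F.awake (F.survivors S i) i :=
  F.mem_awake_congr (fun h1 h2 => (F.seg.par_lt i h1 h2).le) fun z hz => by simp [mem_block, hz]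

variable {F}

lemma Knows.eq_of_mem (h : F.Knows S i x K) (hx : x ∈ F.awake K i) :
    K = block (F.survivors S i) i (x / 2 ^ i) := by
  obtain ⟨a, ha, hK, hb⟩ := h
  rcases ha.lt_or_eq with hlt | rfl
  · exact absurd hx (hb i hlt le_rfl)
  · exact hK

lemma Knows.mem_awake_iff (h : F.Knows S i x K) :
    x ∈ F.awake K i ↔ x ∈ F.awake (F.survivors S i) i := by
  constructor
  · intro hx
    have hK := h.eq_of_mem hx
    rw [hK] at hx
    exact F.mem_awake_block_survivors.1 hx
  · intro hx
    obtain ⟨a, ha, hK, hb⟩ := h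
    rcases ha.lt_or_eq with hlt | rfl
    · obtain ⟨b, hab, hbi, hpar, hxb⟩ := F.exists_mem_awake_of_lt hx hlt
      refine absurd ((F.mem_awake_congr hpar fun y hy => ?_).1 hxb) (hb b hab hbi)
      rw [hK, mem_block, F.mem_survivors_iff_of_block ha (F.awake_subset _ _ hx) hy]
      simp [hy]
    · rw [hK]
      exact F.mem_awake_block_survivors.2 hx

lemma Knows.succ_of_notMem (h : F.Knows S i x K) (hx : x ∉ F.awake K (i + 1)) :
    F.Knows S (i + 1) x K := by
  obtain ⟨a, ha, hK, hb⟩ := h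
  refine ⟨a, by omega, hK, fun b hab hbi => ?_⟩
  rcases Nat.lt_or_eq_of_le hbi with hlt | rfl
  · exact hb b hab (by omega)
  · exact hx

lemma Knows.final (hS : ∀ x ∈ S, x < 2 ^ L) (hx : x ∈ S) (h : F.Knows S L x K) :
    (x ∈ K ↔ x ∈ F.survivors S L) ∧ (x ∈ K → K = F.survivors S L) := by
  have hroot (A : Finset ℕ) : F.awake A L = A := F.awake_root (by omega)
  have hmem := h.mem_awake_iff
  have heq := h.eq_of_mem
  rw [hroot] at heq
  rw [hroot, hroot] at hmem
  refine ⟨hmem, fun hxK => (heq hxK).trans (Finset.filter_true_of_mem fun y hy => ?_)⟩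
  rw [Nat.div_eq_of_lt (hS x hx), Nat.div_eq_of_lt (hS y (F.survivors_subset S L hy))]

end Knows

section Candidate

/-- Device `x` wakes up at the non-root stage `i`, unless its block has given up between the parent
of `i` and `i`. -/
def Candidate (S : Finset ℕ) (x i : ℕ) : Prop :=
  64 < i ∧ i < L ∧ x ∈ F.awake (F.survivors S (F.par i)) i

lemma candidate_of_mem_awake (h1 : 64 < i) (h2 : i < L) (hx : x ∈ F.awake (F.survivors S i) i) :
    F.Candidate S x i :=
  ⟨h1, h2, (F.mem_awake_congr (fun _ _ => le_rfl) fun _ hy =>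
    F.mem_survivors_iff_of_block (F.seg.par_lt i h1 h2).le (F.awake_subset _ _ hx) hy).1 hx⟩

lemma one_le_dep (h1 : 64 < i) (h2 : i < L) : 1 ≤ F.dep i := by
  by_cases h : F.par i = 64
  · rw [F.seg.dep_base i h1 h2 h]
  · rw [F.seg.dep_succ i h1 h2 h]; omega

variable {F}

lemma Knows.candidate (h : F.Knows S i x K) (hx : x ∈ F.awake K (i + 1)) (h1 : 64 < i + 1)
    (h2 : i + 1 < L) : F.Candidate S x (i + 1) := by
  obtain ⟨a, -, hK, hb⟩ := h
  have hlt := F.seg.par_lt _ h1 h2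
  have hpa : F.par (i + 1) ≤ a := by
    by_contra hcon
    exact hb _ (by omega) (by omega) ((F.mem_awake h1 h2).1 hx).1
  have hxK : x ∈ K := F.awake_subset _ _ hx
  rw [hK, mem_block] at hxK
  refine ⟨h1, h2, (F.mem_awake_congr (fun _ _ => le_rfl) fun y hy => ?_).1 hx⟩
  rw [hK, mem_block, F.mem_survivors_iff_of_block hpa hxK.1 hy]
  simp [div_two_pow_eq_of_le hpa hy]

lemma Candidate.mem_par (h : F.Candidate S x i) :
    x ∈ F.awake (F.survivors S (F.par i)) (F.par i) ∧
      blockRank (F.awake (F.survivors S (F.par i)) (F.par i)) (F.par i) x = F.idx i :=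
  (F.mem_awake h.1 h.2.1).1 h.2.2

lemma Candidate.par (h : F.Candidate S x i) (hp : F.par i ≠ 64) : F.Candidate S x (F.par i) := by
  have hle := F.seg.le_par i h.1 h.2.1
  exact F.candidate_of_mem_awake (by omega) ((F.seg.par_lt i h.1 h.2.1).trans h.2.1) h.mem_par.1

lemma Candidate.dep_eq_one_iff (h : F.Candidate S x i) : F.dep i = 1 ↔ F.par i = 64 := by
  refine ⟨fun hd => by_contra fun hp => ?_, F.seg.dep_base i h.1 h.2.1⟩
  have := F.one_le_dep (h.par hp).1 (h.par hp).2.1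
  rw [F.seg.dep_succ i h.1 h.2.1 hp] at hd
  omega

/-- A device has a single rank in its block, so it follows a single path in the tree of stages. -/
lemma Candidate.eq_of_dep_eq (h : F.Candidate S x i) (h' : F.Candidate S x i')
    (hd : F.dep i = F.dep i') : i = i' := by
  induction i using Nat.strong_induction_on generalizing i' with
  | _ i ih =>
    have hpar : F.par i = F.par i' := by
      have hiff : F.par i = 64 ↔ F.par i' = 64 := by
        rw [← h.dep_eq_one_iff, ← h'.dep_eq_one_iff, hd]
      by_cases hp : F.par i = 64
      · rw [hp, hiff.1 hp]
      · have hp' := mt hiff.2 hp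
        rw [F.seg.dep_succ i h.1 h.2.1 hp, F.seg.dep_succ i' h'.1 h'.2.1 hp'] at hd
        exact ih _ (F.seg.par_lt i h.1 h.2.1) (h.par hp) (h'.par hp') (by omega)
    refine F.seg.inj i i' h.1 h.2.1 h'.1 h'.2.1 hpar ?_
    rw [← h.mem_par.2, ← h'.mem_par.2, hpar]

variable (F)

open Classical in
lemma card_candidate_le (S : Finset ℕ) (x n : ℕ) :
    ((Finset.range n).filter (F.Candidate S x)).card ≤ k + 1 := by
  have hcard : ((Finset.range n).filter (F.Candidate S x)).card ≤ (Finset.Icc 1 (k + 1)).card :=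
    Finset.card_le_card_of_injOn F.dep
      (fun i hi => by
        obtain ⟨h1, h2, -⟩ := (Finset.mem_filter.1 hi).2
        exact Finset.mem_coe.2 (Finset.mem_Icc.2 ⟨F.one_le_dep h1 h2, F.seg.dep_le i h1 h2⟩))
      fun i hi i' hi' => (Finset.mem_filter.1 hi).2.eq_of_dep_eq (Finset.mem_filter.1 hi').2
  simpa using hcard

/-- Device `x` may be awake at stage `i`: the stage is a root, or a candidate for `x`. -/
def MayWake (S : Finset ℕ) (x i : ℕ) : Prop := i ≤ 64 ∨ L ≤ i ∨ F.Candidate S x i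

open Classical in
lemma card_mayWake_le (S : Finset ℕ) (x n : ℕ) :
    ((Finset.range n).filter (F.MayWake S x)).card ≤ k + 66 + (n - L) := by
  have hsub : (Finset.range n).filter (F.MayWake S x) ⊆
      (Finset.range 65 ∪ Finset.Ico L n) ∪ (Finset.range n).filter (F.Candidate S x) := by
    intro i
    simp only [Finset.mem_filter, Finset.mem_union, Finset.mem_range, Finset.mem_Ico]
    rintro ⟨hi, h | h | h⟩
    · exact .inl (.inl (by omega))
    · exact .inl (.inr ⟨h, hi⟩)
    · exact .inr ⟨hi, h⟩
  calc _ ≤ (Finset.range 65).card + (Finset.Ico L n).card +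
        ((Finset.range n).filter (F.Candidate S x)).card :=
        (Finset.card_le_card hsub).trans <| (Finset.card_union_le _ _).trans <|
          Nat.add_le_add_right (Finset.card_union_le _ _) _
    _ ≤ 65 + (n - L) + (k + 1) := by
        simpa using F.card_candidate_le S x n
    _ = k + 66 + (n - L) := by ring

end Candidate

section Knowledge

/-- What device `x` actually knows before stage `i`: at first only itself, and whenever it is awake
at the next stage it learns its new block. -/
def knowledge (S : Finset ℕ) : ℕ → ℕ → Finset ℕ
  | 0, x => {x}
  | i + 1, x =>
    if x ∈ F.awake (knowledge S i x) (i + 1) then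
      block (F.survivors S (i + 1)) (i + 1) (x / 2 ^ (i + 1))
    else knowledge S i x

lemma knows_knowledge (hx : x ∈ S) (i : ℕ) : F.Knows S i x (F.knowledge S i x) := by
  induction i with
  | zero => exact F.knows_zero hx
  | succ i ih =>
    rw [knowledge]
    split_ifs with h
    · exact F.knows_survivors S (i + 1) x
    · exact ih.succ_of_notMem h

variable {F}

lemma Knows.mayWake (h : F.Knows S i x K) (hx : x ∈ F.awake K i) : F.MayWake S x i :=
  or_iff_not_imp_left.2 fun h1 => or_iff_not_imp_left.2 fun h2 =>
    F.candidate_of_mem_awake (not_le.1 h1) (not_le.1 h2) (h.mem_awake_iff.1 hx)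

lemma Knows.mayWake_succ (h : F.Knows S i x K) (hx : x ∈ F.awake K (i + 1)) :
    F.MayWake S x (i + 1) :=
  or_iff_not_imp_left.2 fun h1 => or_iff_not_imp_left.2 fun h2 =>
    h.candidate hx (not_le.1 h1) (not_le.1 h2)

lemma mem_knowledge_and_iff (hS : ∀ x ∈ S, x < 2 ^ L) (hx : x ∈ S) (p : Finset ℕ → Prop) :
    x ∈ F.knowledge S L x ∧ p (F.knowledge S L x) ↔
      x ∈ F.survivors S L ∧ p (F.survivors S L) := by
  obtain ⟨hmem, heq⟩ := (F.knows_knowledge hx L).final hS hx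
  constructor
  · rintro ⟨h, hp⟩
    exact ⟨hmem.1 h, heq h ▸ hp⟩
  · rintro ⟨h, hp⟩
    exact ⟨hmem.2 h, (heq (hmem.2 h)).symm ▸ hp⟩

end Knowledge

section Survivors

lemma exists_mem_awake_unit (hx : x ∈ F.survivors S i) :
    ∃ y ∈ F.awake (F.survivors S i) i, y / 2 ^ F.unit i = x / 2 ^ F.unit i := by
  by_cases h : 64 < i ∧ i < L
  · have hp := F.seg.par_lt i h.1 h.2
    have hcard := (F.mem_survivors_succ.1 (F.survivors_antitone S hp hx)).2
    have hidx := F.seg.idx_lt i h.1 h.2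
    rw [← F.threshold_par h.1 h.2] at hidx
    obtain ⟨y, hy, hyx, hrank⟩ := exists_blockRank_eq (hidx.trans_le hcard)
    have hagree (z : ℕ) (hz : z / 2 ^ F.par i = y / 2 ^ F.par i) :
        z ∈ F.awake (F.survivors S i) (F.par i) ↔
          z ∈ F.awake (F.survivors S (F.par i)) (F.par i) :=
      F.mem_awake_congr (fun g1 g2 => (F.seg.par_lt _ g1 g2).le) fun w hw =>
        F.mem_survivors_iff_of_block hp.le hx (hw.trans (hz.trans hyx))
    refine ⟨y, (F.mem_awake h.1 h.2).2 ⟨(hagree y rfl).2 hy, ?_⟩, ?_⟩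
    · rw [blockRank_congr hagree, hrank]
    · rw [unit, if_pos h, hyx]
  · exact ⟨x, by rwa [F.awake_root h], rfl⟩

lemma card_block_sdiff_survivors_le (S : Finset ℕ) (i b : ℕ) :
    (block (F.survivors S i \ F.survivors S (i + 1)) i b).card ≤
      2 ^ F.unit i * (F.threshold i - 1) := by
  rcases (block (F.survivors S i \ F.survivors S (i + 1)) i b).eq_empty_or_nonempty
    with he | ⟨x₀, hx₀⟩
  · simp [he]
  · simp only [mem_block, Finset.mem_sdiff, F.mem_survivors_succ] at hx₀
    obtain ⟨⟨hx₀i, hgiveUp⟩, rfl⟩ := hx₀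
    set D := F.survivors S i \ F.survivors S (i + 1)
    set V := block (F.awake (F.survivors S i) i) i (x₀ / 2 ^ i)
    have hVcard : V.card ≤ F.threshold i - 1 := by
      by_contra hcon
      exact hgiveUp ⟨hx₀i, by omega⟩
    have hmaps : ∀ x ∈ block D i (x₀ / 2 ^ i),
        x / 2 ^ F.unit i ∈ V.image fun y => y / 2 ^ F.unit i := by
      intro x hx
      obtain ⟨hxD, hxb⟩ := mem_block.1 hx
      obtain ⟨y, hy, hyx⟩ := F.exists_mem_awake_unit (Finset.mem_sdiff.1 hxD).1
      exact Finset.mem_image.2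
        ⟨y, mem_block.2 ⟨hy, (div_two_pow_eq_of_le (F.unit_le i) hyx).trans hxb⟩, hyx⟩
    calc (block D i (x₀ / 2 ^ i)).card
        ≤ 2 ^ F.unit i * (V.image fun y => y / 2 ^ F.unit i).card :=
          Finset.card_le_mul_card_image_of_maps_to hmaps _ fun c _ => card_block_le _ _ c
      _ ≤ 2 ^ F.unit i * (F.threshold i - 1) :=
          Nat.mul_le_mul_left _ (Finset.card_image_le.trans hVcard)

lemma card_sdiff_survivors_le (hS : ∀ x ∈ S, x < 2 ^ L) (hi : i < L) :
    (F.survivors S i \ F.survivors S (i + 1)).card ≤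
      2 ^ F.unit i * (F.threshold i - 1) * 2 ^ (L - i) := by
  have hmaps : ∀ x ∈ F.survivors S i \ F.survivors S (i + 1),
      x / 2 ^ i ∈ Finset.range (2 ^ (L - i)) := by
    intro x hx
    rw [Finset.mem_range, Nat.div_lt_iff_lt_mul (by positivity), ← pow_add,
      Nat.sub_add_cancel hi.le]
    exact hS x (F.survivors_subset S i (Finset.mem_sdiff.1 hx).1)
  simpa using Finset.card_le_mul_card_image_of_maps_to hmaps
    (2 ^ F.unit i * (F.threshold i - 1)) fun b _ => F.card_block_sdiff_survivors_le S i b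

lemma card_survivors_of_threshold_eq_one (hS : ∀ x ∈ S, x < 2 ^ L) (hi : i < L)
    (ht : F.threshold i = 1) : (F.survivors S (i + 1)).card = (F.survivors S i).card := by
  have hle := F.card_sdiff_survivors_le hS hi
  have hcard := Finset.card_sdiff_add_card_eq_card (F.survivors_antitone S i.le_succ)
  simp only [ht, Nat.sub_self, mul_zero, zero_mul, Nat.le_zero] at hle
  simp only [Nat.succ_eq_add_one] at hcard
  omega

lemma mul_card_survivors_le (hS : ∀ x ∈ S, x < 2 ^ L) (hi : i < L) :
    i * (i + 1) * (F.survivors S i).card ≤ i * (i + 1) * (F.survivors S (i + 1)).card + 2 ^ L := by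
  by_cases ht : 64 ≤ i ∧ 2 * F.unit i ≤ i
  · have hthr : F.threshold i - 1 ≤ 2 ^ (i / 4) := by
      rw [threshold, if_pos ht]
      exact Nat.sub_le _ _
    have hloss : i * (i + 1) * (F.survivors S i \ F.survivors S (i + 1)).card ≤ 2 ^ L :=
      calc i * (i + 1) * (F.survivors S i \ F.survivors S (i + 1)).card
          ≤ 2 ^ (i / 4) * (2 ^ F.unit i * 2 ^ (i / 4) * 2 ^ (L - i)) :=
            Nat.mul_le_mul (WakeScheme.mul_succ_le_two_pow_div_four ht.1)
              ((F.card_sdiff_survivors_le hS hi).trans (by gcongr))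
        _ = 2 ^ (i / 4 + (F.unit i + i / 4 + (L - i))) := by simp only [pow_add]
        _ ≤ 2 ^ L := Nat.pow_le_pow_right (by norm_num) (by omega)
    rw [← Finset.card_sdiff_add_card_eq_card (F.survivors_antitone S i.le_succ), mul_add,
      Nat.succ_eq_add_one]
    omega
  · rw [F.card_survivors_of_threshold_eq_one hS hi (if_neg ht)]
    exact Nat.le_add_right _ _

lemma card_survivors_eq (hS : ∀ x ∈ S, x < 2 ^ L) (hi : i ≤ L) (hi' : i ≤ 64) :
    (F.survivors S i).card = S.card := by
  induction i with
  | zero => rfl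
  | succ i ih =>
    rw [F.card_survivors_of_threshold_eq_one hS (by omega) (if_neg (by omega)),
      ih (by omega) (by omega)]

/-- The losses at the single stages form the telescoping sum of `1 / (i * (i + 1))`. -/
lemma card_survivors_ge_of_le (hS : ∀ x ∈ S, x < 2 ^ L) (h : 64 ≤ i) (hi : i ≤ L) :
    (S.card : ℝ) - 2 ^ L * (1 / 64 - 1 / i) ≤ (F.survivors S i).card := by
  induction i, h using Nat.le_induction with
  | base => rw [F.card_survivors_eq hS hi le_rfl]; norm_num
  | succ i hi' ih =>
    have hloss : (i * (i + 1) * (F.survivors S i).card : ℝ) ≤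
        i * (i + 1) * (F.survivors S (i + 1)).card + 2 ^ L := by
      exact_mod_cast F.mul_card_survivors_le hS (i := i) (by omega)
    have : (0 : ℝ) < i := by positivity
    have hstep : ((F.survivors S i).card : ℝ) ≤
        (F.survivors S (i + 1)).card + 2 ^ L * (1 / i - 1 / (i + 1)) := by
      have htel : (1 : ℝ) / i - 1 / (i + 1) = 1 / (i * (i + 1)) := by field_simp; ring
      rw [htel, ← sub_le_iff_le_add', mul_one_div, le_div_iff₀ (by positivity)]
      linarith
    push_cast
    linarith [ih (by omega)]

lemma card_survivors_ge (hS : ∀ x ∈ S, x < 2 ^ L) :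
    (S.card : ℝ) - 2 ^ L / 64 ≤ (F.survivors S L).card := by
  rcases le_total L 64 with hL | hL
  · rw [F.card_survivors_eq hS le_rfl hL, sub_le_self_iff]
    positivity
  · have : (0 : ℝ) ≤ 2 ^ L * (1 / L) := by positivity
    linarith [F.card_survivors_ge_of_le hS hL le_rfl]

end Survivors

end WakeForest

/-! ### Protocols with a fixed schedule -/

section Channel

variable {ι M : Type} {a : ι → Action M} {i j : ι} {m m' : M}

lemma IsSoleTransmitter.message_unique (h : IsSoleTransmitter a i m)
    (h' : IsSoleTransmitter a j m') : m = m' := by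
  obtain rfl : i = j := by_contra fun hij => h'.2 i hij m h.1
  simpa [h.1] using h'.1

lemma channel_eq_message (h : IsSoleTransmitter a i m) : channel a = .message m := by
  have hex : ∃ m i, IsSoleTransmitter a i m := ⟨m, i, h⟩
  obtain ⟨j, hj⟩ := hex.choose_spec
  rw [channel, dif_pos hex, hj.message_unique h]

lemma exists_isSoleTransmitter_of_channel (h : channel a = .message m) :
    ∃ i, IsSoleTransmitter a i m := by
  unfold channel at h
  split_ifs at h with hex
  obtain rfl := Signal.message.inj h
  exact hex.choose_spec

lemma channel_eq_silence (h : ∀ i m, a i ≠ .transmit m) : channel a = .silence := by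
  rw [channel, dif_neg, if_neg]
  · rintro ⟨i, m, hm⟩
    exact h i m hm
  · rintro ⟨m, i, hm, -⟩
    exact h i m hm

end Channel

/-- The message of a signal, if it is one. -/
def Signal.toOption {M : Type} : Signal M → Option M
  | .message m => some m
  | _ => none

/-- A protocol that runs through a fixed list of slots. In slot `σ` a device in state `s` sends
`send σ s` if this is a message, and otherwise listens iff it is interested in the slot. The slots
need not be natural numbers, so that their names can carry their purpose. -/
structure SlotMachine (X M O Slot St : Type) where
  schedule : List Slot
  start : X → St
  send : Slot → St → Option M
  interested : Slot → St → Prop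
  recv : Slot → St → Option M → St
  out : St → O

namespace SlotMachine

variable {X M O Slot St ι : Type} (Q : SlotMachine X M O Slot St)

open Classical in
/-- The action of a device in a slot. -/
noncomputable def act (σ : Slot) (s : St) : Action M :=
  match Q.send σ s with
  | some m => .transmit m
  | none => if Q.interested σ s then .listen else .idle

open Classical in
/-- The state of a device after a slot whose message is `o`. An interested sender receives its own
message, although it does not hear it. -/
noncomputable def advance (σ : Slot) (s : St) (o : Option M) : St :=
  Q.recv σ s (if Q.interested σ s then (Q.send σ s <|> o) else none)

/-- The protocol that a slot machine describes. -/
noncomputable def toProtocol : Protocol X M O where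
  State := List Slot × St
  init x := (Q.schedule, Q.start x)
  next
    | ([], s) => .inr (Q.out s)
    | (σ :: _, s) => .inl (Q.act σ s)
  update
    | ([], s), _ => ([], s)
    | (σ :: l, s), sig => (l, Q.advance σ s sig.toOption)

/-- The message that the listeners hear in slot `σ`. -/
noncomputable def content (σ : Slot) (st : ι → St) : Option M :=
  (channel fun i => Q.act σ (st i)).toOption

/-- The states of all devices after a slot. -/
noncomputable def stepAll (st : ι → St) (σ : Slot) : ι → St :=
  fun i => Q.advance σ (st i) (Q.content σ st)

/-- The states of all devices after a list of slots. -/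
noncomputable def exec (l : List Slot) (st : ι → St) : ι → St := l.foldl Q.stepAll st

/-- At most one device sends in slot `σ`. -/
def UniqueSender (σ : Slot) (st : ι → St) : Prop :=
  ∀ i j m m', Q.send σ (st i) = some m → Q.send σ (st j) = some m' → i = j

/-- At most one device sends in each of a list of slots. -/
def CollisionFree : List Slot → (ι → St) → Prop
  | [], _ => True
  | σ :: l, st => Q.UniqueSender σ st ∧ CollisionFree l (Q.stepAll st σ)

/-- The list `l` of slots takes the devices from the states `st` to the states `st'`, and no two of
them send in the same slot. -/
def Leads (l : List Slot) (st st' : ι → St) : Prop :=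
  Q.CollisionFree l st ∧ Q.exec l st = st'

/-- The energy that device `i` spends in a list of slots. -/
noncomputable def cost : List Slot → (ι → St) → ι → ℕ
  | [], _, _ => 0
  | σ :: l, st, i => (Q.act σ (st i)).cost + cost l (Q.stepAll st σ) i

variable {Q}

@[simp] lemma exec_nil (st : ι → St) : Q.exec [] st = st := rfl

@[simp] lemma exec_cons (σ : Slot) (l : List Slot) (st : ι → St) :
    Q.exec (σ :: l) st = Q.exec l (Q.stepAll st σ) := rfl

lemma exec_append (l l' : List Slot) (st : ι → St) :
    Q.exec (l ++ l') st = Q.exec l' (Q.exec l st) := List.foldl_append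

lemma collisionFree_append {l l' : List Slot} {st : ι → St} :
    Q.CollisionFree (l ++ l') st ↔ Q.CollisionFree l st ∧ Q.CollisionFree l' (Q.exec l st) := by
  induction l generalizing st with
  | nil => simp [CollisionFree]
  | cons σ l ih => simp [CollisionFree, ih, and_assoc]

lemma cost_append (l l' : List Slot) (st : ι → St) (i : ι) :
    Q.cost (l ++ l') st i = Q.cost l st i + Q.cost l' (Q.exec l st) i := by
  induction l generalizing st with
  | nil => simp [cost]
  | cons σ l ih => simp [cost, ih, add_assoc]

section Leads

variable {l l' : List Slot} {st st' st'' : ι → St}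

lemma UniqueSender.leads {σ : Slot} (h : Q.UniqueSender σ st) :
    Q.Leads [σ] st (Q.stepAll st σ) :=
  ⟨⟨h, trivial⟩, rfl⟩

lemma Leads.append (h : Q.Leads l st st') (h' : Q.Leads l' st' st'') :
    Q.Leads (l ++ l') st st'' := by
  obtain ⟨hfree, rfl⟩ := h
  exact ⟨collisionFree_append.2 ⟨hfree, h'.1⟩, (exec_append l l' st).trans h'.2⟩

lemma Leads.cost_append (h : Q.Leads l st st') (l' : List Slot) (i : ι) :
    Q.cost (l ++ l') st i = Q.cost l st i + Q.cost l' st' i := by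
  rw [SlotMachine.cost_append, h.2]

variable {st : ℕ → ι → St} {n : ℕ}

lemma leads_flatMap_range {f : ℕ → List Slot}
    (h : ∀ t < n, Q.Leads (f t) (st t) (st (t + 1))) :
    Q.Leads ((List.range n).flatMap f) (st 0) (st n) := by
  induction n with
  | zero => exact ⟨trivial, rfl⟩
  | succ n ih =>
    rw [List.range_succ, List.flatMap_append, List.flatMap_singleton]
    exact (ih fun t ht => h t (by omega)).append (h n n.lt_succ_self)

lemma cost_flatMap_range {f : ℕ → List Slot}
    (h : ∀ t < n, Q.Leads (f t) (st t) (st (t + 1))) (i : ι) :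
    Q.cost ((List.range n).flatMap f) (st 0) i = ∑ t ∈ Finset.range n, Q.cost (f t) (st t) i := by
  induction n with
  | zero => rfl
  | succ n ih =>
    have hn : ∀ t < n, Q.Leads (f t) (st t) (st (t + 1)) := fun t ht => h t (by omega)
    rw [List.range_succ, List.flatMap_append, List.flatMap_singleton,
      (leads_flatMap_range hn).cost_append, ih hn, Finset.sum_range_succ]

lemma leads_map_range {f : ℕ → Slot} (h : ∀ t, Q.Leads [f t] (st t) (st (t + 1))) (n : ℕ) :
    Q.Leads ((List.range n).map f) (st 0) (st n) := by
  rw [List.map_eq_flatMap]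
  exact leads_flatMap_range fun t _ => h t

lemma cost_act_le {σ : Slot} {s : St} {p q : Prop} [Decidable p] [Decidable q]
    (hp : Q.send σ s ≠ none → p) (hq : Q.interested σ s → q) :
    (Q.act σ s).cost ≤ (if p then 1 else 0) + if q then 1 else 0 := by
  rw [act]
  cases h : Q.send σ s with
  | some m' => simp [Action.cost, hp (by simp [h])]
  | none =>
    by_cases hi : Q.interested σ s
    · simp [Action.cost, hi, hq hi]
    · simp [Action.cost, hi]

lemma cost_map_range_le {f : ℕ → Slot} (h : ∀ t, Q.Leads [f t] (st t) (st (t + 1))) (n : ℕ) {i : ι}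
    {P R : Finset ℕ} (hP : ∀ t, Q.send (f t) (st t i) ≠ none → t ∈ P)
    (hR : ∀ t, Q.interested (f t) (st t i) → t ∈ R) :
    Q.cost ((List.range n).map f) (st 0) i ≤ P.card + R.card := by
  rw [List.map_eq_flatMap, cost_flatMap_range fun t _ => h t]
  calc ∑ t ∈ Finset.range n, Q.cost [f t] (st t) i
      ≤ ∑ t ∈ Finset.range n, ((if t ∈ P then 1 else 0) + if t ∈ R then 1 else 0) :=
        Finset.sum_le_sum fun t _ => cost_act_le (hP t) (hR t)
    _ = ((Finset.range n).filter (· ∈ P)).card + ((Finset.range n).filter (· ∈ R)).card := by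
        rw [Finset.sum_add_distrib, Finset.card_filter, Finset.card_filter]
    _ ≤ P.card + R.card := by
        gcongr <;> exact fun t ht => (Finset.mem_filter.1 ht).2

end Leads

lemma act_eq_transmit {σ : Slot} {s : St} {m : M} :
    Q.act σ s = .transmit m ↔ Q.send σ s = some m := by
  rw [act]
  cases Q.send σ s with
  | some m' => simp
  | none => split_ifs <;> simp

lemma act_of_send_eq_none {σ : Slot} {s : St} (h : Q.send σ s = none)
    (h' : Q.interested σ s) : Q.act σ s = .listen := by
  rw [act, h]
  exact if_pos h'

lemma UniqueSender.content_eq {σ : Slot} {st : ι → St} (h : Q.UniqueSender σ st) {i : ι} {m : M}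
    (hi : Q.send σ (st i) = some m) : Q.content σ st = some m := by
  have hsole : IsSoleTransmitter (fun i => Q.act σ (st i)) i m :=
    ⟨act_eq_transmit.2 hi, fun j hj m' hm => hj (h j i m' m (act_eq_transmit.1 hm) hi)⟩
  rw [content, channel_eq_message hsole]
  rfl

lemma content_eq_none {σ : Slot} {st : ι → St} (h : ∀ i, Q.send σ (st i) = none) :
    Q.content σ st = none := by
  have hsilent (i : ι) (m : M) : Q.act σ (st i) ≠ .transmit m := fun hm => by
    simpa [h i] using act_eq_transmit.1 hm
  rw [content, channel_eq_silence hsilent]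
  rfl

open Classical in
lemma UniqueSender.stepAll_apply {σ : Slot} {st : ι → St} (h : Q.UniqueSender σ st) (i : ι) :
    Q.stepAll st σ i =
      Q.recv σ (st i) (if Q.interested σ (st i) then Q.content σ st else none) := by
  rw [stepAll, advance]
  cases hs : Q.send σ (st i) with
  | none => rfl
  | some m => rw [h.content_eq hs]; rfl

lemma toOption_hear_listen (ch : Signal M) :
    (CDModel.noCD.hear ch .listen).toOption = ch.toOption := by
  cases ch <;> rfl

lemma advance_toOption_hear (σ : Slot) (st : ι → St) (i : ι) :
    Q.advance σ (st i)
        (CDModel.noCD.hear (channel fun j => Q.act σ (st j)) (Q.act σ (st i))).toOption =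
      Q.stepAll st σ i := by
  rw [stepAll, advance, advance, content]
  congr 1
  by_cases hi : Q.interested σ (st i)
  · simp only [hi, if_true]
    cases hs : Q.send σ (st i) with
    | some m => rfl
    | none => rw [act_of_send_eq_none hs hi, toOption_hear_listen]
  · simp only [hi, if_false]

lemma run_toProtocol (x : ι → X) (t : ℕ) : Q.toProtocol.run .noCD x t = fun i =>
    (Q.schedule.drop t, Q.exec (Q.schedule.take t) (fun j => Q.start (x j)) i) := by
  induction t with
  | zero => rfl
  | succ t ih =>
    funext i
    rw [Protocol.run, ih]
    by_cases ht : t < Q.schedule.length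
    · rw [List.drop_eq_getElem_cons ht, ← List.take_concat_get' _ _ ht, exec_append]
      exact congrArg (Prod.mk _) (advance_toOption_hear Q.schedule[t] _ i)
    · have hle : Q.schedule.length ≤ t := not_lt.1 ht
      rw [List.drop_eq_nil_of_le hle, List.drop_eq_nil_of_le (hle.trans t.le_succ),
        List.take_of_length_le hle, List.take_of_length_le (hle.trans t.le_succ)]
      rfl

lemma actionAt_toProtocol (x : ι → X) {t : ℕ} (ht : t < Q.schedule.length) (i : ι) :
    Q.toProtocol.actionAt .noCD x t i =
      Q.act Q.schedule[t] (Q.exec (Q.schedule.take t) (fun i => Q.start (x i)) i) := by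
  rw [Protocol.actionAt, run_toProtocol, List.drop_eq_getElem_cons ht]
  rfl

lemma actionAt_toProtocol_of_le (x : ι → X) {t : ℕ} (ht : Q.schedule.length ≤ t) (i : ι) :
    Q.toProtocol.actionAt .noCD x t i = .idle := by
  rw [Protocol.actionAt, run_toProtocol, List.drop_eq_nil_of_le ht]
  rfl

lemma outputAt_toProtocol (x : ι → X) (i : ι) :
    Q.toProtocol.OutputAt .noCD x Q.schedule.length i
      (Q.out (Q.exec Q.schedule (fun i => Q.start (x i)) i)) := by
  rw [Protocol.OutputAt, run_toProtocol, List.drop_length, List.take_length]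
  rfl

lemma CollisionFree.uniqueSender {l : List Slot} {st : ι → St} (h : Q.CollisionFree l st)
    {t : ℕ} (ht : t < l.length) : Q.UniqueSender l[t] (Q.exec (l.take t) st) := by
  induction l generalizing st t with
  | nil => simp at ht
  | cons σ l ih =>
    cases t with
    | zero => exact h.1
    | succ t => exact ih h.2 (by simpa using ht)

lemma cost_eq_sum (l : List Slot) (st : ι → St) (i : ι) :
    Q.cost l st i = ∑ t : Fin l.length, (Q.act l[t] (Q.exec (l.take t) st i)).cost := by
  induction l generalizing st with
  | nil => rfl
  | cons σ l ih =>
    rw [cost, ih]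
    exact (Fin.sum_univ_succ (n := l.length) fun t =>
      (Q.act (σ :: l)[t] (Q.exec ((σ :: l).take t) st i)).cost).symm

lemma energy_toProtocol (x : ι → X) (i : ι) :
    Q.toProtocol.energy .noCD x Q.schedule.length i =
      Q.cost Q.schedule (fun i => Q.start (x i)) i := by
  rw [cost_eq_sum, Protocol.energy, Finset.sum_range]
  refine Finset.sum_congr rfl fun t _ => ?_
  rw [actionAt_toProtocol x t.2]
  rfl

lemma eq_of_actionAt_transmit (x : ι → X)
    (h : Q.CollisionFree Q.schedule fun i => Q.start (x i)) {t : ℕ} {i j : ι} {m m' : M}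
    (hi : Q.toProtocol.actionAt .noCD x t i = .transmit m)
    (hj : Q.toProtocol.actionAt .noCD x t j = .transmit m') : i = j := by
  by_cases ht : t < Q.schedule.length
  · rw [actionAt_toProtocol x ht] at hi hj
    exact h.uniqueSender ht i j m m' (act_eq_transmit.1 hi) (act_eq_transmit.1 hj)
  · rw [actionAt_toProtocol_of_le x (by omega)] at hi
    cases hi

end SlotMachine

/-! ### The Census algorithm -/

/-- The slots of the Census algorithm: in `merge i b` block `b` of length `2 ^ i` announces its
members, after `commit i` the devices awake at stage `i + 1` adopt what they heard, in `report y` a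
device `y` whose block has given up introduces itself, in `chain j` the survivor of rank `j` hands
over what it has collected, and in `announce` the leader announces the list. -/
inductive CensusSlot where
  | merge (i b : ℕ)
  | commit (i : ℕ)
  | report (y : ℕ)
  | chain (j : ℕ)
  | announce

/-- The state of a device in the Census algorithm: its ID, the devices that it knows, and those that
it has heard of in the current phase. -/
structure CensusState where
  id : ℕ
  know : Finset ℕ
  buf : Finset ℕ

/-- The device is the last one in the list that it knows. -/
def CensusState.IsLast (L : ℕ) (s : CensusState) : Prop :=
  s.id ∈ s.know ∧ blockRank s.know L s.id + 1 = s.know.card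

instance (L : ℕ) (s : CensusState) : Decidable (s.IsLast L) := by
  unfold CensusState.IsLast; infer_instance

/-- The report slots in which the survivor `x` listens when `A` is the set of survivors. By
`WakeForest.card_survivors_ge` the survivors together cover all report slots. -/
def quota (L : ℕ) (A : Finset ℕ) (x : ℕ) : Finset ℕ :=
  Finset.Ico (40 * blockRank A L x) (40 * (blockRank A L x + 1))

namespace WakeForest

section Machine

variable {L k : ℕ} (F : WakeForest L k)

/-- Device `x` announces block `b` at stage `i` when it knows `A`: it is the first device of the
block that is awake, and sufficiently many are. -/
def IsSpeaker (A : Finset ℕ) (i b x : ℕ) : Prop :=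
  x ∈ block (F.awake A i) i b ∧ (∀ y ∈ block (F.awake A i) i b, x ≤ y) ∧
    F.threshold i ≤ (block (F.awake A i) i b).card

instance (A : Finset ℕ) (i b x : ℕ) : Decidable (F.IsSpeaker A i b x) := by
  unfold IsSpeaker; infer_instance

/-- What a device sends in the Census algorithm. -/
def censusSend : CensusSlot → CensusState → Option (Finset ℕ)
  | .merge i b, s => if F.IsSpeaker s.know i b s.id then some (block s.know i b) else none
  | .commit _, _ => none
  | .report y, s => if s.id = y ∧ s.id ∉ s.know then some {y} else none
  | .chain j, s => if s.id ∈ s.know ∧ blockRank s.know L s.id = j then some s.buf else none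
  | .announce, s => if s.IsLast L then some (s.know ∪ s.buf) else none

/-- When a device wants to receive in the Census algorithm. -/
def censusInterested : CensusSlot → CensusState → Prop
  | .merge i b, s => b / 2 = s.id / 2 ^ (i + 1) ∧ s.id ∈ F.awake s.know (i + 1)
  | .commit _, _ => False
  | .report y, s => s.id ∈ s.know ∧ y ∈ quota L s.know s.id
  | .chain j, s => s.id ∈ s.know ∧ blockRank s.know L s.id = j + 1
  | .announce, _ => True

/-- How a device updates its state in the Census algorithm. -/
def censusRecv : CensusSlot → CensusState → Option (Finset ℕ) → CensusState
  | .commit i, s, _ =>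
      ⟨s.id, if s.id ∈ F.awake s.know (i + 1) then s.buf else s.know, ∅⟩
  | .announce, s, _ => s
  | _, s, o => ⟨s.id, s.know, s.buf ∪ o.getD ∅⟩

/-- The slots of stage `i`. -/
def stageSlots (L i : ℕ) : List CensusSlot :=
  (List.range (2 ^ (L - i))).map (.merge i) ++ [.commit i]

/-- The slots before the announcement. -/
def mainSlots (L : ℕ) : List CensusSlot :=
  (List.range L).flatMap (stageSlots L) ++ (List.range (2 ^ L)).map .report ++
    (List.range (2 ^ L)).map .chain

/-- The Census algorithm on the ID space `{0, …, N - 1}`. -/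
abbrev census (N : ℕ) :
    SlotMachine (Fin N) (Finset ℕ) (Option (Finset (Fin N))) CensusSlot CensusState where
  schedule := mainSlots L ++ [.announce]
  start x := ⟨x, {(x : ℕ)}, ∅⟩
  send := F.censusSend
  interested := F.censusInterested
  recv := F.censusRecv
  out s := if s.IsLast L then
    some (Finset.univ.filter fun j : Fin N => (j : ℕ) ∈ s.know ∪ s.buf) else none

end Machine

/-- The joint state in which device `x` knows `K x` and has heard of `B x`. -/
abbrev joint {ι : Type} (id : ι → ℕ) (K B : ℕ → Finset ℕ) : ι → CensusState :=
  fun j => ⟨id j, K (id j), B (id j)⟩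

/-- The devices have distinct IDs, and `S` is the set of these IDs. -/
structure Enumerates {ι : Type} (id : ι → ℕ) (S : Finset ℕ) : Prop where
  injective : Function.Injective id
  mem_iff : ∀ x, x ∈ S ↔ ∃ j, id j = x

lemma Enumerates.mem {ι : Type} {id : ι → ℕ} {S : Finset ℕ} (hid : Enumerates id S) (j : ι) :
    id j ∈ S :=
  (hid.mem_iff _).2 ⟨j, rfl⟩

variable {L k : ℕ} {F : WakeForest L k} {N : ℕ} {ι : Type} {id : ι → ℕ} {S K : Finset ℕ}
  {B : ℕ → Finset ℕ} {i b x : ℕ}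

lemma leads_joint {σ : CensusSlot} {K B' : ℕ → Finset ℕ} (hcommit : ∀ i, σ ≠ .commit i)
    (hannounce : σ ≠ .announce) (h : (F.census N).UniqueSender σ (joint id K B))
    (hB' : ∀ j z, z ∈ B' (id j) ↔ z ∈ B (id j) ∨
      F.censusInterested σ (joint id K B j) ∧
        z ∈ ((F.census N).content σ (joint id K B)).getD ∅) :
    (F.census N).Leads [σ] (joint id K B) (joint id K B') := by
  have hrecv (s : CensusState) (o : Option (Finset ℕ)) :
      (F.census N).recv σ s o = ⟨s.id, s.know, s.buf ∪ o.getD ∅⟩ := by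
    cases σ <;> first | rfl | exact absurd rfl hannounce | exact absurd rfl (hcommit _)
  convert h.leads using 1
  funext j
  rw [h.stepAll_apply, hrecv, CensusState.mk.injEq]
  refine ⟨rfl, rfl, ?_⟩
  ext z
  rw [hB', Finset.mem_union]
  by_cases hint : F.censusInterested σ (joint id K B j)
  · simp only [hint, true_and, if_true]
  · simp only [hint, false_and, if_false, Option.getD_none, Finset.notMem_empty]

section Stage

lemma Knows.isSpeaker_iff (h : F.Knows S i x K) :
    F.IsSpeaker K i b x ↔ F.IsSpeaker (F.survivors S i) i b x := by
  have hblock (hx : x ∈ F.awake K i) (hb : x / 2 ^ i = b) :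
      block (F.awake K i) i b = block (F.awake (F.survivors S i) i) i b := by
    ext y
    simp only [mem_block, and_congr_left_iff]
    intro hy
    have hmem := F.mem_awake_block_survivors (S := S) (i := i) (x := y)
    rwa [hy, ← hb, ← h.eq_of_mem hx] at hmem
  constructor
  · intro hsp
    obtain ⟨hx, hb⟩ := mem_block.1 hsp.1
    rwa [IsSpeaker, ← hblock hx hb]
  · intro hsp
    obtain ⟨hx, hb⟩ := mem_block.1 hsp.1
    rwa [IsSpeaker, hblock (h.mem_awake_iff.2 hx) hb]

lemma Knows.censusSend_merge (h : F.Knows S i x K) (U : Finset ℕ) :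
    F.censusSend (.merge i b) ⟨x, K, U⟩ =
      if F.IsSpeaker (F.survivors S i) i b x then some (block (F.survivors S (i + 1)) i b)
      else none := by
  rw [censusSend]
  simp only [h.isSpeaker_iff]
  split_ifs with hsp
  · obtain ⟨hx, hb⟩ := mem_block.1 hsp.1
    rw [h.eq_of_mem (h.mem_awake_iff.2 hx)]
    congr 1
    ext y
    simp only [mem_block, F.mem_survivors_succ]
    have := hsp.2.2
    grind
  · rfl

lemma uniqueSender_merge (hid : Enumerates id S) :
    (F.census N).UniqueSender (.merge i b) (joint id (F.knowledge S i) B) := by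
  intro j j' m m' h h'
  have hsend (j : ι) := (F.knows_knowledge (hid.mem j) i).censusSend_merge (b := b) (B (id j))
  obtain ⟨h, -⟩ := Option.ite_none_right_eq_some.1 ((hsend j).symm.trans h)
  obtain ⟨h', -⟩ := Option.ite_none_right_eq_some.1 ((hsend j').symm.trans h')
  exact hid.injective (le_antisymm (h.2.1 _ h'.1) (h'.2.1 _ h.1))

lemma content_merge (hid : Enumerates id S) :
    ((F.census N).content (.merge i b) (joint id (F.knowledge S i) B)).getD ∅ =
      block (F.survivors S (i + 1)) i b := by
  have hsend (j : ι) := (F.knows_knowledge (hid.mem j) i).censusSend_merge (b := b) (B (id j))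
  by_cases h : ∃ j, F.IsSpeaker (F.survivors S i) i b (id j)
  · obtain ⟨j, hj⟩ := h
    rw [(uniqueSender_merge hid).content_eq ((hsend j).trans (if_pos hj)), Option.getD_some]
  · push Not at h
    rw [SlotMachine.content_eq_none fun j => (hsend j).trans (if_neg (h j)), Option.getD_none,
      eq_comm, Finset.eq_empty_iff_forall_notMem]
    intro y hy
    obtain ⟨hyS, rfl⟩ := mem_block.1 hy
    set V := block (F.awake (F.survivors S i) i) i (y / 2 ^ i)
    have hthr : F.threshold i ≤ V.card := (F.mem_survivors_succ.1 hyS).2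
    have hne : V.Nonempty := Finset.card_pos.1 ((F.one_le_threshold i).trans hthr)
    obtain ⟨j, hj⟩ := (hid.mem_iff _).1
      (F.survivors_subset S i (F.awake_subset _ _ (mem_block.1 (V.min'_mem hne)).1))
    exact h j ⟨hj ▸ V.min'_mem hne, fun z hz => hj ▸ V.min'_le z hz, hthr⟩

/-- What device `x` has heard of after the first `n` merging slots of stage `i`. -/
def merged (F : WakeForest L k) (S : Finset ℕ) (i n x : ℕ) : Finset ℕ :=
  (F.survivors S (i + 1)).filter fun z => z / 2 ^ i < n ∧ z / 2 ^ (i + 1) = x / 2 ^ (i + 1) ∧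
    x ∈ F.awake (F.knowledge S i x) (i + 1)

lemma leads_merge (hid : Enumerates id S) (n : ℕ) :
    (F.census N).Leads [.merge i n] (joint id (F.knowledge S i) (F.merged S i n))
      (joint id (F.knowledge S i) (F.merged S i (n + 1))) := by
  refine leads_joint (by simp) (by simp) (uniqueSender_merge hid) fun j z => ?_
  rw [content_merge hid]
  simp only [censusInterested, merged, Finset.mem_filter, mem_block]
  have hdiv : z / 2 ^ (i + 1) = z / 2 ^ i / 2 := by rw [Nat.div_div_eq_div_mul, pow_succ]
  rw [hdiv, Nat.lt_succ_iff_lt_or_eq]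
  grind

lemma leads_commit (hL : ∀ x ∈ S, x < 2 ^ L) (hi : i < L) :
    (F.census N).Leads [.commit i] (joint id (F.knowledge S i) (F.merged S i (2 ^ (L - i))))
      (joint id (F.knowledge S (i + 1)) fun _ => ∅) := by
  have hsilent : (F.census N).UniqueSender (.commit i)
      (joint id (F.knowledge S i) (F.merged S i (2 ^ (L - i)))) := fun _ _ _ _ h => nomatch h
  convert hsilent.leads using 1
  funext j
  have hmerged (h : id j ∈ F.awake (F.knowledge S i (id j)) (i + 1)) :
      F.merged S i (2 ^ (L - i)) (id j) =
        block (F.survivors S (i + 1)) (i + 1) (id j / 2 ^ (i + 1)) := by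
    refine Finset.filter_congr fun z hz => ?_
    have : z / 2 ^ i < 2 ^ (L - i) := by
      rw [Nat.div_lt_iff_lt_mul (by positivity), ← pow_add, Nat.sub_add_cancel hi.le]
      exact hL z (F.survivors_subset S _ hz)
    simp only [this, h, true_and, and_true]
  rw [hsilent.stepAll_apply]
  simp only [censusRecv, CensusState.mk.injEq, true_and, and_true, knowledge]
  split_ifs with h
  · exact (hmerged h).symm
  · rfl

lemma merged_zero : F.merged S i 0 = fun _ => ∅ := by
  funext x
  simp [merged]

lemma leads_stage (hid : Enumerates id S) (hL : ∀ x ∈ S, x < 2 ^ L) (hi : i < L) :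
    (F.census N).Leads (stageSlots L i) (joint id (F.knowledge S i) fun _ => ∅)
      (joint id (F.knowledge S (i + 1)) fun _ => ∅) := by
  have hmerge := SlotMachine.leads_map_range (fun n => leads_merge (N := N) (F := F) (i := i) hid n)
    (2 ^ (L - i))
  rw [merged_zero] at hmerge
  exact hmerge.append (leads_commit hL hi)

open Classical in
lemma cost_stage_le (hid : Enumerates id S) (i : ℕ) (j : ι) :
    (F.census N).cost (stageSlots L i) (joint id (F.knowledge S i) fun _ => ∅) j ≤
      (if F.MayWake S (id j) i then 1 else 0) +
        2 * if F.MayWake S (id j) (i + 1) then 1 else 0 := by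
  have hleads := leads_merge (N := N) (F := F) (i := i) hid
  have hknow := F.knows_knowledge (hid.mem j) i
  have hmerge := SlotMachine.cost_map_range_le hleads (2 ^ (L - i)) (i := j)
    (P := if F.MayWake S (id j) i then {id j / 2 ^ i} else ∅)
    (R := if F.MayWake S (id j) (i + 1) then
      Finset.Ico (2 * (id j / 2 ^ (i + 1))) (2 * (id j / 2 ^ (i + 1)) + 2) else ∅)
    (fun t ht => by
      simp only [censusSend, ne_eq, ite_eq_right_iff, reduceCtorEq, imp_false, not_not] at ht
      obtain ⟨hawake, hb⟩ := mem_block.1 ht.1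
      rw [if_pos (hknow.mayWake hawake), Finset.mem_singleton, hb])
    (fun t ht => by
      rw [if_pos (hknow.mayWake_succ ht.2), Finset.mem_Ico]
      have := ht.1
      simp only at this
      omega)
  have hcommit (st : ι → CensusState) : (F.census N).cost [.commit i] st j = 0 := by
    simp [SlotMachine.cost, SlotMachine.act, censusSend, censusInterested, Action.cost]
  rw [merged_zero] at hmerge
  rw [stageSlots, SlotMachine.cost_append, hcommit, add_zero]
  refine hmerge.trans_eq ?_
  split_ifs <;> simp

lemma leads_stages (hid : Enumerates id S) (hL : ∀ x ∈ S, x < 2 ^ L) :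
    (F.census N).Leads ((List.range L).flatMap (stageSlots L))
      (joint id (fun x => {x}) fun _ => ∅) (joint id (F.knowledge S L) fun _ => ∅) :=
  SlotMachine.leads_flatMap_range (st := fun i => joint id (F.knowledge S i) fun _ => ∅)
    fun _ hi => leads_stage hid hL hi

lemma cost_stages_le (hid : Enumerates id S) (hL : ∀ x ∈ S, x < 2 ^ L) (j : ι) :
    (F.census N).cost ((List.range L).flatMap (stageSlots L))
      (joint id (fun x => {x}) fun _ => ∅) j ≤ 3 * k + 200 := by
  classical
  let w (i : ℕ) : ℕ := if F.MayWake S (id j) i then 1 else 0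
  have hw (n : ℕ) : ∑ i ∈ Finset.range n, w i ≤ k + 66 + (n - L) := by
    rw [← Finset.card_filter]
    exact F.card_mayWake_le S (id j) n
  calc _ = ∑ i ∈ Finset.range L,
        (F.census N).cost (stageSlots L i) (joint id (F.knowledge S i) fun _ => ∅) j :=
        SlotMachine.cost_flatMap_range (st := fun i => joint id (F.knowledge S i) fun _ => ∅)
          (fun _ hi => leads_stage hid hL hi) j
    _ ≤ ∑ i ∈ Finset.range L, (w i + 2 * w (i + 1)) :=
        Finset.sum_le_sum fun i _ => cost_stage_le hid i j
    _ ≤ ∑ i ∈ Finset.range L, w i + 2 * ∑ i ∈ Finset.range (L + 1), w i := by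
        rw [Finset.sum_add_distrib, ← Finset.mul_sum, Finset.sum_range_succ' w]
        omega
    _ ≤ 3 * k + 200 := by
        have := hw L
        have := hw (L + 1)
        omega

end Stage

end WakeForest

namespace WakeForest

variable {L k : ℕ} {F : WakeForest L k} {N : ℕ} {ι : Type} {id : ι → ℕ} {S : Finset ℕ}
  {B : ℕ → Finset ℕ} {x : ℕ}

lemma mem_knowledge_iff (hL : ∀ x ∈ S, x < 2 ^ L) (hx : x ∈ S) :
    x ∈ F.knowledge S L x ↔ x ∈ F.survivors S L := by
  simpa only [and_true] using F.mem_knowledge_and_iff hL hx fun _ => True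

section Report

/-- What device `x` has heard of after the first `n` report slots. -/
def reported (F : WakeForest L k) (S : Finset ℕ) (n x : ℕ) : Finset ℕ :=
  (S \ F.survivors S L).filter fun z =>
    (x ∈ F.survivors S L ∧ z ∈ quota L (F.survivors S L) x) ∧ z < n

lemma send_report (hid : Enumerates id S) (hL : ∀ x ∈ S, x < 2 ^ L) (n : ℕ) (j : ι) :
    (F.census N).send (.report n) (joint id (F.knowledge S L) B j) =
      if id j = n ∧ id j ∉ F.survivors S L then some {n} else none := by
  simp only [censusSend, F.mem_knowledge_iff hL (hid.mem j)]

lemma uniqueSender_report (hid : Enumerates id S) (hL : ∀ x ∈ S, x < 2 ^ L) (n : ℕ) :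
    (F.census N).UniqueSender (.report n) (joint id (F.knowledge S L) B) := by
  intro j j' m m' h h'
  rw [send_report hid hL, Option.ite_none_right_eq_some] at h h'
  exact hid.injective (h.1.1.trans h'.1.1.symm)

lemma mem_content_report (hid : Enumerates id S) (hL : ∀ x ∈ S, x < 2 ^ L) {n z : ℕ} :
    z ∈ ((F.census N).content (.report n) (joint id (F.knowledge S L) B)).getD ∅ ↔
      z ∈ S \ F.survivors S L ∧ z = n := by
  by_cases hn : n ∈ S \ F.survivors S L
  · obtain ⟨hnS, hnA⟩ := Finset.mem_sdiff.1 hn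
    obtain ⟨j, rfl⟩ := (hid.mem_iff n).1 hnS
    rw [(uniqueSender_report hid hL _).content_eq
      ((send_report hid hL _ j).trans (if_pos ⟨rfl, hnA⟩)), Option.getD_some, Finset.mem_singleton]
    grind
  · have hsilent (j : ι) :
        (F.census N).send (.report n) (joint id (F.knowledge S L) B j) = none := by
      rw [send_report hid hL, if_neg]
      rintro ⟨rfl, hj⟩
      exact hn (Finset.mem_sdiff.2 ⟨hid.mem j, hj⟩)
    rw [SlotMachine.content_eq_none hsilent, Option.getD_none]
    grind

lemma leads_report (hid : Enumerates id S) (hL : ∀ x ∈ S, x < 2 ^ L) (n : ℕ) :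
    (F.census N).Leads [.report n] (joint id (F.knowledge S L) (F.reported S n))
      (joint id (F.knowledge S L) (F.reported S (n + 1))) := by
  refine leads_joint (by simp) (by simp) (uniqueSender_report hid hL n) fun j z => ?_
  rw [mem_content_report hid hL, censusInterested,
    F.mem_knowledge_and_iff hL (hid.mem j) fun A => n ∈ quota L A (id j)]
  simp only [reported, Finset.mem_filter, Nat.lt_succ_iff_lt_or_eq]
  grind

lemma cost_reports_le (hid : Enumerates id S) (hL : ∀ x ∈ S, x < 2 ^ L) (n : ℕ) (j : ι) :
    (F.census N).cost ((List.range n).map .report) (joint id (F.knowledge S L) (F.reported S 0)) j ≤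
      41 := by
  refine (SlotMachine.cost_map_range_le (leads_report (F := F) (N := N) hid hL) n (i := j)
    (P := {id j}) (R := quota L (F.knowledge S L (id j)) (id j)) (fun t ht => ?_)
    fun t ht => ht.2).trans_eq ?_
  · simp only [censusSend, ne_eq, ite_eq_right_iff, reduceCtorEq, imp_false, not_not] at ht
    exact Finset.mem_singleton.2 ht.1.symm
  · rw [Finset.card_singleton, quota, Nat.card_Ico]
    omega

lemma reported_zero : F.reported S 0 = fun _ => ∅ := by
  funext x
  simp [reported]

end Report

section Chain

/-- What the survivor `x` has collected after the first `n` slots of the chain. -/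
def collected (F : WakeForest L k) (S : Finset ℕ) (n x : ℕ) : Finset ℕ :=
  (S \ F.survivors S L).filter fun z => x ∈ F.survivors S L ∧
    (n < blockRank (F.survivors S L) L x → 40 * blockRank (F.survivors S L) L x ≤ z) ∧
      z < 40 * (blockRank (F.survivors S L) L x + 1)

lemma reported_two_pow (hL : ∀ x ∈ S, x < 2 ^ L) : F.reported S (2 ^ L) = F.collected S 0 := by
  funext x
  refine Finset.filter_congr fun z hz => ?_
  have := hL z (Finset.mem_sdiff.1 hz).1
  simp only [quota, Finset.mem_Ico]
  grind

lemma send_chain (hid : Enumerates id S) (hL : ∀ x ∈ S, x < 2 ^ L) (n : ℕ) (j : ι) :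
    (F.census N).send (.chain n) (joint id (F.knowledge S L) B j) =
      if id j ∈ F.survivors S L ∧ blockRank (F.survivors S L) L (id j) = n then some (B (id j))
      else none := by
  simp only [censusSend, F.mem_knowledge_and_iff hL (hid.mem j) fun A => blockRank A L (id j) = n]

lemma uniqueSender_chain (hid : Enumerates id S) (hL : ∀ x ∈ S, x < 2 ^ L) (n : ℕ) :
    (F.census N).UniqueSender (.chain n) (joint id (F.knowledge S L) B) := by
  intro j j' m m' h h'
  rw [send_chain hid hL, Option.ite_none_right_eq_some] at h h'
  refine hid.injective (blockRank_inj h.1.1 h'.1.1 ?_ (h.1.2.trans h'.1.2.symm))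
  rw [Nat.div_eq_of_lt (hL _ (hid.mem j)), Nat.div_eq_of_lt (hL _ (hid.mem j'))]

lemma leads_chain (hid : Enumerates id S) (hL : ∀ x ∈ S, x < 2 ^ L) (n : ℕ) :
    (F.census N).Leads [.chain n] (joint id (F.knowledge S L) (F.collected S n))
      (joint id (F.knowledge S L) (F.collected S (n + 1))) := by
  refine leads_joint (by simp) (by simp) (uniqueSender_chain hid hL n) fun j z => ?_
  rw [censusInterested,
    F.mem_knowledge_and_iff hL (hid.mem j) fun A => blockRank A L (id j) = n + 1]
  by_cases hj : id j ∈ F.survivors S L ∧ blockRank (F.survivors S L) L (id j) = n + 1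
  · obtain ⟨y, hyA, -, hyn⟩ := exists_blockRank_eq (U := F.survivors S L) (p := L) (j := n)
      (b := id j / 2 ^ L) (by have := blockRank_lt_card (p := L) hj.1; omega)
    obtain ⟨i, rfl⟩ := (hid.mem_iff y).1 (F.survivors_subset S L hyA)
    rw [(uniqueSender_chain hid hL n).content_eq
      ((send_chain hid hL n i).trans (if_pos ⟨hyA, hyn⟩)), Option.getD_some]
    simp only [collected, Finset.mem_filter, hj, hyA, hyn]
    grind
  · simp only [hj, false_and, or_false, collected, Finset.mem_filter]
    grind

lemma cost_chains_le (hid : Enumerates id S) (hL : ∀ x ∈ S, x < 2 ^ L) (n : ℕ) (j : ι) :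
    (F.census N).cost ((List.range n).map .chain) (joint id (F.knowledge S L) (F.collected S 0)) j ≤
      2 := by
  refine SlotMachine.cost_map_range_le (leads_chain (F := F) (N := N) hid hL) n (i := j)
    (P := {blockRank (F.knowledge S L (id j)) L (id j)})
    (R := {blockRank (F.knowledge S L (id j)) L (id j) - 1}) (fun t ht => ?_) fun t ht => ?_
  · simp only [censusSend, ne_eq, ite_eq_right_iff, reduceCtorEq, imp_false, not_not] at ht
    exact Finset.mem_singleton.2 ht.2.symm
  · exact Finset.mem_singleton.2 (Nat.eq_sub_of_add_eq ht.2.symm)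

end Chain

section MainSlots

lemma leads_mainSlots (hid : Enumerates id S) (hL : ∀ x ∈ S, x < 2 ^ L) :
    (F.census N).Leads (mainSlots L) (joint id (fun x => {x}) fun _ => ∅)
      (joint id (F.knowledge S L) (F.collected S (2 ^ L))) := by
  have hreport := SlotMachine.leads_map_range (leads_report (F := F) (N := N) hid hL) (2 ^ L)
  rw [reported_zero, reported_two_pow hL] at hreport
  exact ((leads_stages hid hL).append hreport).append
    (SlotMachine.leads_map_range (leads_chain hid hL) _)

lemma cost_mainSlots_le (hid : Enumerates id S) (hL : ∀ x ∈ S, x < 2 ^ L) (j : ι) :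
    (F.census N).cost (mainSlots L) (joint id (fun x => {x}) fun _ => ∅) j ≤ 3 * k + 250 := by
  have hreport := SlotMachine.leads_map_range (leads_report (F := F) (N := N) hid hL) (2 ^ L)
  have hcost := cost_reports_le (F := F) (N := N) hid hL (2 ^ L) j
  rw [reported_zero] at hreport hcost
  rw [reported_two_pow hL] at hreport
  rw [mainSlots, ((leads_stages hid hL).append hreport).cost_append,
    (leads_stages hid hL).cost_append]
  have := cost_stages_le (F := F) (N := N) hid hL j
  have := cost_chains_le (F := F) (N := N) hid hL (2 ^ L) j
  omega

lemma length_stages_le {L n : ℕ} (hn : n ≤ L) :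
    ((List.range n).flatMap (stageSlots L)).length + 2 * 2 ^ (L - n) ≤ 2 * 2 ^ L + n := by
  induction n with
  | zero => simp
  | succ n ih =>
    have hpow : 2 ^ (L - n) = 2 * 2 ^ (L - (n + 1)) := by
      rw [← pow_succ']
      congr 1
      omega
    rw [List.range_succ, List.flatMap_append, List.flatMap_singleton, List.length_append]
    simp only [stageSlots, List.length_append, List.length_map, List.length_range,
      List.length_singleton]
    have := ih (by omega)
    omega

lemma length_mainSlots_le (L : ℕ) : (mainSlots L).length + 2 ≤ 6 * 2 ^ L := by
  have hstages := length_stages_le le_rfl (L := L)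
  have : L < 2 ^ L := Nat.lt_two_pow_self
  rw [Nat.sub_self, pow_zero] at hstages
  simp only [mainSlots, List.length_append, List.length_map, List.length_range]
  omega

end MainSlots

end WakeForest

lemma invAck_spec (x : ℝ) : 1 ≤ invAck x ∧ x ≤ ack (invAck x) (invAck x) := by
  have hne : {k : ℕ | 1 ≤ k ∧ x ≤ (ack k k : ℝ)}.Nonempty := by
    refine ⟨⌈x⌉₊ + 1, by omega, (Nat.le_ceil x).trans ?_⟩
    exact_mod_cast (Nat.le_succ _).trans (lt_ack_left _ _).le
  exact Nat.sInf_mem hne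

lemma invAck_mono : Monotone invAck := fun _ y h =>
  Nat.sInf_le ⟨(invAck_spec y).1, h.trans (invAck_spec y).2⟩

lemma clog_le_ack_invAck (N : ℕ) : Nat.clog 2 N ≤ ack (invAck N) (invAck N) :=
  (Nat.clog_le_of_le_pow Nat.lt_two_pow_self.le).trans (by exact_mod_cast (invAck_spec N).2)

lemma two_pow_clog_le {N : ℕ} (hN : 1 ≤ N) : 2 ^ Nat.clog 2 N ≤ 2 * N := by
  rcases hN.lt_or_eq with h | rfl
  · have hpred := Nat.pow_pred_clog_lt_self one_lt_two h
    have hpow : 2 ^ Nat.clog 2 N = 2 ^ (Nat.clog 2 N).pred * 2 := by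
      rw [← pow_succ, ← Nat.succ_eq_add_one, Nat.succ_pred (Nat.clog_pos one_lt_two h).ne']
    omega
  · simp

namespace WakeForest

variable {L k : ℕ} {F : WakeForest L k} {N : ℕ}

section Announce

variable {ι : Type} {id : ι → ℕ} {S : Finset ℕ} {B : ℕ → Finset ℕ}

lemma isLast_joint_iff (hid : Enumerates id S) (hL : ∀ x ∈ S, x < 2 ^ L) (j : ι) :
    (joint id (F.knowledge S L) B j).IsLast L ↔ id j ∈ F.survivors S L ∧
      blockRank (F.survivors S L) L (id j) + 1 = (F.survivors S L).card :=
  F.mem_knowledge_and_iff hL (hid.mem j) fun A => blockRank A L (id j) + 1 = A.card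

lemma send_announce (s : CensusState) : (F.census N).send .announce s =
    if s.IsLast L then some (s.know ∪ s.buf) else none := rfl

lemma uniqueSender_announce (hid : Enumerates id S) (hL : ∀ x ∈ S, x < 2 ^ L) :
    (F.census N).UniqueSender .announce (joint id (F.knowledge S L) B) := by
  intro j j' m m' h h'
  rw [send_announce, Option.ite_none_right_eq_some, isLast_joint_iff hid hL] at h h'
  refine hid.injective (blockRank_inj (p := L) h.1.1 h'.1.1 ?_ (by omega))
  rw [Nat.div_eq_of_lt (hL _ (hid.mem j)), Nat.div_eq_of_lt (hL _ (hid.mem j'))]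

lemma exists_isLast_joint (hid : Enumerates id S) (hL : ∀ x ∈ S, x < 2 ^ L)
    (hne : (F.survivors S L).Nonempty) :
    ∃ j, (joint id (F.knowledge S L) B j).IsLast L := by
  have hblock : block (F.survivors S L) L 0 = F.survivors S L :=
    Finset.filter_true_of_mem fun y hy => Nat.div_eq_of_lt (hL y (F.survivors_subset S L hy))
  have hpos := hne.card_pos
  obtain ⟨y, hy, -, hrank⟩ := exists_blockRank_eq (U := F.survivors S L) (p := L) (b := 0)
    (j := (F.survivors S L).card - 1) (by rw [hblock]; omega)
  obtain ⟨j, rfl⟩ := (hid.mem_iff y).1 (F.survivors_subset S L hy)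
  exact ⟨j, (isLast_joint_iff hid hL j).2 ⟨hy, by omega⟩⟩

lemma collected_subset (n x : ℕ) : F.collected S n x ⊆ S :=
  (Finset.filter_subset _ _).trans Finset.sdiff_subset

lemma list_subset_of_isLast (hid : Enumerates id S) (hL : ∀ x ∈ S, x < 2 ^ L) {n : ℕ} {j : ι}
    (hj : (joint id (F.knowledge S L) (F.collected S n) j).IsLast L) :
    F.knowledge S L (id j) ∪ F.collected S n (id j) ⊆ S := by
  have hknow := ((F.knows_knowledge (hid.mem j) L).final hL (hid.mem j)).2 hj.1
  exact Finset.union_subset (hknow ▸ F.survivors_subset S L) (collected_subset _ _)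

lemma list_eq_of_isLast (hid : Enumerates id S) (hL : ∀ x ∈ S, x < 2 ^ L)
    (hcard : 2 ^ L ≤ 40 * (F.survivors S L).card) {j : ι}
    (hj : (joint id (F.knowledge S L) (F.collected S (2 ^ L)) j).IsLast L) :
    F.knowledge S L (id j) ∪ F.collected S (2 ^ L) (id j) = S := by
  refine subset_antisymm (list_subset_of_isLast hid hL hj) fun y hy => Finset.mem_union.2 ?_
  rw [((F.knows_knowledge (hid.mem j) L).final hL (hid.mem j)).2 hj.1]
  refine or_iff_not_imp_left.2 fun hyA => ?_
  obtain ⟨hjA, hlast⟩ := (isLast_joint_iff hid hL j).1 hj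
  have hle : (F.survivors S L).card ≤ 2 ^ L := by
    simpa using Finset.card_le_card (t := Finset.range (2 ^ L)) fun z hz =>
      Finset.mem_range.2 (hL z (F.survivors_subset S L hz))
  have := hL y hy
  exact Finset.mem_filter.2 ⟨Finset.mem_sdiff.2 ⟨hy, hyA⟩, hjA, by omega, by omega⟩

end Announce

section Execution

/-- The IDs as natural numbers. -/
abbrev idSet (S : Finset (Fin N)) : Finset ℕ := S.map Fin.valEmbedding

lemma enumerates_idSet (S : Finset (Fin N)) :
    Enumerates (fun i : S => ((i : Fin N) : ℕ)) (idSet S) where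
  injective _ _ h := Subtype.ext (Fin.ext h)
  mem_iff x := by simp

/-- The states of the devices in `S` after the main slots of the Census algorithm; the announcement
does not change them any more. -/
abbrev finalState (F : WakeForest L k) (S : Finset (Fin N)) : S → CensusState :=
  joint (fun i : S => ((i : Fin N) : ℕ)) (F.knowledge (idSet S) L) (F.collected (idSet S) (2 ^ L))

variable {S : Finset (Fin N)}

lemma idSet_lt (hN : N ≤ 2 ^ L) (S : Finset (Fin N)) : ∀ x ∈ idSet S, x < 2 ^ L := by
  intro x hx
  obtain ⟨j, -, rfl⟩ := Finset.mem_map.1 hx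
  exact j.2.trans_le hN

lemma leads_census (hN : N ≤ 2 ^ L) (S : Finset (Fin N)) :
    (F.census N).Leads (F.census N).schedule (fun i : S => (F.census N).start i)
      (F.finalState S) :=
  (leads_mainSlots (enumerates_idSet S) (idSet_lt hN S)).append
    (uniqueSender_announce (enumerates_idSet S) (idSet_lt hN S)).leads

lemma outputAt_census (hN : N ≤ 2 ^ L) (i : S) :
    (F.census N).toProtocol.OutputAt .noCD (Subtype.val : S → Fin N)
      (F.census N).schedule.length i ((F.census N).out (F.finalState S i)) := by
  rw [← (leads_census hN S).2]
  exact SlotMachine.outputAt_toProtocol _ i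

lemma actionAt_announce (hN : N ≤ 2 ^ L) (i : S) :
    (F.census N).toProtocol.actionAt .noCD (Subtype.val : S → Fin N) (mainSlots L).length i =
      (F.census N).act .announce (F.finalState S i) := by
  rw [SlotMachine.actionAt_toProtocol _ (by simp)]
  simp only [List.getElem_concat_length, List.take_left]
  exact congrArg (fun st : S → CensusState => (F.census N).act .announce (st i))
    (leads_mainSlots (enumerates_idSet S) (idSet_lt hN S)).2

lemma energy_census_le (hN : N ≤ 2 ^ L) (i : S) :
    (F.census N).toProtocol.energy .noCD (Subtype.val : S → Fin N)
      (F.census N).schedule.length i ≤ 3 * k + 251 := by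
  have hleads := leads_mainSlots (F := F) (N := N) (enumerates_idSet S) (idSet_lt hN S)
  have hannounce : (F.census N).cost [.announce] (F.finalState S) i ≤ 1 := by
    rw [SlotMachine.cost, SlotMachine.cost, add_zero]
    cases (F.census N).act .announce (F.finalState S i) <;> simp [Action.cost]
  have hmain := cost_mainSlots_le (F := F) (N := N) (enumerates_idSet S) (idSet_lt hN S) i
  exact ((SlotMachine.energy_toProtocol _ i).trans (hleads.cost_append [.announce] i)).trans_le
    ((Nat.add_le_add hmain hannounce).trans (by omega))

lemma filter_mem_subset {U : Finset ℕ} (hU : U ⊆ idSet S) :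
    (Finset.univ.filter fun j : Fin N => (j : ℕ) ∈ U) ⊆ S := fun j hj => by
  simpa [Fin.val_inj] using hU (Finset.mem_filter.1 hj).2

lemma filter_mem_idSet (S : Finset (Fin N)) :
    (Finset.univ.filter fun j : Fin N => (j : ℕ) ∈ idSet S) = S := by
  ext j
  simp [Fin.val_inj]

lemma card_le_of_out_eq_some (hN : N ≤ 2 ^ L) {i : S} {I : Finset (Fin N)}
    (h : (F.census N).out (F.finalState S i) = some I) : I.card ≤ S.card := by
  obtain ⟨hlast, hI⟩ := Option.ite_none_right_eq_some.1 h
  obtain rfl := Option.some.inj hI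
  exact Finset.card_le_card <| filter_mem_subset <|
    list_subset_of_isLast (enumerates_idSet S) (idSet_lt hN S) hlast

lemma solvesCensus_census (hN : N ≤ 2 ^ L) (hcard : 2 ^ L ≤ 40 * (F.survivors (idSet S) L).card) :
    SolvesCensus (F.census N).toProtocol
      (fun m : Finset ℕ => Finset.univ.filter fun j : Fin N => (j : ℕ) ∈ m) S
      (F.census N).schedule.length := by
  have hid := enumerates_idSet S
  have hL := idSet_lt hN S
  have hne : (F.survivors (idSet S) L).Nonempty := by
    have : 0 < 2 ^ L := by positivity
    exact Finset.card_pos.1 (by omega)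
  obtain ⟨s, hs⟩ : ∃ s, (F.finalState S s).IsLast L := exists_isLast_joint hid hL hne
  have hlist : (F.finalState S s).know ∪ (F.finalState S s).buf = idSet S :=
    list_eq_of_isLast hid hL hcard hs
  have hothers (i : S) (hi : i ≠ s) : ¬(F.finalState S i).IsLast L := fun h =>
    hi (uniqueSender_announce (F := F) (N := N) hid hL i s _ _ (if_pos h) (if_pos hs))
  have hout_leader : (F.census N).out (F.finalState S s) = some S :=
    (if_pos hs).trans (by rw [hlist, filter_mem_idSet])
  have hout_others (i : S) (hi : i ≠ s) : (F.census N).out (F.finalState S i) = none :=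
    if_neg (hothers i hi)
  refine ⟨s, hout_leader ▸ outputAt_census hN s,
    fun i hi => hout_others i hi ▸ outputAt_census hN i,
    (mainSlots L).length, idSet S, by simp, ?_, filter_mem_idSet S, fun i hi => ?_⟩
  · rw [actionAt_announce hN, SlotMachine.act_eq_transmit, send_announce, if_pos hs, hlist]
  · rw [actionAt_announce hN]
    exact SlotMachine.act_of_send_eq_none (if_neg (hothers i hi)) trivial

end Execution

end WakeForest

section DenseCensus

open WakeForest

/-- The wake-up forest used on the ID space `{0, …, N - 1}`. -/
noncomputable def censusForest (N : ℕ) : WakeForest (Nat.clog 2 N) (invAck N) :=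
  Classical.choice (nonempty_wakeForest (clog_le_ack_invAck N))

/-- The dense Census algorithm. -/
noncomputable def denseCensus : CensusFamily (Finset ℕ) :=
  fun N => ((censusForest N).census N).toProtocol

/-- The running time of the dense Census algorithm. -/
noncomputable def censusTime (N : ℕ) : ℕ := ((censusForest N).census N).schedule.length

variable {N : ℕ} {S : Finset (Fin N)}

lemma censusTime_le (hN : 1 ≤ N) : censusTime N ≤ 12 * N := by
  have hlength := length_mainSlots_le (Nat.clog 2 N)
  have hpow := two_pow_clog_le hN
  simp only [censusTime, List.length_append, List.length_singleton]
  omega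

lemma eq_of_denseCensus_transmit {t : ℕ} {i j : S} {m m' : Finset ℕ}
    (hi : (denseCensus N).actionAt .noCD (Subtype.val : S → Fin N) t i = .transmit m)
    (hj : (denseCensus N).actionAt .noCD (Subtype.val : S → Fin N) t j = .transmit m') : i = j :=
  SlotMachine.eq_of_actionAt_transmit _ (leads_census (Nat.le_pow_clog one_lt_two N) S).1 hi hj

lemma exists_outputAt_denseCensus (i : S) :
    ∃ o, (denseCensus N).OutputAt .noCD (Subtype.val : S → Fin N) (censusTime N) i o ∧
      ∀ I, o = some I → I.card ≤ S.card :=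
  ⟨_, outputAt_census (Nat.le_pow_clog one_lt_two N) i,
    fun _ hI => card_le_of_out_eq_some (Nat.le_pow_clog one_lt_two N) hI⟩

lemma energy_denseCensus_le (i : S) :
    (denseCensus N).energy .noCD (Subtype.val : S → Fin N) (censusTime N) i ≤
      3 * invAck N + 251 :=
  energy_census_le (Nat.le_pow_clog one_lt_two N) i

lemma solvesCensus_denseCensus (hN : 1 ≤ N) (hS : (N : ℝ) ≤ 10 * S.card) :
    SolvesCensus (denseCensus N)
      (fun m : Finset ℕ => Finset.univ.filter fun j : Fin N => (j : ℕ) ∈ m) S (censusTime N) := by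
  have hle := Nat.le_pow_clog one_lt_two N
  refine solvesCensus_census hle ?_
  have hsurvivors := (censusForest N).card_survivors_ge (idSet_lt hle S)
  have hpow : (2 : ℝ) ^ Nat.clog 2 N ≤ 2 * N := by exact_mod_cast two_pow_clog_le hN
  rw [Finset.card_map] at hsurvivors
  have : (2 : ℝ) ^ Nat.clog 2 N ≤
      40 * ((censusForest N).survivors (idSet S) (Nat.clog 2 N)).card := by linarith
  exact_mod_cast this

lemma isDenseCensus_denseCensus {c : ℝ} (hc : 0.1 ≤ c) : IsDenseCensus c denseCensus := by
  refine ⟨254, fun N m => Finset.univ.filter fun j : Fin N => (j : ℕ) ∈ m, fun N hN S =>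
    ⟨fun t i j m m' => eq_of_denseCensus_transmit, fun hS =>
      ⟨censusTime N, ?_, solvesCensus_denseCensus hN ?_, fun i => ?_⟩⟩⟩
  · have : (censusTime N : ℝ) ≤ 12 * N := by exact_mod_cast censusTime_le hN
    linarith [N.cast_nonneg (α := ℝ)]
  · nlinarith [N.cast_nonneg (α := ℝ)]
  · have henergy : ((denseCensus N).energy .noCD (Subtype.val : S → Fin N) (censusTime N) i : ℝ) ≤
        3 * invAck N + 251 := by exact_mod_cast energy_denseCensus_le i
    have hpos : (1 : ℝ) ≤ invAck N := by exact_mod_cast (invAck_spec N).1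
    linarith

end DenseCensus

/-! ### The ID assignment -/

namespace Protocol

section Seq

variable {X M O Y ι : Type} {P : Protocol X M Y} {Q : Protocol Y M O} {c : CDModel} {x : ι → X}
  {y : ι → Y} {T : ℕ}

/-- All devices halt after exactly `T` time slots, device `i` with the output `y i`. -/
structure HaltsAt (P : Protocol X M Y) (c : CDModel) (x : ι → X) (T : ℕ) (y : ι → Y) : Prop where
  active : ∀ t < T, ∀ i, ∃ a, P.next (P.run c x t i) = .inl a
  output : ∀ i, P.OutputAt c x T i (y i)

lemma handOver_of_inl {s : P.State} {a : Action M} (h : P.next s = .inl a) :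
    handOver P Q s = .inl s := by
  rw [handOver, h]

lemma handOver_of_inr {s : P.State} {o : Y} (h : P.next s = .inr o) :
    handOver P Q s = .inr (Q.init o) := by
  rw [handOver, h]

lemma step_of_inl {s : P.State} {a : Action M} (h : P.next s = .inl a) (sig : Signal M) :
    P.step s sig = P.update s sig := by
  simp only [step, h]

lemma seq_step_inr (s : Q.State) (sig : Signal M) :
    (P.seq Q).step (.inr s) sig = .inr (Q.step s sig) := by
  simp only [step, seq]
  cases Q.next s <;> rfl

lemma HaltsAt.seq_run_of_le (h : P.HaltsAt c x T y) {t : ℕ} (ht : t ≤ T) (i : ι) :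
    (P.seq Q).run c x t i = handOver P Q (P.run c x t i) := by
  induction t generalizing i with
  | zero => rfl
  | succ t ih =>
    have hrun (j : ι) : (P.seq Q).run c x t j = .inl (P.run c x t j) := by
      obtain ⟨a, ha⟩ := h.active t ht j
      rw [ih (by omega), handOver_of_inl ha]
    obtain ⟨a, ha⟩ := h.active t ht i
    change (P.seq Q).step _ _ = handOver P Q (P.step (P.run c x t i) _)
    simp only [hrun]
    rw [step_of_inl ha]
    rfl

lemma HaltsAt.seq_actionAt_of_lt (h : P.HaltsAt c x T y) {t : ℕ} (ht : t < T) (i : ι) :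
    (P.seq Q).actionAt c x t i = P.actionAt c x t i := by
  obtain ⟨a, ha⟩ := h.active t ht i
  rw [actionAt, h.seq_run_of_le ht.le, handOver_of_inl ha]
  rfl

lemma HaltsAt.seq_run_add (h : P.HaltsAt c x T y) (t : ℕ) (i : ι) :
    (P.seq Q).run c x (T + t) i = .inr (Q.run c y t i) := by
  induction t generalizing i with
  | zero =>
    rw [add_zero, h.seq_run_of_le le_rfl, handOver_of_inr (h.output i)]
    rfl
  | succ t ih =>
    rw [← add_assoc, run]
    simp only [ih]
    exact seq_step_inr _ _

lemma HaltsAt.seq_outputAt (h : P.HaltsAt c x T y) (t : ℕ) (i : ι) (o : O) :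
    (P.seq Q).OutputAt c x (T + t) i o ↔ Q.OutputAt c y t i o := by
  rw [OutputAt, h.seq_run_add]
  rfl

lemma HaltsAt.seq_energy (h : P.HaltsAt c x T y) (t : ℕ) (i : ι) :
    (P.seq Q).energy c x (T + t) i = P.energy c x T i + Q.energy c y t i := by
  rw [energy, Finset.sum_range_add]
  congr 1 <;> refine Finset.sum_congr rfl fun s hs => ?_
  · rw [h.seq_actionAt_of_lt (Finset.mem_range.1 hs)]
  · rw [actionAt, h.seq_run_add]
    rfl

end Seq

end Protocol

section Signals

variable {M ι : Type}

lemma isMessage_channel {a : ι → Action M} :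
    (channel a).IsMessage ↔ ∃ i m, IsSoleTransmitter a i m := by
  constructor
  · rintro ⟨m, hm⟩
    obtain ⟨i, hi⟩ := exists_isSoleTransmitter_of_channel hm
    exact ⟨i, m, hi⟩
  · rintro ⟨i, m, h⟩
    exact ⟨m, channel_eq_message h⟩

lemma isMessage_perceive (c : CDModel) (s : Signal M) :
    (c.perceive s).IsMessage ↔ s.IsMessage := by
  cases c <;> cases s <;> simp [CDModel.perceive, Signal.IsMessage]

lemma isMessage_hear_transmit {c : CDModel} (hc : c = .strongCD ∨ c = .senderCD)
    (s : Signal M) (m : M) : (c.hear s (.transmit m)).IsMessage ↔ s.IsMessage := by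
  rcases hc with rfl | rfl
  · exact isMessage_perceive .strongCD s
  · exact isMessage_perceive .senderCD s

lemma isMessage_hear_listen {c : CDModel} {a : ι → Action (Option M)} {p : ι → Prop}
    (h : ∀ i m, a i = .transmit m ↔ p i ∧ m = none) :
    (c.hear (channel a) .listen).IsMessage ↔ ∃ i, p i ∧ ∀ j, j ≠ i → ¬p j := by
  rw [CDModel.hear, isMessage_perceive, isMessage_channel]
  constructor
  · rintro ⟨i, m, hi, hsole⟩
    exact ⟨i, ((h i m).1 hi).1, fun j hj hp => hsole j hj none ((h j none).2 ⟨hp, rfl⟩)⟩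
  · rintro ⟨i, hi, hsole⟩
    exact ⟨i, none, (h i none).2 ⟨hi, rfl⟩, fun j hj m hm => hsole j hj ((h j m).1 hm).1⟩

lemma ite_transmit_eq_transmit_iff {p : Prop} [Decidable p] {a : Action (Option M)}
    (ha : ∀ m, a ≠ .transmit m) (m : Option M) :
    (if p then Action.transmit none else a) = .transmit m ↔ p ∧ m = none := by
  split_ifs with hp <;> simp [hp, ha, eq_comm]

lemma cost_le_ite {a : Action M} {p : Prop} [Decidable p] (h : ¬p → a = .idle) :
    a.cost ≤ if p then 1 else 0 := by
  split_ifs with hp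
  · cases a <;> simp [Action.cost]
  · rw [h hp, Action.cost]

end Signals

section Tasks

variable {ι : Type} {L β : ℕ} {x : ι → Fin L → Bool} {k : ℕ} {i j : ι}

/-- Device `i` is the only one with the task `k`. -/
def SoleTask (β : ℕ) (x : ι → Fin L → Bool) (k : ℕ) (i : ι) : Prop :=
  k ∈ tasks β (x i) ∧ ∀ j, j ≠ i → k ∉ tasks β (x j)

/-- Device `i` is the only one with the task `2 * k` and another device is the only one with the
task `2 * k + 1`. -/
def SolePair (β : ℕ) (x : ι → Fin L → Bool) (k : ℕ) (i : ι) : Prop :=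
  SoleTask β x (2 * k) i ∧ ∃ j, j ≠ i ∧ SoleTask β x (2 * k + 1) j

lemma SoleTask.eq_of_mem (h : SoleTask β x k i) (hj : k ∈ tasks β (x j)) : j = i :=
  by_contra fun hne => h.2 j hne hj

lemma SoleTask.eq (h : SoleTask β x k i) (h' : SoleTask β x k j) : i = j :=
  h'.eq_of_mem h.1

lemma card_tasks_le (coins : Fin L → Bool) : (tasks β coins).card ≤ β := by
  unfold tasks
  dsimp only
  split_ifs with h
  · exact h.le
  · simp

lemma filter_lt_succ {N t : ℕ} (ht : t < N) (p : ℕ → Prop) [DecidablePred p] :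
    (Finset.univ.filter fun k : Fin N => (k : ℕ) < t + 1 ∧ p k) =
      if p t then insert ⟨t, ht⟩ (Finset.univ.filter fun k : Fin N => (k : ℕ) < t ∧ p k)
      else Finset.univ.filter fun k : Fin N => (k : ℕ) < t ∧ p k := by
  ext k
  split_ifs with hp <;>
    simp only [Finset.mem_insert, Finset.mem_filter, Finset.mem_univ, true_and, Fin.ext_iff,
      Nat.lt_succ_iff_lt_or_eq] <;> grind

end Tasks

section AssignDirect

variable {ι M : Type} {N β : ℕ} {c : CDModel}

lemma assignDirect_action {s : AssignState N} (hs : s.slot < N) :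
    (assignDirect M N β).action s = if s.slot ∈ s.tasks then .transmit none else .idle := by
  simp [Protocol.action, assignDirect, hs]

lemma mem_tasks_and_isMessage_hear_iff (hc : c = .strongCD ∨ c = .senderCD) {L : ℕ}
    (x : ι → Fin L → Bool) (t : ℕ) (i : ι) :
    (t ∈ tasks β (x i) ∧ (c.hear
      (channel fun j => if t ∈ tasks β (x j) then Action.transmit (none : Option M) else .idle)
      (if t ∈ tasks β (x i) then .transmit none else .idle)).IsMessage) ↔ SoleTask β x t i := by
  have hmessage := isMessage_hear_listen (c := c)
    (fun j => ite_transmit_eq_transmit_iff (M := M) (p := t ∈ tasks β (x j)) (a := .idle) (by simp))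
  rw [CDModel.hear, isMessage_perceive] at hmessage
  constructor
  · rintro ⟨hi, h⟩
    rw [if_pos hi, isMessage_hear_transmit hc, hmessage] at h
    obtain ⟨j, hj⟩ : ∃ j, SoleTask β x t j := h
    rwa [hj.eq_of_mem hi]
  · intro h
    rw [if_pos h.1, isMessage_hear_transmit hc, hmessage]
    exact ⟨h.1, i, h⟩

open Classical in
lemma assignDirect_run (hc : c = .strongCD ∨ c = .senderCD) (x : ι → Fin N → Bool) {t : ℕ}
    (ht : t ≤ N) (i : ι) : (assignDirect M N β).run c x t i =
      ⟨tasks β (x i), t, False,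
        Finset.univ.filter fun k : Fin N => (k : ℕ) < t ∧ SoleTask β x k i⟩ := by
  induction t generalizing i with
  | zero => simp [Protocol.run, assignDirect]
  | succ t ih =>
    have htN : t < N := ht
    have hrun (j : ι) := ih htN.le j
    have haction (j : ι) : (assignDirect M N β).action ((assignDirect M N β).run c x t j) =
        if t ∈ tasks β (x j) then .transmit none else .idle := by
      rw [hrun, assignDirect_action htN]
    rw [Protocol.run]
    simp only [haction]
    rw [hrun]
    simp only [Protocol.step, assignDirect, htN, if_true, dif_pos,
      mem_tasks_and_isMessage_hear_iff hc, AssignState.mk.injEq, true_and]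
    exact (filter_lt_succ htN fun k => SoleTask β x k i).symm

open Classical in
lemma haltsAt_assignDirect (hc : c = .strongCD ∨ c = .senderCD) (x : ι → Fin N → Bool) :
    (assignDirect M N β).HaltsAt c x N
      fun i => Finset.univ.filter fun k : Fin N => SoleTask β x k i where
  active t ht i := by
    rw [assignDirect_run hc x ht.le]
    simp [assignDirect, ht]
  output i := by
    rw [Protocol.OutputAt, assignDirect_run hc x le_rfl]
    simp [assignDirect]

lemma energy_assignDirect_le (hc : c = .strongCD ∨ c = .senderCD) (x : ι → Fin N → Bool) (i : ι) :
    (assignDirect M N β).energy c x N i ≤ β := by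
  calc (assignDirect M N β).energy c x N i
      ≤ ∑ t ∈ Finset.range N, if t ∈ tasks β (x i) then 1 else 0 := by
        refine Finset.sum_le_sum fun t ht => cost_le_ite fun hp => ?_
        have htN := Finset.mem_range.1 ht
        rw [Protocol.actionAt, assignDirect_run hc x htN.le, assignDirect_action htN, if_neg hp]
    _ = ((Finset.range N).filter (· ∈ tasks β (x i))).card := (Finset.card_filter _ _).symm
    _ ≤ (tasks β (x i)).card := Finset.card_le_card fun t ht => (Finset.mem_filter.1 ht).2
    _ ≤ β := card_tasks_le _

end AssignDirect

section AssignPaired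

variable {ι M : Type} {N β : ℕ} {c : CDModel}

section Action

variable {s : AssignState N} (hs : s.slot < 4 * N)
include hs

lemma assignPaired_action_two (h : s.slot % 4 = 2) :
    (assignPaired M N β).action s =
      if 2 * (s.slot / 4) ∈ s.tasks then .transmit none
      else if 2 * (s.slot / 4) + 1 ∈ s.tasks then .listen else .idle := by
  simp [Protocol.action, assignPaired, hs, h]

open Classical in
lemma assignPaired_action_three (h : s.slot % 4 = 3) :
    (assignPaired M N β).action s =
      if 2 * (s.slot / 4) + 1 ∈ s.tasks ∧ s.heard then .transmit none
      else if 2 * (s.slot / 4) ∈ s.tasks ∧ 2 * (s.slot / 4) + 1 ∉ s.tasks then .listen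
      else .idle := by
  simp [Protocol.action, assignPaired, hs, h]

lemma assignPaired_action_eq_idle (hA : 2 * (s.slot / 4) ∉ s.tasks)
    (hB : 2 * (s.slot / 4) + 1 ∉ s.tasks) : (assignPaired M N β).action s = .idle := by
  have hmod : s.slot % 4 = 0 ∨ s.slot % 4 = 1 ∨ s.slot % 4 = 2 ∨ s.slot % 4 = 3 := by omega
  rcases hmod with h | h | h | h <;> simp [Protocol.action, assignPaired, hs, h, hA, hB]

end Action

open Classical in
/-- The state of device `i` after `t` slots of the paired ID assignment. -/
noncomputable def pairedState (β : ℕ) (x : ι → Fin (2 * N) → Bool) (t : ℕ) (i : ι) :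
    AssignState N where
  tasks := tasks β (x i)
  slot := t
  heard := t % 4 = 3 ∧ 2 * (t / 4) + 1 ∈ tasks β (x i) ∧ 2 * (t / 4) ∉ tasks β (x i) ∧
    ∃ j, SoleTask β x (2 * (t / 4)) j
  ids := Finset.univ.filter fun k : Fin N => (k : ℕ) < t / 4 ∧ SolePair β x k i

section Hear

variable {x : ι → Fin (2 * N) → Bool} {t : ℕ} {i : ι}

lemma isMessage_hear_paired_two (ht : t < 4 * N) (hmod : t % 4 = 2) :
    (2 * (t / 4) + 1 ∈ tasks β (x i) ∧ 2 * (t / 4) ∉ tasks β (x i) ∧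
      (c.hear (channel fun j => (assignPaired M N β).action (pairedState β x t j))
        ((assignPaired M N β).action (pairedState β x t i))).IsMessage) ↔
      2 * (t / 4) + 1 ∈ tasks β (x i) ∧ 2 * (t / 4) ∉ tasks β (x i) ∧
        ∃ j, SoleTask β x (2 * (t / 4)) j := by
  refine and_congr_right fun hB => and_congr_right fun hA => ?_
  have haction (j : ι) :=
    assignPaired_action_two (M := M) (β := β) (s := pairedState β x t j) ht hmod
  have hlisten : (assignPaired M N β).action (pairedState β x t i) = .listen :=
    (haction i).trans ((if_neg hA).trans (if_pos hB))
  rw [hlisten]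
  refine isMessage_hear_listen fun j m => ?_
  rw [haction]
  refine ite_transmit_eq_transmit_iff (fun m => ?_) m
  split_ifs <;> simp

lemma isMessage_hear_paired_three (ht : t < 4 * N) (hmod : t % 4 = 3) :
    (2 * (t / 4) ∈ tasks β (x i) ∧ 2 * (t / 4) + 1 ∉ tasks β (x i) ∧
      (c.hear (channel fun j => (assignPaired M N β).action (pairedState β x t j))
        ((assignPaired M N β).action (pairedState β x t i))).IsMessage) ↔
      SolePair β x (t / 4) i := by
  classical
  have haction (j : ι) :=
    assignPaired_action_three (M := M) (β := β) (s := pairedState β x t j) ht hmod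
  have hhear (hA : 2 * (t / 4) ∈ tasks β (x i)) (hB : 2 * (t / 4) + 1 ∉ tasks β (x i)) :
      (c.hear (channel fun j => (assignPaired M N β).action (pairedState β x t j))
        ((assignPaired M N β).action (pairedState β x t i))).IsMessage ↔
      ∃ j, (2 * (t / 4) + 1 ∈ tasks β (x j) ∧ (pairedState β x t j).heard) ∧
        ∀ j', j' ≠ j → ¬(2 * (t / 4) + 1 ∈ tasks β (x j') ∧ (pairedState β x t j').heard) := by
    have hlisten : (assignPaired M N β).action (pairedState β x t i) = .listen :=
      (haction i).trans ((if_neg fun h => hB h.1).trans (if_pos ⟨hA, hB⟩))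
    rw [hlisten]
    refine isMessage_hear_listen fun j m => ?_
    rw [haction]
    refine ite_transmit_eq_transmit_iff (fun m => ?_) m
    split_ifs <;> simp
  constructor
  · rintro ⟨hA, hB, hm⟩
    obtain ⟨j, ⟨hjB, -, -, -, i', hi'⟩, hsole⟩ := (hhear hA hB).1 hm
    obtain rfl := hi'.eq_of_mem hA
    refine ⟨hi', j, fun h => hB (h ▸ hjB), hjB, fun j' hj' hB' => ?_⟩
    exact hsole j' hj' ⟨hB', hmod, hB', hi'.2 j' fun h => hB (h ▸ hB'), i, hi'⟩
  · rintro ⟨hi, j, hji, hj⟩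
    have hB : 2 * (t / 4) + 1 ∉ tasks β (x i) := hj.2 i hji.symm
    exact ⟨hi.1, hB, (hhear hi.1 hB).2
      ⟨j, ⟨hj.1, hmod, hj.1, hi.2 j hji, i, hi⟩, fun j' hj' h => hj.2 j' hj' h.1⟩⟩

end Hear

lemma step_pairedState (x : ι → Fin (2 * N) → Bool) {t : ℕ} (ht : t < 4 * N) (i : ι) :
    (assignPaired M N β).step (pairedState β x t i)
      (c.hear (channel fun j => (assignPaired M N β).action (pairedState β x t j))
        ((assignPaired M N β).action (pairedState β x t i))) = pairedState β x (t + 1) i := by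
  classical
  have htwo := isMessage_hear_paired_two (M := M) (c := c) (β := β) (x := x) (i := i) ht
  have hthree := isMessage_hear_paired_three (M := M) (c := c) (β := β) (x := x) (i := i) ht
  generalize c.hear _ _ = sig at htwo hthree ⊢
  have htN : t / 4 < N := by omega
  refine (Protocol.step_of_inl (a := (assignPaired M N β).action (pairedState β x t i))
    (by simp [Protocol.action, assignPaired, pairedState, ht]) sig).trans ?_
  simp only [assignPaired, pairedState, htN, dif_pos, AssignState.mk.injEq, true_and]
  constructor
  · by_cases hmod : t % 4 = 2
    · have hdiv : (t + 1) / 4 = t / 4 := by omega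
      have hmod' : (t + 1) % 4 = 3 := by omega
      simp only [hmod, hmod', hdiv, htwo hmod]
    · have hmod' : (t + 1) % 4 ≠ 3 := by omega
      simp only [hmod, hmod', false_and]
  · by_cases hmod : t % 4 = 3
    · have hdiv : (t + 1) / 4 = t / 4 + 1 := by omega
      rw [hdiv]
      exact (if_congr ((and_iff_right hmod).trans (hthree hmod)) rfl rfl).trans
        (filter_lt_succ htN fun k => SolePair β x k i).symm
    · have hdiv : (t + 1) / 4 = t / 4 := by omega
      rw [hdiv, if_neg fun h => hmod h.1]

lemma assignPaired_run (x : ι → Fin (2 * N) → Bool) {t : ℕ} (ht : t ≤ 4 * N) :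
    (assignPaired M N β).run c x t = pairedState β x t := by
  induction t with
  | zero =>
    funext i
    simp [Protocol.run, assignPaired, pairedState]
  | succ t ih =>
    funext i
    rw [Protocol.run, ih (by omega)]
    exact step_pairedState x ht i

open Classical in
lemma haltsAt_assignPaired (x : ι → Fin (2 * N) → Bool) :
    (assignPaired M N β).HaltsAt c x (4 * N)
      fun i => Finset.univ.filter fun k : Fin N => SolePair β x k i where
  active t ht i := by
    rw [assignPaired_run x ht.le]
    simp [assignPaired, pairedState, ht]
  output i := by
    rw [Protocol.OutputAt, assignPaired_run x le_rfl]
    simp [assignPaired, pairedState]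

lemma card_filter_block_mem_le (n d : ℕ) (U : Finset ℕ) :
    ((Finset.range n).filter fun t => 2 * (t / 4) + d ∈ U).card ≤ 4 * U.card := by
  refine Finset.card_le_mul_card_image_of_maps_to (f := fun t => 2 * (t / 4) + d)
    (fun t ht => (Finset.mem_filter.1 ht).2) 4 fun b _ => ?_
  calc _ ≤ (Finset.Ico (4 * ((b - d) / 2)) (4 * ((b - d) / 2) + 4)).card := by
        refine Finset.card_le_card fun t ht => ?_
        simp only [Finset.mem_filter] at ht
        rw [Finset.mem_Ico]
        omega
    _ = 4 := by simp

lemma energy_assignPaired_le (x : ι → Fin (2 * N) → Bool) (i : ι) :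
    (assignPaired M N β).energy c x (4 * N) i ≤ 8 * β := by
  calc (assignPaired M N β).energy c x (4 * N) i
      ≤ ∑ t ∈ Finset.range (4 * N), if 2 * (t / 4) + 0 ∈ tasks β (x i) ∨
          2 * (t / 4) + 1 ∈ tasks β (x i) then 1 else 0 := by
        refine Finset.sum_le_sum fun t ht => cost_le_ite fun hp => ?_
        have htN := Finset.mem_range.1 ht
        push Not at hp
        rw [Protocol.actionAt, assignPaired_run x htN.le]
        exact assignPaired_action_eq_idle htN hp.1 hp.2
    _ ≤ ((Finset.range (4 * N)).filter fun t => 2 * (t / 4) + 0 ∈ tasks β (x i)).card +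
        ((Finset.range (4 * N)).filter fun t => 2 * (t / 4) + 1 ∈ tasks β (x i)).card := by
        rw [← Finset.card_filter, Finset.filter_or]
        exact Finset.card_union_le _ _
    _ ≤ 4 * β + 4 * β := by
        gcongr <;> exact (card_filter_block_mem_le _ _ _).trans (by gcongr; exact card_tasks_le _)
    _ = 8 * β := by ring

end AssignPaired

section AssignIDs

variable {ι M : Type} {N β : ℕ} {c : CDModel}

/-- The length of the ID assignment. -/
def CDModel.assignTime : CDModel → ℕ → ℕ
  | .strongCD, N => N
  | .senderCD, N => N
  | .receiverCD, N => 4 * N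
  | .noCD, N => 4 * N

/-- Device `i` takes the ID `k`. -/
def Assigned : (c : CDModel) → (β : ℕ) → (x : ι → Fin (c.coinCount N) → Bool) → ℕ → ι → Prop
  | .strongCD, β, x => SoleTask β x
  | .senderCD, β, x => SoleTask β x
  | .receiverCD, β, x => SolePair β x
  | .noCD, β, x => SolePair β x

open Classical in
/-- The IDs that device `i` takes. -/
noncomputable def assignedIDs (c : CDModel) (β : ℕ) (x : ι → Fin (c.coinCount N) → Bool) (i : ι) :
    Finset (Fin N) :=
  Finset.univ.filter fun k : Fin N => Assigned c β x k i

variable {x : ι → Fin (c.coinCount N) → Bool}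

lemma mem_assignedIDs {k : Fin N} {i : ι} : k ∈ assignedIDs c β x i ↔ Assigned c β x k i := by
  simp [assignedIDs]

lemma Assigned.eq {k : ℕ} {i j : ι} (h : Assigned c β x k i) (h' : Assigned c β x k j) :
    i = j := by
  cases c
  · exact SoleTask.eq h h'
  · exact SoleTask.eq h h'
  · exact SoleTask.eq h.1 h'.1
  · exact SoleTask.eq h.1 h'.1

lemma exists_injective_mem_tasks_of_assigned (c : CDModel) (N β : ℕ) :
    ∃ f : ℕ → ℕ, f.Injective ∧
      ∀ (x : ι → Fin (c.coinCount N) → Bool) k i, Assigned c β x k i → f k ∈ tasks β (x i) := by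
  cases c
  · exact ⟨_, Function.injective_id, fun _ _ _ h => h.1⟩
  · exact ⟨_, Function.injective_id, fun _ _ _ h => h.1⟩
  · exact ⟨_, mul_right_injective₀ two_ne_zero, fun _ _ _ h => h.1.1⟩
  · exact ⟨_, mul_right_injective₀ two_ne_zero, fun _ _ _ h => h.1.1⟩

lemma card_assignedIDs_le (x : ι → Fin (c.coinCount N) → Bool) (i : ι) :
    (assignedIDs c β x i).card ≤ β := by
  obtain ⟨f, hf, hmem⟩ := exists_injective_mem_tasks_of_assigned (ι := ι) c N β
  refine le_trans ?_ (card_tasks_le (x i))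
  exact Finset.card_le_card_of_injOn (fun k => f k)
    (fun k hk => hmem x k i (mem_assignedIDs.1 hk)) fun a _ b _ h => Fin.ext (hf h)

lemma haltsAt_assignIDs (c : CDModel) (x : ι → Fin (c.coinCount N) → Bool) :
    (assignIDs M N β c).HaltsAt c x (c.assignTime N) (assignedIDs c β x) := by
  cases c
  · exact haltsAt_assignDirect (.inl rfl) x
  · exact haltsAt_assignDirect (.inr rfl) x
  · exact haltsAt_assignPaired x
  · exact haltsAt_assignPaired x

lemma energy_assignIDs_le (c : CDModel) (x : ι → Fin (c.coinCount N) → Bool) (i : ι) :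
    (assignIDs M N β c).energy c x (c.assignTime N) i ≤ 8 * β := by
  cases c
  · exact (energy_assignDirect_le (.inl rfl) x i).trans (by omega)
  · exact (energy_assignDirect_le (.inr rfl) x i).trans (by omega)
  · exact energy_assignPaired_le x i
  · exact energy_assignPaired_le x i

end AssignIDs

/-! ### Simulating the Census on the taken IDs -/

namespace Protocol

variable {X M O : Type} {P : Protocol X M O} {s : P.State}

lemma action_of_inl {a : Action M} (h : P.next s = .inl a) : P.action s = a := by
  simp only [action, h]

lemma action_of_inr {o : O} (h : P.next s = .inr o) : P.action s = .idle := by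
  simp only [action, h]

lemma step_of_inr {o : O} (h : P.next s = .inr o) (sig : Signal M) : P.step s sig = s := by
  simp only [step, h]

end Protocol

/-- At most one device transmits. -/
def CollisionFree {ι M : Type} (a : ι → Action M) : Prop :=
  ∀ i j m m', a i = .transmit m → a j = .transmit m' → i = j

lemma CollisionFree.isSoleTransmitter {ι M : Type} {a : ι → Action M} (h : CollisionFree a)
    {i : ι} {m : M} (hi : a i = .transmit m) : IsSoleTransmitter a i m :=
  ⟨hi, fun j hj m' hm' => hj (h j i m' m hm' hi)⟩

/-- The set `S` is the disjoint union of the sets `y i` of IDs held by the devices `i`. -/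
structure Distributes {ι : Type} {N : ℕ} (y : ι → Finset (Fin N)) (S : Finset (Fin N)) : Prop where
  mem_iff : ∀ k, k ∈ S ↔ ∃ i, k ∈ y i
  eq_of_mem : ∀ {i j k}, k ∈ y i → k ∈ y j → i = j

namespace Distributes

variable {ι M : Type} {N : ℕ} {c : CDModel} {y : ι → Finset (Fin N)} {S : Finset (Fin N)}
  (h : Distributes y S)
include h

/-- An ID held by device `i` as an element of the set of all IDs. -/
def incl (i : ι) (k : y i) : S := ⟨k, (h.mem_iff k).2 ⟨i, k.2⟩⟩

open Classical in
/-- What device `i` does when the simulated devices perform the actions `a`. -/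
noncomputable def outer (a : S → Action M) (i : ι) : Action (Option M) :=
  outerAction (channel fun k => a (h.incl i k)) (∃ k, a (h.incl i k) = .listen)

variable {a : S → Action M} {i : ι}

lemma channel_incl_of_mem {k : S} {m : M} (hsole : IsSoleTransmitter a k m) (hk : ↑k ∈ y i) :
    channel (fun j => a (h.incl i j)) = .message m :=
  channel_eq_message (i := (⟨k, hk⟩ : y i)) ⟨hsole.1, fun j hj =>
    hsole.2 (h.incl i j) fun heq => hj (Subtype.ext (congrArg (fun l : S => (l : Fin N)) heq))⟩

lemma channel_incl_of_notMem {k : S} {m : M} (hsole : IsSoleTransmitter a k m) (hk : ↑k ∉ y i) :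
    channel (fun j => a (h.incl i j)) = .silence :=
  channel_eq_silence fun j => hsole.2 _ fun heq => hk (heq ▸ j.2)

lemma outer_of_silence (hsilence : channel (fun j => a (h.incl i j)) = .silence)
    [Decidable (∃ k, a (h.incl i k) = .listen)] :
    h.outer a i = if ∃ k, a (h.incl i k) = .listen then .listen else .idle := by
  simp only [outer, hsilence, outerAction]
  congr

lemma outer_ne_transmit_of_silence (hsilence : channel (fun j => a (h.incl i j)) = .silence)
    (m : Option M) : h.outer a i ≠ .transmit m := by
  classical
  rw [h.outer_of_silence hsilence]
  split_ifs <;> simp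

lemma isSoleTransmitter_outer {k : S} {m : M} (hsole : IsSoleTransmitter a k m)
    (hk : ↑k ∈ y i) : IsSoleTransmitter (h.outer a) i (some m) := by
  refine ⟨?_, fun j hj => h.outer_ne_transmit_of_silence <|
    h.channel_incl_of_notMem hsole fun hkj => hj (h.eq_of_mem hkj hk)⟩
  rw [outer, h.channel_incl_of_mem hsole hk, outerAction]

lemma innerSignal_hear_of_listen (ha : CollisionFree a) (c : CDModel) {k : y i}
    (hk : a (h.incl i k) = .listen) :
    innerSignal (channel fun j => a (h.incl i j)) (c.hear (channel (h.outer a)) (h.outer a i)) =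
      CDModel.noCD.hear (channel a) .listen := by
  classical
  have hlisten (hsilence : channel (fun j => a (h.incl i j)) = .silence) :
      h.outer a i = .listen := by
    rw [h.outer_of_silence hsilence, if_pos ⟨k, hk⟩]
  by_cases htransmit : ∃ k m, a k = .transmit m
  · obtain ⟨k₀, m, hm⟩ := htransmit
    have hsole := ha.isSoleTransmitter hm
    rw [channel_eq_message hsole]
    by_cases hi : ↑k₀ ∈ y i
    · rw [h.channel_incl_of_mem hsole hi]
      rfl
    · obtain ⟨i₀, hi₀⟩ := (h.mem_iff k₀).1 k₀.2
      have hsilence := h.channel_incl_of_notMem hsole hi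
      rw [hsilence, hlisten hsilence, channel_eq_message (h.isSoleTransmitter_outer hsole hi₀)]
      cases c <;> rfl
  · push Not at htransmit
    have hsilence (i' : ι) : channel (fun j => a (h.incl i' j)) = .silence :=
      channel_eq_silence fun j => htransmit _
    rw [hsilence, hlisten (hsilence i), channel_eq_silence htransmit,
      channel_eq_silence fun i' => h.outer_ne_transmit_of_silence (hsilence i')]
    cases c <;> rfl

lemma innerSignal_hear (ha : CollisionFree a) (c : CDModel) (k : y i) :
    (match a (h.incl i k) with
      | .listen => innerSignal (channel fun j => a (h.incl i j))
          (c.hear (channel (h.outer a)) (h.outer a i))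
      | _ => .nothing) = CDModel.noCD.hear (channel a) (a (h.incl i k)) := by
  cases hk : a (h.incl i k) with
  | idle => rfl
  | transmit m => rfl
  | listen => exact h.innerSignal_hear_of_listen ha c hk

lemma cost_outer_le (a : S → Action M) (i : ι) :
    (h.outer a i).cost ≤ ∑ k, (a (h.incl i k)).cost := by
  classical
  by_cases hidle : ∀ k, a (h.incl i k) = .idle
  · have hsilence : channel (fun j => a (h.incl i j)) = .silence :=
      channel_eq_silence fun j m => by simp [hidle j]
    rw [h.outer_of_silence hsilence, if_neg (by simp [hidle])]
    exact Nat.zero_le _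
  · push Not at hidle
    obtain ⟨k, hk⟩ := hidle
    calc (h.outer a i).cost ≤ 1 := by cases h.outer a i <;> simp [Action.cost]
      _ ≤ (a (h.incl i k)).cost := by
        revert hk
        cases a (h.incl i k) <;> simp [Action.cost]
      _ ≤ _ := Finset.single_le_sum (f := fun k => (a (h.incl i k)).cost)
        (fun _ _ => Nat.zero_le _) (Finset.mem_univ k)

end Distributes

section Simulate

variable {ι M : Type} {N : ℕ} {D : Protocol (Fin N) M (Option (Finset (Fin N)))} {θ : ℝ}
  {c : CDModel} {y : ι → Finset (Fin N)} {S : Finset (Fin N)}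

section Step

variable {ids : Finset (Fin N)} {v : ids → D.State}

open Classical in
lemma simulate_next_of_halted (h : ∀ k, ∃ o, D.next (v k) = .inr o) :
    (simulate θ D).next ⟨ids, v⟩ =
      .inr (if ∃ k I, D.next (v k) = .inr (some I) ∧ θ * N ≤ I.card
        then .leader else .follower) :=
  if_pos h

open Classical in
lemma simulate_next_of_not_halted (h : ¬∀ k, ∃ o, D.next (v k) = .inr o) :
    (simulate θ D).next ⟨ids, v⟩ = .inl (outerAction (channel fun k => D.action (v k))
      (∃ k, D.action (v k) = .listen)) :=
  if_neg h

open Classical in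
lemma simulate_action : (simulate θ D).action ⟨ids, v⟩ =
    outerAction (channel fun k => D.action (v k)) (∃ k, D.action (v k) = .listen) := by
  by_cases h : ∀ k, ∃ o, D.next (v k) = .inr o
  · have hidle (k : ids) : D.action (v k) = .idle := Protocol.action_of_inr (h k).choose_spec
    simp only [Protocol.action_of_inr (simulate_next_of_halted h), hidle]
    rw [channel_eq_silence (by simp)]
    simp [outerAction]
  · exact Protocol.action_of_inl (simulate_next_of_not_halted h)

lemma simulate_step (sig : Signal (Option M)) : (simulate θ D).step ⟨ids, v⟩ sig =
    ⟨ids, fun k => D.step (v k)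
      (match D.action (v k) with
        | .listen => innerSignal (channel fun j => D.action (v j)) sig
        | _ => .nothing)⟩ := by
  by_cases h : ∀ k, ∃ o, D.next (v k) = .inr o
  · refine (Protocol.step_of_inr (simulate_next_of_halted h) sig).trans ?_
    congr 1
    funext k
    exact (Protocol.step_of_inr (h k).choose_spec _).symm
  · exact Protocol.step_of_inl (simulate_next_of_not_halted h) sig

end Step

variable (h : Distributes y S)
  (hD : ∀ t, CollisionFree (D.actionAt .noCD (Subtype.val : S → Fin N) t))
include hD

lemma simulate_run (t : ℕ) (i : ι) : (simulate θ D).run c y t i =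
    ⟨y i, fun k => D.run .noCD (Subtype.val : S → Fin N) t (h.incl i k)⟩ := by
  induction t generalizing i with
  | zero => rfl
  | succ t ih =>
    have haction (i : ι) : (simulate θ D).action ((simulate θ D).run c y t i) =
        h.outer (D.actionAt .noCD Subtype.val t) i := by
      rw [ih]
      exact simulate_action
    rw [Protocol.run]
    simp only [haction]
    rw [ih]
    refine (simulate_step _).trans (congrArg _ (funext fun k => ?_))
    exact congrArg (D.step _) (h.innerSignal_hear (hD t) c k)

lemma simulate_actionAt (t : ℕ) (i : ι) : (simulate θ D).actionAt c y t i =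
    h.outer (D.actionAt .noCD (Subtype.val : S → Fin N) t) i := by
  rw [Protocol.actionAt, simulate_run h hD]
  exact simulate_action

include h in
lemma simulate_energy_le {T E : ℕ}
    (hE : ∀ k : S, D.energy .noCD (Subtype.val : S → Fin N) T k ≤ E) (i : ι) :
    (simulate θ D).energy c y T i ≤ (y i).card * E := by
  calc (simulate θ D).energy c y T i
      ≤ ∑ t ∈ Finset.range T, ∑ k,
          (D.actionAt .noCD (Subtype.val : S → Fin N) t (h.incl i k)).cost := by
        refine Finset.sum_le_sum fun t _ => ?_
        rw [simulate_actionAt h hD]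
        exact h.cost_outer_le _ i
    _ = ∑ k, D.energy .noCD (Subtype.val : S → Fin N) T (h.incl i k) := Finset.sum_comm
    _ ≤ ∑ _k : y i, E := Finset.sum_le_sum fun k _ => hE _
    _ = (y i).card * E := by simp

open Classical in
include h in
lemma simulate_outputAt {T : ℕ} {o : S → Option (Finset (Fin N))}
    (ho : ∀ k, D.OutputAt .noCD (Subtype.val : S → Fin N) T k (o k)) (i : ι) :
    (simulate θ D).OutputAt c y T i
      (if ∃ k I, ↑k ∈ y i ∧ o k = some I ∧ θ * N ≤ I.card then .leader else .follower) := by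
  rw [Protocol.OutputAt, simulate_run h hD]
  refine (simulate_next_of_halted fun k => ⟨_, ho _⟩).trans (congrArg _ (if_congr ?_ rfl rfl))
  constructor
  · rintro ⟨k, I, hI, hcard⟩
    exact ⟨h.incl i k, I, k.2, Sum.inr.inj ((ho _).symm.trans hI), hcard⟩
  · rintro ⟨k, I, hk, hI, hcard⟩
    exact ⟨⟨k, hk⟩, I, (ho k).trans (congrArg _ hI), hcard⟩

end Simulate

section TestNetworkSize

variable {ι : Type} {c : CDModel} {N β : ℕ} {x : ι → Fin (c.coinCount N) → Bool}

lemma CDModel.density_ge (c : CDModel) : (0.1 : ℝ) ≤ c.density := by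
  cases c <;> norm_num [CDModel.density]

/-- The running time of Test-Network-Size with `N` IDs. -/
noncomputable def CDModel.testTime (c : CDModel) (N : ℕ) : ℕ := c.assignTime N + censusTime N

lemma CDModel.testTime_le (c : CDModel) (hN : 1 ≤ N) : c.testTime N ≤ 16 * N := by
  have hassign : c.assignTime N ≤ 4 * N := by cases c <;> simp only [CDModel.assignTime] <;> omega
  have hcensus := censusTime_le hN
  rw [CDModel.testTime]
  omega

open Classical in
/-- The IDs that are taken by some device. -/
noncomputable def takenIDs (c : CDModel) (β : ℕ) (x : ι → Fin (c.coinCount N) → Bool) :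
    Finset (Fin N) :=
  Finset.univ.filter fun k : Fin N => ∃ i, Assigned c β x k i

lemma mem_takenIDs {k : Fin N} : k ∈ takenIDs c β x ↔ ∃ i, Assigned c β x k i := by
  simp [takenIDs]

lemma distributes_assignedIDs (c : CDModel) (β : ℕ) (x : ι → Fin (c.coinCount N) → Bool) :
    Distributes (assignedIDs c β x) (takenIDs c β x) where
  mem_iff k := by simp only [mem_takenIDs, mem_assignedIDs]
  eq_of_mem hi hj := (mem_assignedIDs.1 hi).eq (mem_assignedIDs.1 hj)

lemma collisionFree_denseCensus (S : Finset (Fin N)) (t : ℕ) :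
    CollisionFree ((denseCensus N).actionAt .noCD (Subtype.val : S → Fin N) t) :=
  fun _ _ _ _ => eq_of_denseCensus_transmit

open Classical in
lemma outputAt_testNetworkSize {o : takenIDs c β x → Option (Finset (Fin N))}
    (ho : ∀ k, (denseCensus N).OutputAt .noCD Subtype.val (censusTime N) k (o k)) (i : ι) :
    (testNetworkSize c N β denseCensus).OutputAt c x (c.testTime N) i
      (if ∃ k I, ↑k ∈ assignedIDs c β x i ∧ o k = some I ∧ c.density * N ≤ I.card
        then .leader else .follower) :=
  ((haltsAt_assignIDs c x).seq_outputAt _ _ _).2 <|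
    simulate_outputAt (distributes_assignedIDs c β x) (collisionFree_denseCensus _) ho i

lemma exists_outputAt_testNetworkSize (x : ι → Fin (c.coinCount N) → Bool) (i : ι) :
    ∃ r, (testNetworkSize c N β denseCensus).OutputAt c x (c.testTime N) i r := by
  choose o ho _ using exists_outputAt_denseCensus (S := takenIDs c β x)
  exact ⟨_, outputAt_testNetworkSize ho i⟩

lemma energy_testNetworkSize_le (x : ι → Fin (c.coinCount N) → Bool) (i : ι) :
    (testNetworkSize c N β denseCensus).energy c x (c.testTime N) i ≤
      8 * β + β * (3 * invAck N + 251) := by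
  rw [testNetworkSize, CDModel.testTime, (haltsAt_assignIDs c x).seq_energy]
  refine Nat.add_le_add (energy_assignIDs_le c x i) ?_
  exact (simulate_energy_le (distributes_assignedIDs c β x) (collisionFree_denseCensus _)
    energy_denseCensus_le i).trans (Nat.mul_le_mul_right _ (card_assignedIDs_le x i))

lemma leaderElected_testNetworkSize (hN : 1 ≤ N)
    (hcard : c.density * N ≤ (takenIDs c β x).card) :
    LeaderElected (testNetworkSize c N β denseCensus) c x (c.testTime N) := by
  classical
  have hN' : (1 : ℝ) ≤ N := by exact_mod_cast hN
  obtain ⟨s, hs, hothers, -⟩ := solvesCensus_denseCensus (S := takenIDs c β x) hN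
    (by nlinarith [c.density_ge, hN'])
  have hrole := outputAt_testNetworkSize
    (o := fun k => if k = s then some (takenIDs c β x) else none) fun k => by
      split_ifs with hk
      · exact hk ▸ hs
      · exact hothers k hk
  obtain ⟨i, hi⟩ := mem_takenIDs.1 s.2
  have hsi : ↑s ∈ assignedIDs c β x i := mem_assignedIDs.2 hi
  refine ⟨i, ?_, fun j hj => ?_⟩
  · convert hrole i using 1
    rw [if_pos ⟨s, _, hsi, if_pos rfl, hcard⟩]
  · convert hrole j using 1
    rw [if_neg]
    rintro ⟨k, I, hk, hI, -⟩
    obtain ⟨rfl, -⟩ : k = s ∧ _ := by simpa using hI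
    exact hj ((distributes_assignedIDs c β x).eq_of_mem hk hsi)

lemma noLeaderElected_testNetworkSize (hcard : (takenIDs c β x).card < c.density * N) :
    NoLeaderElected (testNetworkSize c N β denseCensus) c x (c.testTime N) := by
  classical
  intro i
  choose o ho hle using exists_outputAt_denseCensus (S := takenIDs c β x)
  convert outputAt_testNetworkSize ho i using 1
  rw [if_neg]
  rintro ⟨k, I, -, hI, hdense⟩
  exact (hcard.trans_le hdense).not_ge (by exact_mod_cast hle k I hI)

end TestNetworkSize

open MeasureTheory ProbabilityTheory

/-! ### Coin tosses -/

lemma measureReal_pi_le_card {N : ℕ} {Ω : Type*} [MeasurableSpace Ω] (ν : Measure Ω)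
    [IsProbabilityMeasure ν] {s : Set Ω} (hs : MeasurableSet s) [DecidablePred (· ∈ s)] {δ : ℝ}
    (hδ : 0 ≤ δ) :
    (Measure.pi fun _ : Fin N => ν).real
        {v | (ν.real s + δ) * N ≤ (Finset.univ.filter fun k => v k ∈ s).card} ≤
      Real.exp (-2 * δ ^ 2 * N) := by
  set X : Fin N → (Fin N → Ω) → ℝ := fun k v => s.indicator 1 (v k) - ν.real s with hX
  have hindicator : Measurable (s.indicator (1 : Ω → ℝ)) := measurable_one.indicator hs
  have hindep : iIndepFun X (Measure.pi fun _ : Fin N => ν) :=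
    iIndepFun_pi (X := fun _ ω => s.indicator 1 ω - ν.real s) fun _ =>
      (hindicator.sub_const _).aemeasurable
  have hsub : ∀ k ∈ Finset.univ,
      HasSubgaussianMGF (X k) ((‖(1 : ℝ) - 0‖₊ / 2) ^ 2) (Measure.pi fun _ : Fin N => ν) := by
    intro k _
    have heval := measurePreserving_eval (fun _ : Fin N => ν) k
    refine HasSubgaussianMGF.of_map (X := fun ω => s.indicator 1 ω - ν.real s)
      heval.aemeasurable ?_
    rw [heval.map_eq, ← integral_indicator_one hs]
    refine hasSubgaussianMGF_of_mem_Icc hindicator.aemeasurable (.of_forall fun ω => ?_)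
    exact ⟨Set.indicator_nonneg (fun _ _ => zero_le_one) ω,
      Set.indicator_le_self' (fun _ _ => zero_le_one) ω⟩
  have hsum : ∀ v : Fin N → Ω, ∑ k, X k v =
      (Finset.univ.filter fun k => v k ∈ s).card - ν.real s * N := by
    intro v
    simp [hX, Set.indicator_apply, mul_comm]
  have hexponent : -2 * δ ^ 2 * N =
      -(δ * N) ^ 2 / (2 * ∑ _k : Fin N, ((‖(1 : ℝ) - 0‖₊ / 2) ^ 2 : NNReal)) := by
    rcases N.eq_zero_or_pos with rfl | hN
    · simp
    · simp only [sub_zero, nnnorm_one, one_div, inv_pow, Finset.sum_const, Finset.card_univ,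
        Fintype.card_fin, nsmul_eq_mul, NNReal.coe_mul, NNReal.coe_natCast, NNReal.coe_inv,
        NNReal.coe_pow, NNReal.coe_ofNat]
      field_simp
  rw [hexponent]
  refine (measureReal_mono fun v hv => ?_).trans
    (HasSubgaussianMGF.measure_sum_ge_le_of_iIndepFun hindep hsub (ε := δ * N) (by positivity))
  rw [Set.mem_ofPred_eq, hsum]
  rw [Set.mem_ofPred_eq] at hv
  linarith

lemma measureReal_pi_card_lt {N : ℕ} {Ω : Type*} [MeasurableSpace Ω] (ν : Measure Ω)
    [IsProbabilityMeasure ν] {s : Set Ω} (hs : MeasurableSet s) [DecidablePred (· ∈ s)] {δ : ℝ}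
    (hδ : 0 ≤ δ) :
    (Measure.pi fun _ : Fin N => ν).real
        {v | (Finset.univ.filter fun k => v k ∈ s).card < (ν.real s - δ) * N} ≤
      Real.exp (-2 * δ ^ 2 * N) := by
  refine (measureReal_mono fun v hv => ?_).trans (measureReal_pi_le_card ν hs.compl hδ)
  have hcard : (((Finset.univ.filter fun k => v k ∈ s).card : ℕ) : ℝ) +
      (Finset.univ.filter fun k => v k ∈ sᶜ).card = N := by
    exact_mod_cast (Finset.card_filter_add_card_filter_not (s := Finset.univ) (v · ∈ s)).trans
      (Finset.card_fin N)
  rw [Set.mem_ofPred_eq] at hv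
  rw [Set.mem_ofPred_eq, probReal_compl_eq_one_sub hs]
  linarith

/-- The law of a family of independent coins, each of which shows `true` with probability `p`. The
coins of the algorithm form a family of such families, one for each device. -/
noncomputable def coins (κ : Type) [Fintype κ] (p : ℝ) : Measure (κ → Bool) :=
  Measure.pi fun _ => bernoulliMeasure true false (Set.projIcc 0 1 zero_le_one p)

section Coins

variable {κ ι ρ : Type} [Fintype κ] [Fintype ι] [Fintype ρ] {p : ℝ}

instance : IsProbabilityMeasure (coins κ p) := by
  unfold coins
  infer_instance

instance {n L : ℕ} : IsProbabilityMeasure (coinLaw n L p) :=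
  inferInstanceAs (IsProbabilityMeasure (Measure.pi fun _ => coins (Fin L) p))

lemma coins_real_singleton (hp : p ∈ Set.Icc 0 1) (u : κ → Bool) :
    (coins κ p).real {u} = ∏ j, if u j then p else 1 - p := by
  rw [coins, measureReal_def, Measure.pi_singleton, ENNReal.toReal_prod]
  refine Finset.prod_congr rfl fun j _ => ?_
  rw [← measureReal_def, bernoulliMeasure_real_apply _ (measurableSet_singleton _)]
  cases u j <;> simp [Set.projIcc_of_mem zero_le_one hp]

lemma pi_coins_real_singleton (v : ρ → κ → Bool) :
    (Measure.pi fun _ : ρ => coins κ p).real {v} = ∏ d, (coins κ p).real {v d} := by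
  rw [measureReal_def, Measure.pi_singleton, ENNReal.toReal_prod]
  rfl

lemma coins_real_forall_true (hp : p ∈ Set.Icc 0 1) (S : Finset κ) :
    (coins κ p).real {u | ∀ j ∈ S, u j = true} = p ^ S.card := by
  have hpi : {u : κ → Bool | ∀ j ∈ S, u j = true} = (S : Set κ).pi fun _ => {true} := by
    ext u
    simp [Set.mem_pi]
  rw [hpi, coins, measureReal_def, Measure.pi_pi_finset, ENNReal.toReal_prod]
  simp [Set.projIcc_of_mem zero_le_one hp]

lemma coinLaw_real_row {n L : ℕ} (i : Fin n) (A : Set (Fin L → Bool)) :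
    (coinLaw n L p).real {ω | ω i ∈ A} = (coins (Fin L) p).real A :=
  (measurePreserving_eval (fun _ : Fin n => coins (Fin L) p) i).measureReal_preimage
    (Set.toFinite A).measurableSet.nullMeasurableSet

/-- Cutting the slots into `N` blocks of shape `ρ` makes an array of coins, indexed by devices and
slots, into a sequence of `N` arrays, indexed by the slots of a block and the devices. -/
def blocks {N : ℕ} (e : Fin N × ρ ≃ κ) : (ι → κ → Bool) ≃ (Fin N → ρ → ι → Bool) where
  toFun ω k d i := ω i (e (k, d))
  invFun v i j := v (e.symm j).1 (e.symm j).2 i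
  left_inv ω := by simp
  right_inv v := by simp

lemma map_blocks {N : ℕ} (e : Fin N × ρ ≃ κ) :
    (Measure.pi fun _ : ι => coins κ p).map (blocks e) =
      Measure.pi fun _ : Fin N => Measure.pi fun _ : ρ => coins ι p := by
  refine Measure.ext_of_singleton fun v => ?_
  rw [Measure.map_apply (measurable_of_finite _) (measurableSet_singleton v),
    ← Equiv.image_symm_eq_preimage, Set.image_singleton]
  simp only [coins, Measure.pi_singleton]
  rw [Finset.prod_comm, ← Equiv.prod_comp e, Fintype.prod_prod_type]
  simp [blocks]

end Coins

section Blocks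

variable {n L N : ℕ} {ρ : Type} [Fintype ρ] {p δ : ℝ}

lemma coinLaw_real_preimage_blocks (e : Fin N × ρ ≃ Fin L) (A : Set (Fin N → ρ → Fin n → Bool)) :
    (coinLaw n L p).real (blocks e ⁻¹' A) =
      (Measure.pi fun _ : Fin N => Measure.pi fun _ : ρ => coins (Fin n) p).real A := by
  rw [← map_blocks e,
    map_measureReal_apply (measurable_of_finite _) (Set.toFinite A).measurableSet]
  rfl

lemma coinLaw_le_card_blocks (e : Fin N × ρ ≃ Fin L) (s : Set (ρ → Fin n → Bool))
    [DecidablePred (· ∈ s)] (hδ : 0 ≤ δ) :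
    (coinLaw n L p).real {ω | ((Measure.pi fun _ : ρ => coins (Fin n) p).real s + δ) * N ≤
        (Finset.univ.filter fun k => blocks e ω k ∈ s).card} ≤ Real.exp (-2 * δ ^ 2 * N) :=
  (coinLaw_real_preimage_blocks e _).trans_le
    (measureReal_pi_le_card _ (Set.toFinite s).measurableSet hδ)

lemma coinLaw_card_blocks_lt (e : Fin N × ρ ≃ Fin L) (s : Set (ρ → Fin n → Bool))
    [DecidablePred (· ∈ s)] (hδ : 0 ≤ δ) :
    (coinLaw n L p).real {ω | (Finset.univ.filter fun k => blocks e ω k ∈ s).card <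
        ((Measure.pi fun _ : ρ => coins (Fin n) p).real s - δ) * N} ≤ Real.exp (-2 * δ ^ 2 * N) :=
  (coinLaw_real_preimage_blocks e _).trans_le
    (measureReal_pi_card_lt _ (Set.toFinite s).measurableSet hδ)

end Blocks

/-! ### The number of taken IDs -/

/-- The slots selected by the coins of a device. -/
def selected {L : ℕ} (u : Fin L → Bool) : Finset (Fin L) :=
  Finset.univ.filter fun j => u j = true

lemma mem_tasks {L β : ℕ} {u : Fin L → Bool} {k : ℕ} :
    k ∈ tasks β u ↔ (selected u).card < β ∧ ∃ h : k < L, u ⟨k, h⟩ = true := by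
  have hcard : ((Finset.univ.filter fun j => u j = true).image Fin.val).card =
      (selected u).card := Finset.card_image_of_injective _ Fin.val_injective
  simp only [tasks, hcard]
  split_ifs with h
  · simp only [Finset.mem_image, Finset.mem_filter, Finset.mem_univ, true_and, h]
    exact ⟨fun ⟨j, hj, hjk⟩ => hjk ▸ ⟨j.2, hj⟩, fun ⟨hk, hj⟩ => ⟨_, hj, rfl⟩⟩
  · simp [h]

/-- Every device selects fewer than `β` slots, so that none is excluded. -/
def AllParticipate {n L : ℕ} (β : ℕ) (x : Fin n → Fin L → Bool) : Prop :=
  ∀ i, (selected (x i)).card < β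

/-- The coins of which only that of `k` shows `true`. -/
def solo {κ : Type} [DecidableEq κ] (k : κ) : κ → Bool := fun j => decide (j = k)

section Solo

variable {κ : Type} [DecidableEq κ] {p : ℝ}

lemma solo_injective : Function.Injective (solo (κ := κ)) := by
  intro i j h
  simpa [solo] using congrFun h i

lemma eq_solo_iff {u : κ → Bool} {i : κ} :
    u = solo i ↔ u i = true ∧ ∀ j, j ≠ i → u j ≠ true := by
  refine ⟨by rintro rfl; simp [solo], fun ⟨hi, hothers⟩ => funext fun j => ?_⟩
  rcases eq_or_ne j i with rfl | hj
  · simpa [solo] using hi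
  · simpa [solo, hj] using hothers j hj

variable [Fintype κ]

lemma coins_real_solo (hp : p ∈ Set.Icc 0 1) (k : κ) :
    (coins κ p).real {solo k} = p * (1 - p) ^ (Fintype.card κ - 1) := by
  rw [coins_real_singleton hp, ← Finset.mul_prod_erase _ _ (Finset.mem_univ k)]
  have hothers : ∀ j ∈ Finset.univ.erase k, (if solo k j then p else 1 - p) = 1 - p :=
    fun j hj => by simp [solo, Finset.ne_of_mem_erase hj]
  rw [Finset.prod_congr rfl hothers, Finset.prod_const,
    Finset.card_erase_of_mem (Finset.mem_univ k), Finset.card_univ]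
  simp [solo]

end Solo

lemma soleTask_iff {n L β : ℕ} {x : Fin n → Fin L → Bool} (hx : AllParticipate β x) {k : ℕ}
    (hk : k < L) {i : Fin n} : SoleTask β x k i ↔ (fun j => x j ⟨k, hk⟩) = solo i := by
  have hmem : ∀ j, k ∈ tasks β (x j) ↔ x j ⟨k, hk⟩ = true := fun j =>
    mem_tasks.trans ⟨fun h => h.2.2, fun h => ⟨hx j, hk, h⟩⟩
  simp only [eq_solo_iff, SoleTask, hmem]

/-- The event that in a single slot exactly one device transmits. -/
def DirectSuccess (n : ℕ) : Set (Unit → Fin n → Bool) := {v | ∃ i, v () = solo i}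

/-- The event that in each of two slots exactly one device transmits, not the same in both. -/
def PairedSuccess (n : ℕ) : Set (Fin 2 → Fin n → Bool) :=
  {v | ∃ i j, j ≠ i ∧ v 0 = solo i ∧ v 1 = solo j}

/-- The probability that a given ID is taken if all devices participate. -/
noncomputable def CDModel.successProb : CDModel → ℕ → ℝ → ℝ
  | .strongCD, n, p => n * (p * (1 - p) ^ (n - 1))
  | .senderCD, n, p => n * (p * (1 - p) ^ (n - 1))
  | .receiverCD, n, p => n * (n - 1) * (p * (1 - p) ^ (n - 1)) ^ 2
  | .noCD, n, p => n * (n - 1) * (p * (1 - p) ^ (n - 1)) ^ 2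

section Success

variable {n N β : ℕ} {p δ : ℝ}

lemma real_directSuccess (n : ℕ) (hp : p ∈ Set.Icc 0 1) :
    (Measure.pi fun _ : Unit => coins (Fin n) p).real (DirectSuccess n) =
      n * (p * (1 - p) ^ (n - 1)) := by
  have h : DirectSuccess n = (Finset.univ.image fun i (_ : Unit) => solo i :
      Finset (Unit → Fin n → Bool)) := by
    ext v
    simp [DirectSuccess, funext_iff, Unique.forall_iff, eq_comm]
  have hinj : Function.Injective fun (i : Fin n) (_ : Unit) => solo i := fun i j hij =>
    solo_injective (congrFun hij ())
  rw [h, ← sum_measureReal_singleton, Finset.sum_image hinj.injOn]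
  simp [pi_coins_real_singleton, coins_real_solo hp]

lemma real_pairedSuccess (n : ℕ) (hp : p ∈ Set.Icc 0 1) :
    (Measure.pi fun _ : Fin 2 => coins (Fin n) p).real (PairedSuccess n) =
      n * (n - 1) * (p * (1 - p) ^ (n - 1)) ^ 2 := by
  have h : PairedSuccess n =
      ((Finset.univ : Finset (Fin n)).offDiag.image fun x => ![solo x.1, solo x.2] :
        Finset _) := by
    ext v
    simp [PairedSuccess, funext_iff, Fin.forall_fin_two, eq_comm]
  have hinj : Set.InjOn (fun x : Fin n × Fin n => ![solo x.1, solo x.2])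
      (Finset.univ : Finset (Fin n)).offDiag := fun x _ y _ hxy =>
    Prod.ext (solo_injective (congrFun hxy 0)) (solo_injective (congrFun hxy 1))
  rw [h, ← sum_measureReal_singleton, Finset.sum_image hinj]
  simp only [pi_coins_real_singleton, Fin.prod_univ_two, Matrix.cons_val_zero,
    Matrix.cons_val_one, coins_real_solo hp, Finset.sum_const, Finset.offDiag_card,
    Finset.card_univ, Fintype.card_fin, nsmul_eq_mul]
  rw [Nat.cast_sub (Nat.le_mul_self n)]
  push_cast
  ring

/-- The two slots of an ID. -/
def pairSlots (N : ℕ) : Fin N × Fin 2 ≃ Fin (2 * N) :=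
  finProdFinEquiv.trans (finCongr (mul_comm N 2))

lemma val_pairSlots (k : Fin N) (d : Fin 2) : (pairSlots N (k, d) : ℕ) = 2 * k + d := by
  simp [pairSlots, finProdFinEquiv, add_comm]

lemma exists_soleTask_iff {ω : Fin n → Fin N → Bool} (hω : AllParticipate β ω) (k : Fin N) :
    (∃ i, SoleTask β ω k i) ↔ blocks (Equiv.prodUnique (Fin N) Unit) ω k ∈ DirectSuccess n :=
  exists_congr fun _ => soleTask_iff hω k.2

lemma exists_solePair_iff {ω : Fin n → Fin (2 * N) → Bool} (hω : AllParticipate β ω) (k : Fin N) :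
    (∃ i, SolePair β ω k i) ↔ blocks (pairSlots N) ω k ∈ PairedSuccess n := by
  have h0 : 2 * (k : ℕ) < 2 * N := by omega
  have h1 : 2 * (k : ℕ) + 1 < 2 * N := by omega
  have e0 : pairSlots N (k, 0) = ⟨2 * k, h0⟩ := Fin.ext (val_pairSlots k 0)
  have e1 : pairSlots N (k, 1) = ⟨2 * k + 1, h1⟩ := Fin.ext (val_pairSlots k 1)
  simp only [SolePair, soleTask_iff hω h0, soleTask_iff hω h1, ← e0, ← e1]
  refine exists_congr fun i => ⟨?_, ?_⟩
  · rintro ⟨hi, j, hj, hj'⟩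
    exact ⟨j, hj, hi, hj'⟩
  · rintro ⟨j, hj, hi, hj'⟩
    exact ⟨hi, j, hj, hj'⟩

open Classical in
lemma exists_blocks_takenIDs (c : CDModel) (n N β : ℕ) (hp : p ∈ Set.Icc 0 1) :
    ∃ (ρ : Type) (_ : Fintype ρ) (e : Fin N × ρ ≃ Fin (c.coinCount N))
      (s : Set (ρ → Fin n → Bool)),
      (Measure.pi fun _ : ρ => coins (Fin n) p).real s = c.successProb n p ∧
      ∀ ω, AllParticipate β ω →
        takenIDs c β ω = Finset.univ.filter fun k => blocks e ω k ∈ s := by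
  cases c
  case strongCD | senderCD =>
    refine ⟨Unit, inferInstance, Equiv.prodUnique (Fin N) Unit, _, real_directSuccess n hp,
      fun ω hω => ?_⟩
    ext k
    simpa only [Finset.mem_filter_univ] using mem_takenIDs.trans (exists_soleTask_iff hω k)
  case receiverCD | noCD =>
    refine ⟨Fin 2, inferInstance, pairSlots N, _, real_pairedSuccess n hp, fun ω hω => ?_⟩
    ext k
    simpa only [Finset.mem_filter_univ] using mem_takenIDs.trans (exists_solePair_iff hω k)

lemma coinLaw_le_card_takenIDs (c : CDModel) (N β : ℕ) (hp : p ∈ Set.Icc 0 1) (hδ : 0 ≤ δ)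
    (h : c.successProb n p + δ ≤ c.density) :
    (coinLaw n (c.coinCount N) p).real {ω | AllParticipate β ω ∧
      c.density * N ≤ (takenIDs c (N := N) β ω).card} ≤ Real.exp (-2 * δ ^ 2 * N) := by
  classical
  obtain ⟨ρ, _, e, s, hs, htaken⟩ := exists_blocks_takenIDs c n N β hp
  refine (measureReal_mono fun ω hω => ?_).trans (coinLaw_le_card_blocks e s hδ)
  rw [Set.mem_ofPred_eq, hs, ← htaken ω hω.1]
  exact (mul_le_mul_of_nonneg_right h N.cast_nonneg).trans hω.2

lemma coinLaw_card_takenIDs_lt (c : CDModel) (N β : ℕ) (hp : p ∈ Set.Icc 0 1) (hδ : 0 ≤ δ)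
    (h : c.density + δ ≤ c.successProb n p) :
    (coinLaw n (c.coinCount N) p).real {ω | AllParticipate β ω ∧
      (takenIDs c (N := N) β ω).card < c.density * N} ≤ Real.exp (-2 * δ ^ 2 * N) := by
  classical
  obtain ⟨ρ, _, e, s, hs, htaken⟩ := exists_blocks_takenIDs c n N β hp
  refine (measureReal_mono fun ω hω => ?_).trans (coinLaw_card_blocks_lt e s hδ)
  rw [Set.mem_ofPred_eq, hs, ← htaken ω hω.1]
  exact hω.2.trans_le (mul_le_mul_of_nonneg_right (le_sub_iff_add_le.2 h) N.cast_nonneg)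

end Success

section Rare

variable {L β : ℕ} {p : ℝ}

lemma coins_real_le_card_selected (L β : ℕ) (hp : p ∈ Set.Icc 0 1) :
    (coins (Fin L) p).real {u | β ≤ (selected u).card} ≤ (L * p) ^ β / β.factorial := by
  have hsub : {u : Fin L → Bool | β ≤ (selected u).card} ⊆
      ⋃ S ∈ Finset.powersetCard β Finset.univ, {u | ∀ j ∈ S, u j = true} := by
    intro u hu
    obtain ⟨S, hS, hcard⟩ := Finset.exists_subset_card_eq hu
    refine Set.mem_biUnion (Finset.mem_powersetCard_univ.2 hcard) fun j hj => ?_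
    exact (Finset.mem_filter.1 (hS hj)).2
  calc (coins (Fin L) p).real {u | β ≤ (selected u).card}
      ≤ ∑ S ∈ Finset.powersetCard β Finset.univ, (coins (Fin L) p).real {u | ∀ j ∈ S, u j = true} :=
        (measureReal_mono hsub (measure_ne_top _ _)).trans (measureReal_biUnion_finset_le _ _)
    _ = L.choose β * p ^ β := by
        rw [Finset.sum_congr rfl fun S hS => by
          rw [coins_real_forall_true hp, Finset.mem_powersetCard_univ.1 hS]]
        simp
    _ ≤ L ^ β / β.factorial * p ^ β :=
        mul_le_mul_of_nonneg_right (Nat.choose_le_pow_div β L) (pow_nonneg hp.1 β)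
    _ = (L * p) ^ β / β.factorial := by ring

lemma coinLaw_not_allParticipate (n L β : ℕ) (hp : p ∈ Set.Icc 0 1) :
    (coinLaw n L p).real {ω | ¬ AllParticipate β ω} ≤ n * ((L * p) ^ β / β.factorial) := by
  have hunion : {ω : Fin n → Fin L → Bool | ¬ AllParticipate β ω} =
      ⋃ i, {ω | ω i ∈ {u | β ≤ (selected u).card}} := by
    ext ω
    simp [AllParticipate]
  rw [hunion]
  refine (measureReal_iUnion_fintype_le _).trans ?_
  simp only [coinLaw_real_row, Finset.sum_const, Finset.card_univ, Fintype.card_fin, nsmul_eq_mul]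
  exact mul_le_mul_of_nonneg_left (coins_real_le_card_selected L β hp) n.cast_nonneg

lemma coins_real_notMem_tasks_le (hp : p ∈ Set.Icc 0 1) (hβ : 2 ≤ β) (k : Fin L) :
    (coins (Fin L) p).real {u | (k : ℕ) ∉ tasks β u} ≤ Real.exp (-(p * (1 - p) ^ (L - 1))) := by
  have hsolo : (k : ℕ) ∈ tasks β (solo k) := by
    have hselected : selected (solo k) = {k} := by
      ext j
      simp [selected, solo]
    exact mem_tasks.2 ⟨by rw [hselected, Finset.card_singleton]; omega, k.2, by simp [solo]⟩
  have hsub : {u | (k : ℕ) ∉ tasks β u} ⊆ {solo k}ᶜ := by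
    rintro u hu rfl
    exact hu hsolo
  calc (coins (Fin L) p).real {u | (k : ℕ) ∉ tasks β u}
      ≤ 1 - (coins (Fin L) p).real {solo k} :=
        (measureReal_mono hsub).trans_eq (probReal_compl_eq_one_sub (measurableSet_singleton _))
    _ = 1 - p * (1 - p) ^ (L - 1) := by rw [coins_real_solo hp, Fintype.card_fin]
    _ ≤ _ := Real.one_sub_le_exp_neg _

lemma coinLaw_soleTask {n : ℕ} (hp : p ∈ Set.Icc 0 1) (hβ : 2 ≤ β) (k : Fin L) (i : Fin n) :
    (coinLaw n L p).real {ω | SoleTask β ω k i} ≤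
      Real.exp (-(p * (1 - p) ^ (L - 1)) * (n - 1)) := by
  have hsub : {ω : Fin n → Fin L → Bool | SoleTask β ω k i} ⊆
      ((Finset.univ.erase i : Finset (Fin n)) : Set (Fin n)).pi
        fun _ => {u | (k : ℕ) ∉ tasks β u} :=
    fun ω hω j hj => hω.2 j (Finset.ne_of_mem_erase hj)
  refine (measureReal_mono hsub).trans ?_
  have hpi : (coinLaw n L p).real (((Finset.univ.erase i : Finset (Fin n)) : Set (Fin n)).pi
      fun _ => {u | (k : ℕ) ∉ tasks β u}) =
      (coins (Fin L) p).real {u | (k : ℕ) ∉ tasks β u} ^ (n - 1) := by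
    change (Measure.pi fun _ => coins (Fin L) p).real _ = _
    rw [measureReal_def, Measure.pi_pi_finset, ENNReal.toReal_prod]
    simp [measureReal_def]
  have hexp : Real.exp (-(p * (1 - p) ^ (L - 1)) * (n - 1)) =
      Real.exp (-(p * (1 - p) ^ (L - 1))) ^ (n - 1) := by
    rw [← Real.exp_nat_mul, Nat.cast_pred (Fin.pos i), mul_comm]
  rw [hpi, hexp]
  exact pow_le_pow_left₀ measureReal_nonneg (coins_real_notMem_tasks_le hp hβ k) _

lemma coinLaw_exists_soleTask (n L : ℕ) (hp : p ∈ Set.Icc 0 1) (hβ : 2 ≤ β) :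
    (coinLaw n L p).real {ω | ∃ k < L, ∃ i, SoleTask β ω k i} ≤
      L * n * Real.exp (-(p * (1 - p) ^ (L - 1)) * (n - 1)) := by
  have hunion : {ω : Fin n → Fin L → Bool | ∃ k < L, ∃ i, SoleTask β ω k i} ⊆
      ⋃ x : Fin L × Fin n, {ω | SoleTask β ω x.1 x.2} := by
    rintro ω ⟨k, hk, i, h⟩
    exact Set.mem_iUnion.2 ⟨(⟨k, hk⟩, i), h⟩
  refine (measureReal_mono hunion).trans ((measureReal_iUnion_fintype_le _).trans ?_)
  refine (Finset.sum_le_sum fun x _ => coinLaw_soleTask hp hβ x.1 x.2).trans_eq ?_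
  simp

end Rare

/-! ### The probability that an ID is taken -/

/-- The hypothesis says that `a` lies between `x` and the maximum of `x * exp (-x)` at `1`. -/
lemma mul_exp_neg_le {a x : ℝ} (ha : 0 ≤ a) (h : 0 ≤ (a - x) * (1 - a)) :
    x * Real.exp (-x) ≤ a * Real.exp (-a) := by
  have hx : x ≤ a * Real.exp (x - a) := by nlinarith [Real.add_one_le_exp (x - a)]
  calc x * Real.exp (-x) ≤ a * Real.exp (x - a) * Real.exp (-x) :=
        mul_le_mul_of_nonneg_right hx (Real.exp_pos _).le
    _ = a * Real.exp (-a) := by rw [mul_assoc, ← Real.exp_add]; ring_nf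

lemma mul_exp_neg_le_iff {a b x : ℝ} : a * Real.exp (-x) ≤ b ↔ a ≤ b * Real.exp x := by
  rw [Real.exp_neg, ← div_eq_mul_inv, div_le_iff₀ (Real.exp_pos _)]

lemma le_mul_exp_neg_iff {a b x : ℝ} : b ≤ a * Real.exp (-x) ↔ b * Real.exp x ≤ a := by
  rw [Real.exp_neg, ← div_eq_mul_inv, le_div_iff₀ (Real.exp_pos _)]

lemma mul_exp_neg_le_of_le {x : ℝ} (hx : x ≤ 10 / 19) : x * Real.exp (-x) ≤ 0.314 := by
  have hhalf : (1.648 : ℝ) ≤ Real.exp (1 / 2) := by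
    refine le_of_pow_le_pow_left₀ (n := 2) (by norm_num) (Real.exp_pos _).le ?_
    rw [← Real.exp_nat_mul, show ((2 : ℕ) : ℝ) * (1 / 2) = 1 by norm_num]
    linarith [Real.exp_one_gt_d9]
  have hexp : (1.648 * (1 + 1 / 38) : ℝ) ≤ Real.exp (10 / 19) := by
    rw [show (10 / 19 : ℝ) = 1 / 2 + 1 / 38 by norm_num, Real.exp_add]
    refine mul_le_mul hhalf ?_ (by norm_num) (Real.exp_pos _).le
    linarith [Real.add_one_le_exp (1 / 38 : ℝ)]
  refine (mul_exp_neg_le (a := 10 / 19) (by norm_num) (by nlinarith)).trans ?_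
  rw [mul_exp_neg_le_iff]
  linarith

lemma mul_exp_neg_le_of_ge {x : ℝ} (hx : 1.9 ≤ x) : x * Real.exp (-x) ≤ 0.314 := by
  have hexp : (7.38 * 0.9 : ℝ) ≤ Real.exp 1.9 := by
    rw [show (1.9 : ℝ) = 1 + 1 + -0.1 by norm_num, Real.exp_add, Real.exp_add]
    refine mul_le_mul (by nlinarith [Real.exp_one_gt_d9]) ?_ (by norm_num) (by positivity)
    linarith [Real.add_one_le_exp (-0.1 : ℝ)]
  refine (mul_exp_neg_le (a := 1.9) (by norm_num) (by nlinarith)).trans ?_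
  rw [mul_exp_neg_le_iff]
  linarith

lemma le_mul_exp_neg {x : ℝ} (h₁ : 2 / 3 ≤ x) (h₂ : x ≤ 3 / 2) : 0.334 ≤ x * Real.exp (-x) := by
  have he : Real.exp 1 * Real.exp 1 ≤ 7.3891 := by
    nlinarith [Real.exp_one_lt_d9, Real.exp_pos 1]
  rcases le_total x 1 with h | h
  · have hexp : Real.exp (2 / 3) ≤ 1.95 := by
      refine le_of_pow_le_pow_left₀ (n := 3) (by norm_num) (by norm_num) ?_
      rw [← Real.exp_nat_mul, show ((3 : ℕ) : ℝ) * (2 / 3) = 1 + 1 by norm_num, Real.exp_add]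
      linarith
    refine le_trans ?_ (mul_exp_neg_le (a := x) (x := 2 / 3) (by linarith) (by nlinarith))
    rw [le_mul_exp_neg_iff]
    linarith
  · have hexp : Real.exp (3 / 2) ≤ 4.485 := by
      refine le_of_pow_le_pow_left₀ (n := 2) (by norm_num) (by norm_num) ?_
      rw [← Real.exp_nat_mul, show ((2 : ℕ) : ℝ) * (3 / 2) = 1 + 1 + 1 by norm_num,
        Real.exp_add, Real.exp_add]
      nlinarith [Real.exp_one_lt_d9, Real.exp_pos 1]
    refine le_trans ?_ (mul_exp_neg_le (a := x) (x := 3 / 2) (by linarith) (by nlinarith))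
    rw [le_mul_exp_neg_iff]
    linarith

section OneSubPow

variable {n : ℕ} {p : ℝ}

lemma one_sub_pow_le (hn : 1 ≤ n) (hp : p ≤ 1) :
    (1 - p) ^ (n - 1) ≤ Real.exp (-(n * p)) * Real.exp p := by
  refine (pow_le_pow_left₀ (sub_nonneg.2 hp) (Real.one_sub_le_exp_neg p) (n - 1)).trans_eq ?_
  rw [← Real.exp_nat_mul, ← Real.exp_add, Nat.cast_pred hn]
  congr 1
  ring

lemma exp_neg_div_one_sub_le (hp : p < 1) : Real.exp (-(p / (1 - p))) ≤ 1 - p := by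
  have hp' : (0 : ℝ) < 1 - p := sub_pos.2 hp
  rw [Real.exp_neg]
  refine inv_le_of_inv_le₀ hp' (Eq.trans_le ?_ (Real.add_one_le_exp (p / (1 - p))))
  field_simp
  ring

lemma le_one_sub_pow (hn : 1 ≤ n) (hp : p < 1) :
    Real.exp (-((n - 1) * (p / (1 - p)))) ≤ (1 - p) ^ (n - 1) := by
  refine Eq.trans_le ?_ (pow_le_pow_left₀ (Real.exp_pos _).le (exp_neg_div_one_sub_le hp) (n - 1))
  rw [← Real.exp_nat_mul, Nat.cast_pred hn, mul_neg]

lemma soloProb_le (hn : 1 ≤ n) (hp₀ : 0 ≤ p) (hp₁ : p ≤ 0.01) (h : n * p ≤ 10 / 19 ∨ 1.9 ≤ n * p) :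
    n * (p * (1 - p) ^ (n - 1)) ≤ 0.32 := by
  have hfar : n * p * Real.exp (-(n * p)) ≤ 0.314 :=
    h.elim mul_exp_neg_le_of_le mul_exp_neg_le_of_ge
  have hexp : Real.exp p ≤ 1.011 := by
    have hinv : Real.exp p * Real.exp (-p) = 1 := by
      rw [← Real.exp_add, add_neg_cancel, Real.exp_zero]
    nlinarith [Real.one_sub_le_exp_neg p, Real.exp_pos p]
  calc n * (p * (1 - p) ^ (n - 1)) = n * p * (1 - p) ^ (n - 1) := by ring
    _ ≤ n * p * (Real.exp (-(n * p)) * Real.exp p) :=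
        mul_le_mul_of_nonneg_left (one_sub_pow_le hn (by linarith)) (by positivity)
    _ = n * p * Real.exp (-(n * p)) * Real.exp p := by ring
    _ ≤ 0.314 * 1.011 := mul_le_mul hfar hexp (Real.exp_pos p).le (by norm_num)
    _ ≤ 0.32 := by norm_num

lemma le_soloProb (hn : 1 ≤ n) (hp₀ : 0 ≤ p) (hp₁ : p ≤ 0.01) (h₁ : 2 / 3 ≤ n * p)
    (h₂ : n * p ≤ 3 / 2) : 0.329 ≤ n * (p * (1 - p) ^ (n - 1)) := by
  have hpow : Real.exp (-(n * p)) * Real.exp (-0.0051) ≤ (1 - p) ^ (n - 1) := by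
    refine le_trans ?_ (le_one_sub_pow hn (by linarith))
    have hexponent : ((n : ℝ) - 1) * (p / (1 - p)) ≤ n * p + 0.0051 := by
      rw [← mul_div_assoc, div_le_iff₀ (by linarith)]
      nlinarith
    rw [← Real.exp_add, Real.exp_le_exp]
    linarith
  have hexp : (0.9949 : ℝ) ≤ Real.exp (-0.0051) := by
    linarith [Real.add_one_le_exp (-0.0051 : ℝ)]
  calc (0.329 : ℝ) ≤ 0.334 * 0.9949 := by norm_num
    _ ≤ n * p * Real.exp (-(n * p)) * Real.exp (-0.0051) :=
        mul_le_mul (le_mul_exp_neg h₁ h₂) hexp (by norm_num) (by positivity)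
    _ = n * p * (Real.exp (-(n * p)) * Real.exp (-0.0051)) := by ring
    _ ≤ n * p * (1 - p) ^ (n - 1) := mul_le_mul_of_nonneg_left hpow (by positivity)
    _ = n * (p * (1 - p) ^ (n - 1)) := by ring

end OneSubPow

section Estimate

variable {n : ℕ} {est : ℝ}

lemma CDModel.successProb_le (c : CDModel) (hn : 1 ≤ n) (hest : 100 ≤ est)
    (h : 1.9 * n ≤ est ∨ est ≤ n / 1.9) : c.successProb n (1 / est) + 0.0005 ≤ c.density := by
  have hest₀ : 0 < est := by linarith
  have hp₀ : 0 ≤ 1 / est := by positivity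
  have hp₁ : 1 / est ≤ 0.01 := by rw [div_le_iff₀ hest₀]; linarith
  have hratio : n * (1 / est) ≤ 10 / 19 ∨ 1.9 ≤ n * (1 / est) := by
    rw [mul_one_div, div_le_iff₀ hest₀, le_div_iff₀ hest₀]
    rw [le_div_iff₀ (by norm_num)] at h
    exact h.imp (fun h => by linarith) fun h => by linarith
  have hsolo := soloProb_le hn hp₀ hp₁ hratio
  have hw₀ : 0 ≤ 1 / est * (1 - 1 / est) ^ (n - 1) :=
    mul_nonneg hp₀ (pow_nonneg (by linarith) _)
  have hpair : (n : ℝ) * (n - 1) * (1 / est * (1 - 1 / est) ^ (n - 1)) ^ 2 + 0.0005 ≤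
      0.325 ^ 2 := by
    set w := 1 / est * (1 - 1 / est) ^ (n - 1)
    have hnw : 0 ≤ n * w := by positivity
    nlinarith [mul_nonneg hnw hw₀]
  cases c
  case strongCD | senderCD =>
    exact (add_le_add_left hsolo _).trans (by norm_num [CDModel.density])
  case receiverCD | noCD => exact hpair

lemma CDModel.le_successProb (c : CDModel) (hest : 100 ≤ est) (h₁ : n / 1.5 ≤ est)
    (h₂ : est ≤ 1.5 * n) : c.density + 0.0005 ≤ c.successProb n (1 / est) := by
  have hest₀ : 0 < est := by linarith
  have hn : (66 : ℝ) ≤ n := by linarith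
  have hp₁ : 1 / est ≤ 0.01 := by rw [div_le_iff₀ hest₀]; linarith
  have hratio₁ : 2 / 3 ≤ n * (1 / est) := by
    rw [mul_one_div, le_div_iff₀ hest₀]
    linarith
  have hratio₂ : n * (1 / est) ≤ 3 / 2 := by
    rw [mul_one_div, div_le_iff₀ hest₀]
    linarith [(div_le_iff₀ (by norm_num)).1 h₁]
  have hsolo := le_soloProb (by exact_mod_cast (by linarith : (1 : ℝ) ≤ n)) (by positivity) hp₁
    hratio₁ hratio₂
  have hpair : 0.325 ^ 2 + 0.0005 ≤
      (n : ℝ) * (n - 1) * (1 / est * (1 - 1 / est) ^ (n - 1)) ^ 2 := by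
    set w := 1 / est * (1 - 1 / est) ^ (n - 1)
    have hinv : (1 : ℝ) / n ≤ 1 / 66 := one_div_le_one_div_of_le (by norm_num) hn
    have hsq : (0.329 : ℝ) ^ 2 ≤ (n * w) ^ 2 := pow_le_pow_left₀ (by norm_num) hsolo 2
    calc (0.325 : ℝ) ^ 2 + 0.0005 ≤ 0.329 ^ 2 * (1 - 1 / 66) := by norm_num
      _ ≤ (n * w) ^ 2 * (1 - 1 / n) :=
          mul_le_mul hsq (by linarith) (by norm_num) (sq_nonneg _)
      _ = (n : ℝ) * (n - 1) * w ^ 2 := by field_simp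
  cases c
  case strongCD | senderCD => exact le_trans (by norm_num [CDModel.density]) hsolo
  case receiverCD | noCD => exact hpair

end Estimate

/-! ### The failure probability -/

lemma log_le_two_mul_sqrt {x : ℝ} (hx : 0 < x) : Real.log x ≤ 2 * √x := by
  have hlog := Real.log_le_sub_one_of_pos (Real.sqrt_pos.2 hx)
  rw [Real.log_sqrt hx.le] at hlog
  linarith

lemma exists_mul_pow_le_exp_mul (a : ℝ) {b : ℝ} (hb : 0 < b) (k : ℕ) :
    ∃ M : ℝ, ∀ z, M ≤ z → a * z ^ k ≤ Real.exp (b * z) := by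
  have hlittle := (isLittleO_pow_exp_pos_mul_atTop k hb).const_mul_left a
  obtain ⟨M, hM⟩ := Filter.eventually_atTop.1 (hlittle.bound one_pos)
  refine ⟨M, fun z hz => (le_abs_self _).trans ?_⟩
  simpa only [Real.norm_eq_abs, Real.abs_exp, one_mul] using hM z hz

section FewDevices

variable {n L h : ℕ} {A K est : ℝ}

lemma mul_inv_pow_div_factorial_le (hest : 0 < est) (hL : L ≤ A * √est) (b : ℕ) :
    (L * (1 / est)) ^ (2 * b) / (2 * b).factorial ≤ Real.exp A / est ^ b := by
  have hA : 0 ≤ A := nonneg_of_mul_nonneg_left ((Nat.cast_nonneg L).trans hL) (Real.sqrt_pos.2 hest)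
  have hLA : L * (1 / est) ≤ A / √est := by
    rw [mul_one_div, div_le_div_iff₀ hest (Real.sqrt_pos.2 hest)]
    calc L * √est ≤ A * √est * √est := mul_le_mul_of_nonneg_right hL (Real.sqrt_nonneg _)
      _ = A * est := by rw [mul_assoc, Real.mul_self_sqrt hest.le]
  calc (L * (1 / est)) ^ (2 * b) / (2 * b).factorial
      ≤ (A / √est) ^ (2 * b) / (2 * b).factorial := by gcongr
    _ = A ^ (2 * b) / (2 * b).factorial / est ^ b := by
        rw [div_pow, pow_mul √est, Real.sq_sqrt hest.le, div_right_comm]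
    _ ≤ Real.exp A / est ^ b := by
        gcongr
        exact Real.pow_div_factorial_le_exp A hA (2 * b)

lemma exists_not_allParticipate_bound (hK : 0 < K) (h : ℕ) :
    ∃ b : ℕ, 1 ≤ b ∧ ∀ (n L : ℕ) (est : ℝ), 100 ≤ est → n ≤ est ^ h →
      L ≤ 2 * (K * Real.log est + 1) →
      n * ((L * (1 / est)) ^ (2 * b) / (2 * b).factorial) ≤ est⁻¹ / 2 := by
  obtain ⟨m, hm⟩ := pow_unbounded_of_one_lt (2 * Real.exp (4 * K + 2)) (by norm_num : (1 : ℝ) < 100)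
  refine ⟨h + 1 + m, by omega, fun n L est hest hn hL => ?_⟩
  have hest₀ : 0 < est := by linarith
  have hLA : L ≤ (4 * K + 2) * √est := by
    nlinarith [log_le_two_mul_sqrt hest₀, Real.one_le_sqrt.2 (by linarith : 1 ≤ est)]
  have hm' : 2 * Real.exp (4 * K + 2) ≤ est ^ m :=
    hm.le.trans (pow_le_pow_left₀ (by norm_num) hest m)
  calc n * ((L * (1 / est)) ^ (2 * (h + 1 + m)) / (2 * (h + 1 + m)).factorial)
      ≤ est ^ h * (Real.exp (4 * K + 2) / est ^ (h + 1 + m)) :=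
        mul_le_mul hn (mul_inv_pow_div_factorial_le hest₀ hLA _) (by positivity) (by positivity)
    _ ≤ est ^ h * (est ^ m / 2 / est ^ (h + 1 + m)) := by
        gcongr
        linarith
    _ = est⁻¹ / 2 := by
        rw [pow_add, pow_add, pow_one]
        field_simp

lemma exp_neg_le_inv_div_two {x y : ℝ} (hx : 2 ≤ x) (hy : 2 * Real.log x ≤ y) :
    Real.exp (-y) ≤ x⁻¹ / 2 := by
  have hx₀ : 0 < x := by linarith
  calc Real.exp (-y) ≤ Real.exp (-Real.log x + -Real.log x) := Real.exp_le_exp.2 (by linarith)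
    _ = x⁻¹ * x⁻¹ := by rw [Real.exp_add, Real.exp_neg, Real.exp_log hx₀]
    _ ≤ x⁻¹ * 2⁻¹ := by gcongr
    _ = x⁻¹ / 2 := (div_eq_mul_inv _ _).symm

lemma inv_le_rpow_neg {x ε : ℝ} (hx : 1 ≤ x) (hε : ε ≤ 1) : x⁻¹ ≤ x ^ (-ε) := by
  rw [← Real.rpow_neg_one]
  exact Real.rpow_le_rpow_of_exponent_le hx (neg_le_neg hε)

lemma inv_le_min_rpow_of_le_pow (hn : 1 ≤ n) (hest : 1 ≤ est) (hh : h ≠ 0) (h₁ : n ≤ est ^ h) :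
    est⁻¹ ≤ min ((n : ℝ) ^ (-(1 / h : ℝ))) (est ^ (-(1 / h : ℝ))) := by
  have hh' : (1 : ℝ) ≤ h := by exact_mod_cast Nat.one_le_iff_ne_zero.2 hh
  refine le_min ?_ (inv_le_rpow_neg hest ((div_le_one (by linarith)).2 hh'))
  calc est⁻¹ = (est ^ h) ^ (-(1 / h : ℝ)) := by
        rw [Real.rpow_neg (by positivity), one_div, Real.pow_rpow_inv_natCast (by linarith) hh]
    _ ≤ (n : ℝ) ^ (-(1 / h : ℝ)) :=
        Real.rpow_le_rpow_of_nonpos (by exact_mod_cast hn) h₁ (neg_nonpos.2 (by positivity))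

end FewDevices

section ManyDevices

variable {n L : ℕ} {p K est : ℝ}

lemma exp_neg_le_one_sub_pow (hp₀ : 0 ≤ p) (hp : p ≤ 1 / 2) (L : ℕ) :
    Real.exp (-(2 * (L * p))) ≤ (1 - p) ^ (L - 1) := by
  have hdiv : p / (1 - p) ≤ 2 * p := by
    rw [div_le_iff₀ (by linarith)]
    nlinarith
  calc Real.exp (-(2 * (L * p))) = Real.exp (-(2 * p)) ^ L := by
        rw [← Real.exp_nat_mul]
        ring_nf
    _ ≤ (1 - p) ^ L := by
        refine pow_le_pow_left₀ (Real.exp_pos _).le ?_ L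
        exact (Real.exp_le_exp.2 (neg_le_neg hdiv)).trans (exp_neg_div_one_sub_le (by linarith))
    _ ≤ (1 - p) ^ (L - 1) := pow_le_pow_of_le_one (by linarith) (by linarith) (Nat.sub_le _ _)

lemma soleTask_exponent_ge (hest : 2 ≤ est) (hn : est ≤ √n) (hL : L ≤ (2 * K + 1) * est) :
    Real.exp (-(4 * K + 2)) / 2 * √n ≤ 1 / est * (1 - 1 / est) ^ (L - 1) * (n - 1) := by
  have hest₀ : 0 < est := by linarith
  have hsq : √(n : ℝ) ^ 2 = n := Real.sq_sqrt (Nat.cast_nonneg n)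
  have hp : 1 / est ≤ 1 / 2 := one_div_le_one_div_of_le two_pos hest
  have hpow : Real.exp (-(4 * K + 2)) ≤ (1 - 1 / est) ^ (L - 1) := by
    refine le_trans ?_ (exp_neg_le_one_sub_pow (by positivity) hp L)
    have hLp : L * (1 / est) ≤ 2 * K + 1 := by rwa [mul_one_div, div_le_iff₀ hest₀]
    rw [Real.exp_le_exp]
    linarith
  have hz : √n ≤ 1 / est * n := by
    rw [one_div_mul_eq_div, le_div_iff₀ hest₀]
    nlinarith
  calc Real.exp (-(4 * K + 2)) / 2 * √n ≤ Real.exp (-(4 * K + 2)) / 2 * (1 / est * n) := by gcongr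
    _ = 1 / est * Real.exp (-(4 * K + 2)) * (n / 2) := by ring
    _ ≤ 1 / est * (1 - 1 / est) ^ (L - 1) * (n - 1) :=
        mul_le_mul (mul_le_mul_of_nonneg_left hpow (by positivity)) (by nlinarith) (by positivity)
          (mul_nonneg (by positivity) (pow_nonneg (by linarith) _))

lemma exists_soleTask_bound (hK : 0 < K) :
    ∃ h : ℕ, 2 ≤ h ∧ ∀ (n L : ℕ) (est : ℝ), 100 ≤ est → est ^ h < n →
      L ≤ 2 * (K * Real.log est + 1) →
      L * n * Real.exp (-(1 / est * (1 - 1 / est) ^ (L - 1)) * (n - 1)) ≤ (n : ℝ)⁻¹ := by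
  set κ := Real.exp (-(4 * K + 2)) / 2
  obtain ⟨M, hM⟩ := exists_mul_pow_le_exp_mul (2 * K + 1) (b := κ) (by positivity) 5
  obtain ⟨m, hm⟩ := pow_unbounded_of_one_lt M (by norm_num : (1 : ℝ) < 100)
  refine ⟨2 * (m + 1), by omega, fun n L est hest hn hL => ?_⟩
  set z := √(n : ℝ)
  have hest₀ : 0 < est := by linarith
  have hsq : z ^ 2 = n := Real.sq_sqrt (Nat.cast_nonneg n)
  have hz : est ^ (m + 1) ≤ z := Real.le_sqrt_of_sq_le (by rw [← pow_mul, mul_comm]; exact hn.le)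
  have hestz : est ≤ z := (le_self_pow₀ (by linarith) m.succ_ne_zero).trans hz
  have hMz : M ≤ z := hm.le.trans <| (pow_le_pow_left₀ (by norm_num) hest m).trans <|
    (pow_le_pow_right₀ (by linarith) m.le_succ).trans hz
  have hLest : L ≤ (2 * K + 1) * est := by
    nlinarith [Real.log_le_sub_one_of_pos hest₀]
  have hexponent := soleTask_exponent_ge (by linarith) hestz hLest
  have hz₀ : 0 < z := hest₀.trans_le hestz
  calc L * n * Real.exp (-(1 / est * (1 - 1 / est) ^ (L - 1)) * (n - 1))
      ≤ (2 * K + 1) * z * z ^ 2 * Real.exp (-(κ * z)) := by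
        rw [hsq]
        gcongr
        · exact hLest.trans (by gcongr)
        · rw [neg_mul]
          exact neg_le_neg hexponent
    _ = (2 * K + 1) * z ^ 5 / Real.exp (κ * z) * (z ^ 2)⁻¹ := by
        rw [Real.exp_neg]
        field_simp
    _ ≤ 1 * (z ^ 2)⁻¹ := by
        gcongr
        exact (div_le_one (Real.exp_pos _)).2 (hM z hMz)
    _ = (n : ℝ)⁻¹ := by rw [one_mul, hsq]

lemma exists_soleTask_of_assigned {ι : Type} {c : CDModel} {N β : ℕ}
    {x : ι → Fin (c.coinCount N) → Bool} {k : Fin N} {i : ι} (h : Assigned c β x k i) :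
    ∃ k < c.coinCount N, ∃ i, SoleTask β x k i := by
  cases c
  case strongCD | senderCD => exact ⟨k, k.2, i, h⟩
  case receiverCD | noCD => exact ⟨2 * k, Nat.mul_lt_mul_of_pos_left k.2 two_pos, i, h.1⟩

lemma inv_le_min_rpow_of_le {ε : ℝ} (hest : 0 < est) (hn : 1 ≤ n) (hestn : est ≤ n) (hε₀ : 0 ≤ ε)
    (hε : ε ≤ 1) : (n : ℝ)⁻¹ ≤ min ((n : ℝ) ^ (-ε)) (est ^ (-ε)) := by
  have hinv := inv_le_rpow_neg (by exact_mod_cast hn : (1 : ℝ) ≤ n) hε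
  exact le_min hinv (hinv.trans (Real.rpow_le_rpow_of_nonpos hest hestn (neg_nonpos.2 hε₀)))

end ManyDevices

section RevealsSize

variable {c : CDModel} {n N β : ℕ} {est : ℝ}

/-- The event that the number of taken IDs tells a good estimate `est` of the number `n` of devices
from one that is far off. -/
def RevealsSize (c : CDModel) (N β : ℕ) (est : ℝ) (ω : Fin n → Fin (c.coinCount N) → Bool) : Prop :=
  (n / 1.5 ≤ est ∧ est ≤ 1.5 * n → c.density * N ≤ (takenIDs c (N := N) β ω).card) ∧
    (1.9 * n ≤ est ∨ est ≤ n / 1.9 → (takenIDs c (N := N) β ω).card < c.density * N)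

lemma coinLaw_le_add_allParticipate {L : ℕ} {p : ℝ} (hp : p ∈ Set.Icc 0 1) (β : ℕ)
    (s : Set (Fin n → Fin L → Bool)) :
    (coinLaw n L p).real s ≤ n * ((L * p) ^ β / β.factorial) +
      (coinLaw n L p).real {ω | AllParticipate β ω ∧ ω ∈ s} := by
  calc (coinLaw n L p).real s
      ≤ (coinLaw n L p).real ({ω | ¬ AllParticipate β ω} ∪ {ω | AllParticipate β ω ∧ ω ∈ s}) :=
        measureReal_mono fun ω hω => or_iff_not_imp_left.2 fun h => ⟨not_not.1 h, hω⟩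
    _ ≤ _ := (measureReal_union_le _ _).trans
        (add_le_add_left (coinLaw_not_allParticipate n L β hp) _)

lemma coinLaw_allParticipate_not_revealsSize (c : CDModel) (N β : ℕ) (hn : 1 ≤ n)
    (hest : 100 ≤ est) :
    (coinLaw n (c.coinCount N) (1 / est)).real
      {ω | AllParticipate β ω ∧ ¬ RevealsSize c N β est ω} ≤ Real.exp (-2 * 0.0005 ^ 2 * N) := by
  have hp : 1 / est ∈ Set.Icc 0 1 := ⟨by positivity, (div_le_one (by linarith)).2 (by linarith)⟩
  by_cases hnear : n / 1.5 ≤ est ∧ est ≤ 1.5 * n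
  · refine (measureReal_mono fun ω hω => And.intro hω.1 ?_).trans
      (coinLaw_card_takenIDs_lt c N β hp (by norm_num) (c.le_successProb hest hnear.1 hnear.2))
    have hnot_far : ¬ (1.9 * n ≤ est ∨ est ≤ n / 1.9) := by
      rw [div_le_iff₀ (by norm_num)] at hnear
      rw [le_div_iff₀ (by norm_num)]
      rintro (h | h) <;> linarith
    by_contra hcard
    exact hω.2 ⟨fun _ => not_lt.1 hcard, fun h => absurd h hnot_far⟩
  by_cases hfar : 1.9 * n ≤ est ∨ est ≤ n / 1.9
  · refine (measureReal_mono fun ω hω => And.intro hω.1 ?_).trans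
      (coinLaw_le_card_takenIDs c N β hp (by norm_num) (c.successProb_le hn hest hfar))
    by_contra hcard
    exact hω.2 ⟨fun h => absurd h hnear, fun _ => not_le.1 hcard⟩
  · have hempty : {ω : Fin n → Fin (c.coinCount N) → Bool |
        AllParticipate β ω ∧ ¬ RevealsSize c N β est ω} = ∅ :=
      Set.eq_empty_of_forall_notMem fun ω hω =>
        hω.2 ⟨fun h => absurd h hnear, fun h => absurd h hfar⟩
    rw [hempty, measureReal_empty]
    exact (Real.exp_pos _).le

lemma revealsSize_of_not_exists_soleTask (hestn : 1.5 * est < n) (hN : 0 < N)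
    {ω : Fin n → Fin (c.coinCount N) → Bool}
    (hω : ¬ ∃ k < c.coinCount N, ∃ i, SoleTask β ω k i) : RevealsSize c N β est ω := by
  refine ⟨fun hnear => ?_, fun _ => ?_⟩
  · have := (div_le_iff₀ (by norm_num)).1 hnear.1
    linarith
  · have hempty : takenIDs c (N := N) β ω = ∅ := Finset.eq_empty_of_forall_notMem fun k hk =>
      hω (exists_soleTask_of_assigned (mem_takenIDs.1 hk).choose_spec)
    rw [hempty, Finset.card_empty, Nat.cast_zero]
    exact mul_pos (by linarith [c.density_ge]) (by exact_mod_cast hN)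

lemma coinCount_ceil_le (c : CDModel) {K : ℝ} (hK : 0 ≤ K) (hest : 1 ≤ est) :
    (c.coinCount ⌈K * Real.log est⌉₊ : ℝ) ≤ 2 * (K * Real.log est + 1) := by
  have hcount : c.coinCount ⌈K * Real.log est⌉₊ ≤ 2 * ⌈K * Real.log est⌉₊ := by
    cases c <;> simp only [CDModel.coinCount] <;> omega
  have hceil := Nat.ceil_lt_add_one (mul_nonneg hK (Real.log_nonneg hest))
  have hcount' : (c.coinCount ⌈K * Real.log est⌉₊ : ℝ) ≤ 2 * ⌈K * Real.log est⌉₊ := by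
    exact_mod_cast hcount
  linarith

lemma exists_coinLaw_not_revealsSize_le (c : CDModel) :
    ∃ (K : ℝ) (β : ℕ) (ε : ℝ), 0 < K ∧ 0 < ε ∧ ∀ (n : ℕ) (est : ℝ), 1 ≤ n → 100 ≤ est →
      (coinLaw n (c.coinCount ⌈K * Real.log est⌉₊) (1 / est)).real
        {ω | ¬ RevealsSize c ⌈K * Real.log est⌉₊ β est ω} ≤
          min ((n : ℝ) ^ (-ε)) (est ^ (-ε)) := by
  -- With this `K` the exponent of the Chernoff bound is at most `-2 * log est`.
  set K : ℝ := 1 / 0.0005 ^ 2 with hK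
  have hK₀ : 0 < K := by positivity
  obtain ⟨h, hh, hmany⟩ := exists_soleTask_bound hK₀
  obtain ⟨b, hb, hfew⟩ := exists_not_allParticipate_bound hK₀ h
  have hh' : (1 : ℝ) ≤ h := by exact_mod_cast one_le_two.trans hh
  refine ⟨K, 2 * b, 1 / h, hK₀, by positivity, fun n est hn hest => ?_⟩
  set N := ⌈K * Real.log est⌉₊
  have hp : 1 / est ∈ Set.Icc 0 1 := ⟨by positivity, (div_le_one (by linarith)).2 (by linarith)⟩
  have hlog : 0 < Real.log est := Real.log_pos (by linarith)
  have hL := coinCount_ceil_le c hK₀.le (by linarith : 1 ≤ est)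
  rcases le_or_gt (n : ℝ) (est ^ h) with hcase | hcase
  · have hchernoff : Real.exp (-2 * 0.0005 ^ 2 * N) ≤ est⁻¹ / 2 := by
      have hN : K * Real.log est ≤ N := Nat.le_ceil _
      rw [neg_mul, neg_mul]
      refine exp_neg_le_inv_div_two (by linarith) ?_
      rw [hK, one_div_mul_eq_div, div_le_iff₀ (by norm_num)] at hN
      linarith
    refine le_trans ?_ (inv_le_min_rpow_of_le_pow hn (by linarith) (by omega) hcase)
    refine (coinLaw_le_add_allParticipate hp (2 * b) _).trans (le_trans ?_ (add_halves est⁻¹).le)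
    exact add_le_add (hfew n _ est hest hcase hL)
      ((coinLaw_allParticipate_not_revealsSize c N (2 * b) hn hest).trans hchernoff)
  · have hsquare : est ^ 2 < n := (pow_le_pow_right₀ (by linarith) hh).trans_lt hcase
    have hN : 0 < N := Nat.ceil_pos.2 (by positivity)
    calc (coinLaw n (c.coinCount N) (1 / est)).real {ω | ¬ RevealsSize c N (2 * b) est ω}
        ≤ (coinLaw n (c.coinCount N) (1 / est)).real
            {ω | ∃ k < c.coinCount N, ∃ i, SoleTask (2 * b) ω k i} :=
          measureReal_mono fun ω => not_imp_comm.1 <|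
            revealsSize_of_not_exists_soleTask (by nlinarith) hN
      _ ≤ (n : ℝ)⁻¹ :=
          (coinLaw_exists_soleTask n _ hp (by omega)).trans (hmany n _ est hest hcase hL)
      _ ≤ _ := inv_le_min_rpow_of_le (by linarith) hn (by nlinarith) (by positivity)
          ((div_le_one (by linarith)).2 hh')

end RevealsSize

section Cost

variable {K est : ℝ}

lemma one_le_log (hest : 100 ≤ est) : 1 ≤ Real.log est := by
  rw [Real.le_log_iff_exp_le (by linarith)]
  linarith [Real.exp_one_lt_d9]

lemma testTime_ceil_le (c : CDModel) (hK : 0 < K) (hest : 100 ≤ est) :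
    (c.testTime ⌈K * Real.log est⌉₊ : ℝ) ≤ 16 * (K + 1) * Real.log est := by
  have hlog := one_le_log hest
  have hceil := Nat.ceil_lt_add_one (by positivity : 0 ≤ K * Real.log est)
  have htime : (c.testTime ⌈K * Real.log est⌉₊ : ℝ) ≤ 16 * ⌈K * Real.log est⌉₊ := by
    exact_mod_cast c.testTime_le (Nat.ceil_pos.2 (by positivity))
  linarith

lemma invAck_ceil_log_le (hK : 0 < K) (hest : 100 ≤ est) :
    invAck ⌈K * Real.log est⌉₊ ≤ invAck (4 * (K + 1) ^ 2) * invAck est := by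
  have hest₀ : 0 < est := by linarith
  have hlog := log_le_two_mul_sqrt hest₀
  have hsqrt : 1 ≤ √est := Real.one_le_sqrt.2 (by linarith)
  have hsq := Real.sq_sqrt hest₀.le
  have hceil : (⌈K * Real.log est⌉₊ : ℝ) ≤ 2 * (K + 1) * √est := by
    refine (Nat.ceil_lt_add_one ?_).le.trans (by nlinarith)
    exact mul_nonneg hK.le (Real.log_nonneg (by linarith))
  rcases le_total (2 * (K + 1)) √est with h | h
  · exact (invAck_mono (hceil.trans (by nlinarith))).trans
      (Nat.le_mul_of_pos_left _ (invAck_spec _).1)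
  · exact (invAck_mono (hceil.trans (by nlinarith))).trans
      (Nat.le_mul_of_pos_right _ (invAck_spec _).1)

lemma energy_ceil_log_le (β : ℕ) (hK : 0 < K) (hest : 100 ≤ est) :
    8 * β + β * (3 * invAck ⌈K * Real.log est⌉₊ + 251) ≤
      β * (3 * invAck (4 * (K + 1) ^ 2) + 259) * invAck est := by
  have hone : 1 ≤ invAck est := (invAck_spec est).1
  calc 8 * β + β * (3 * invAck ⌈K * Real.log est⌉₊ + 251)
      = β * (3 * invAck ⌈K * Real.log est⌉₊ + 259 * 1) := by ring
    _ ≤ β * (3 * (invAck (4 * (K + 1) ^ 2) * invAck est) + 259 * invAck est) := by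
        gcongr
        exact invAck_ceil_log_le hK hest
    _ = β * (3 * invAck (4 * (K + 1) ^ 2) + 259) * invAck est := by ring

end Cost

end RadioNetwork

open RadioNetwork in
theorem mainTheorem9 (model : CDModel) :
    ∃ (M : Type) (D : CensusFamily M), IsDenseCensus model.density D ∧
    ∃ (K : ℝ) (β : ℕ) (C ε : ℝ), 0 < K ∧ 0 < C ∧ 0 < ε ∧
    ∀ (n : ℕ) (est : ℝ), 1 ≤ n → 100 ≤ est →
      let N : ℕ := ⌈K * Real.log est⌉₊
      let P := testNetworkSize model N β D
      1 - min ((n : ℝ) ^ (-ε)) (est ^ (-ε)) ≤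
        (coinLaw n (model.coinCount N) (1 / est)).real
          {ω | ∃ T : ℕ, (T : ℝ) ≤ C * Real.log est ∧
            (∀ i, ∃ r, P.OutputAt model ω T i r) ∧
            (∀ i, (P.energy model ω T i : ℝ) ≤ C * invAck est) ∧
            (n / 1.5 ≤ est ∧ est ≤ 1.5 * n → LeaderElected P model ω T) ∧
            (1.9 * n ≤ est ∨ est ≤ n / 1.9 → NoLeaderElected P model ω T)} := by
  obtain ⟨K, β, ε, hK, hε, hreveals⟩ := exists_coinLaw_not_revealsSize_le model
  set C₁ : ℝ := 16 * (K + 1)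
  set C₂ : ℕ := β * (3 * invAck (4 * (K + 1) ^ 2) + 259)
  refine ⟨Finset ℕ, denseCensus, isDenseCensus_denseCensus model.density_ge, K, β, max C₁ C₂, ε, hK,
    lt_max_of_lt_left (by positivity), hε, ?_⟩
  intro n est hn hest N P
  have hlog := one_le_log hest
  have hN : 1 ≤ N := Nat.ceil_pos.2 (by positivity)
  calc 1 - min ((n : ℝ) ^ (-ε)) (est ^ (-ε))
      ≤ 1 - (coinLaw n (model.coinCount N) (1 / est)).real {ω | ¬ RevealsSize model N β est ω} :=
        sub_le_sub_left (hreveals n est hn hest) 1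
    _ = (coinLaw n (model.coinCount N) (1 / est)).real {ω | ¬ RevealsSize model N β est ω}ᶜ :=
        (MeasureTheory.probReal_compl_eq_one_sub (Set.toFinite _).measurableSet).symm
    _ ≤ _ := MeasureTheory.measureReal_mono fun ω hω => ?_
  obtain ⟨hnear, hfar⟩ := not_not.1 hω
  refine ⟨model.testTime N, ?_, exists_outputAt_testNetworkSize ω, fun i => ?_,
    fun h => leaderElected_testNetworkSize hN (hnear h),
    fun h => noLeaderElected_testNetworkSize (hfar h)⟩
  · exact (testTime_ceil_le model hK hest).trans (by gcongr; exact le_max_left _ _)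
  · calc (P.energy model ω (model.testTime N) i : ℝ) ≤ C₂ * invAck est := by
          exact_mod_cast (energy_testNetworkSize_le ω i).trans (energy_ceil_log_le β hK hest)
      _ ≤ max C₁ C₂ * invAck est := by gcongr; exact le_max_right _ _
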